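/- **Setting.** For $n\ge 3$ let $G_1$ be the travelling salesman instance on the vertices $V=\{1,\dots,n\}$ in which the edges $\{i,i+1\}$ ($1\le i<n$) and $\{n,1\}$ have distance $1$ and all other edges of the complete graph (edge set $E$) have distance $n$. The cost $f(s)$ of a Hamiltonian cycle $s$ is the sum of the distances of its edges. The cycle $s^*=(1,2,\dots,n)$ is the unique optimal solution. The following cross-entropy algorithm with sample size $N=N(n)\in\mathbb N$ is run. Start with $\pi^0_{i,j}=\frac1{n-1}$ for $i\ne j$. In iteration $t=0,1,2,\dots$ draw $N$ independent random Hamiltonian cycles from $\Pi_t=(\pi^t_{i,j})$ by one of the two generation methods below, sort them by non-decreasing cost (ties are broken arbitrarily, possibly at random or depending on the past), and let $X_t$ be the first one (elite size $M=1$, smoothing parameter $\rho=1$). Put $w_{i,j}=1$ if $\{i,j\}\in X_t$ and $w_{i,j}=0$ otherwise, and let $\pi^{t+1}_{i,j}$ ($i\neq j$) be $w_{i,j}$ reset to the nearest point of $[\pi_{\min},\pi_{\max}]$, where $\pi_{\min}=\frac1{n(n-2)}$ and $\pi_{\max}=1-\frac1n$; diagonal entries are $0$. *Vertex-based generation.*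 Choose the first vertex uniformly at random; then repeatedly continue from the current vertex $v$ to an unvisited vertex $v'$ with probability $\pi_{v,v'}/\sum_{k\text{ unvisited}}\pi_{v,k}$, until all vertices are visited; the cycle is then closed. *Edge-based generation.* Start with $B=\emptyset$ and repeatedly add to $B$ an edge $\{i,j\}\notin B$ that is admissible (i.e. $(V,B\cup\{\{i,j\}\})$ has no cycle and no vertex of degree $\ge3$), chosen among the admissible edges with probability proportional to $\pi_{i,j}+\pi_{j,i}$. After $n-1$ choices $B$ is a Hamiltonian path, which is closed by the edge joining its end points. The *runtime* is the number of solutions that are drawn until the optimal solution is drawn for the first time (inclusive). "With probability $1-n^{-\omega(1)}$" means: with probability at least $1-n^{-g(n)}$ for all large $n$, for some function $g(n)\to\infty$. **Corollary.** Let $N\in\omega(\ln n)$, i.e. $N(n)/\ln n\to\infty$. a) With vertex-based generation, $s^*$ is found within $n^6$ iterations with probability $1-n^{-\omega(1)}$. In particular, if $N=(\ln n)^2$ (rounded down or up to an integer), the runtime is at most $n^6(\ln n)^2$ with probability $1-n^{-\omega(1)}$. b) With edge-based generation, $s^*$ is found within $n^3\ln n$ iterations with probability $1-n^{-\omega(1)}$.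 In particular, if $N=(\ln n)^2$ (rounded down or up to an integer), the runtime is at most $n^3(\ln n)^3$ with probability $1-n^{-\omega(1)}$. -/

import Mathlib

open Filter Topology

noncomputable section

namespace CrossEntropyTSP

/-! ### Tours, cost, optimality. Vertices are `0, …, n - 1`. -/

/-- The edges of the closed walk through the vertices of `l` in the given order. -/
def tourEdges {n : ℕ} (l : List (Fin n)) : Finset (Sym2 (Fin n)) :=
  (List.zipWith (fun i j => s(i, j)) l (l.rotate 1)).toFinset

/-- `s` is (the edge set of) a Hamiltonian cycle. Two permutations of the vertices are the
same solution iff they have the same edge set. -/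
def IsTour {n : ℕ} (s : Finset (Sym2 (Fin n))) : Prop :=
  ∃ l : List (Fin n), l.Nodup ∧ l.length = n ∧ tourEdges l = s

/-- Total travelling cost. -/
def cost {n : ℕ} (d : Sym2 (Fin n) → ℝ) (s : Finset (Sym2 (Fin n))) : ℝ :=
  ∑ e ∈ s, d e

/-- `s` is a Hamiltonian cycle of minimum cost. -/
def IsOptimal {n : ℕ} (d : Sym2 (Fin n) → ℝ) (s : Finset (Sym2 (Fin n))) : Prop :=
  IsTour s ∧ ∀ s', IsTour s' → cost d s ≤ cost d s'

open Classical in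
/-- The distance function of the instance `G₁`: the edges `{i, i + 1}` and `{n, 1}` have
distance `1`, all other edges distance `n`. -/
def g1Dist (n : ℕ) (e : Sym2 (Fin n)) : ℝ :=
  if ∃ i j : Fin n, e = s(i, j) ∧ (i.val + 1) % n = j.val then 1 else n

/-- The cycle `(1, 2, …, n)`. -/
def g1Optimum (n : ℕ) : Finset (Sym2 (Fin n)) := tourEdges (List.finRange n)

/-! ### Random choices -/

open Classical in
/-- Choose `a ∈ s` with probability `w a / ∑ b ∈ s, w b` and move on to `next a`. If the total
weight is zero (so that no choice is possible), the result is `stuck`. -/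
def weightedChoice {α β : Type} [Fintype α] (s : Finset α) (w : α → ℝ)
    (next : α → β) (stuck : β) : PMF β :=
  if h : (∑' a, if a ∈ s then ENNReal.ofReal (w a) else 0) ≠ 0 then
    (PMF.normalize (fun a => if a ∈ s then ENNReal.ofReal (w a) else 0) h (by
      rw [tsum_fintype]
      refine ENNReal.sum_ne_top.2 fun a _ => ?_
      split_ifs
      · exact ENNReal.ofReal_ne_top
      · exact ENNReal.zero_ne_top)).map next
  else PMF.pure stuck

/-- `k` successive random steps. -/
def iterSteps {α : Type} (step : α → PMF α) : ℕ → α → PMF α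
  | 0, a => PMF.pure a
  | k + 1, a => (step a).bind (iterSteps step k)

/-- `N` independent draws from `p`. -/
def iid {α : Type} (p : PMF α) : (N : ℕ) → PMF (Fin N → α)
  | 0 => PMF.pure Fin.elim0
  | N + 1 => p.bind fun a => (iid p N).map fun x => Fin.cons a x

/-! ### Vertex-based random solution generation -/

/-- One step: the first vertex is uniformly random; afterwards the current vertex `v` (the head
of the list) is followed by an unvisited vertex `v'` with probability proportional to
`P v v'`. -/
def vertexStep {n : ℕ} (P : Fin n → Fin n → ℝ) : List (Fin n) → PMF (List (Fin n))
  | [] => weightedChoice Finset.univ (fun _ => 1) (fun v => [v]) []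
  | v :: l => weightedChoice (Finset.univ.filter fun v' => v' ∉ v :: l) (P v)
      (fun v' => v' :: v :: l) (v :: l)

/-- The Hamiltonian cycle obtained after all `n` vertices have been visited. -/
def vertexGen {n : ℕ} (P : Fin n → Fin n → ℝ) : PMF (Finset (Sym2 (Fin n))) :=
  (iterSteps (vertexStep P) n []).map tourEdges

/-! ### Edge-based random solution generation -/

/-- The degree of `v` in the graph with edge set `B`. -/
def degreeIn {n : ℕ} (B : Finset (Sym2 (Fin n))) (v : Fin n) : ℕ :=
  (B.filter fun e => v ∈ e).card

open Classical in
/-- The edges `e ∉ B` for which `B ∪ {e}` has neither a cycle nor a vertex of degree `≥ 3`. -/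
def admissible {n : ℕ} (B : Finset (Sym2 (Fin n))) : Finset (Sym2 (Fin n)) :=
  Finset.univ.filter fun e => ¬ e.IsDiag ∧ e ∉ B ∧
    (SimpleGraph.fromEdgeSet (↑(insert e B) : Set (Sym2 (Fin n)))).IsAcyclic ∧
    ∀ v, degreeIn (insert e B) v ≤ 2

/-- The weight `P i j + P j i` of the edge `{i, j}`. -/
def edgeWeight {n : ℕ} (P : Fin n → Fin n → ℝ) : Sym2 (Fin n) → ℝ :=
  Sym2.lift ⟨fun i j => P i j + P j i, fun _ _ => add_comm _ _⟩

/-- One step: add an admissible edge, chosen with probability proportional to its weight. -/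
def edgeStep {n : ℕ} (P : Fin n → Fin n → ℝ) (B : Finset (Sym2 (Fin n))) :
    PMF (Finset (Sym2 (Fin n))) :=
  weightedChoice (admissible B) (edgeWeight P) (fun e => insert e B) B

/-- Add the edge that joins the two end points of a Hamiltonian path. -/
def closeTour {n : ℕ} (B : Finset (Sym2 (Fin n))) : Finset (Sym2 (Fin n)) :=
  B ∪ Finset.univ.filter fun e => ¬ e.IsDiag ∧ ∀ v ∈ e, degreeIn B v = 1

/-- After `n - 1` choices the selected edges form a Hamiltonian path, and the last edge of the
Hamiltonian cycle is determined. -/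
def edgeGen {n : ℕ} (P : Fin n → Fin n → ℝ) : PMF (Finset (Sym2 (Fin n))) :=
  (iterSteps (edgeStep P) (n - 1) ∅).map closeTour

/-! ### The cross-entropy algorithm with max-min calibration -/

/-- What happens in one iteration: the sample `X^(1), …, X^(N)` in the order in which it is
drawn, and a permutation that sorts it. -/
abbrev Iteration (n N : ℕ) : Type := (Fin N → Finset (Sym2 (Fin n))) × Equiv.Perm (Fin N)

/-- A way to sort the sample by non-decreasing cost. How ties are broken is left open: this may
be random and may depend on all previous iterations. -/
structure SortRule {n : ℕ} (d : Sym2 (Fin n) → ℝ) (N : ℕ) where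
  order : List (Iteration n N) → (Fin N → Finset (Sym2 (Fin n))) → PMF (Equiv.Perm (Fin N))
  sorted : ∀ past x τ, τ ∈ (order past x).support → Monotone fun k => cost d (x (τ k))

/-- The empirical distribution `W` of the `M` best solutions of an iteration. -/
def empirical {n N : ℕ} (M : ℕ) (r : Iteration n N) (i j : Fin n) : ℝ :=
  (∑ k : Fin N, if k.val < M ∧ s(i, j) ∈ r.1 (r.2 k) then (1 : ℝ) else 0) / M

/-- Reset the entries that belong to edges to the nearest point of `[pmin, pmax]`. -/
def calibrate {n : ℕ} (pmin pmax : ℝ) (P : Fin n → Fin n → ℝ) (i j : Fin n) : ℝ :=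
  if i = j then 0
  else if P i j < pmin then pmin
  else if pmax < P i j then pmax
  else P i j

/-- One iteration, acting on the current distribution and the list of past iterations (in
chronological order). -/
def ceStep {n N : ℕ} {d : Sym2 (Fin n) → ℝ}
    (gen : (Fin n → Fin n → ℝ) → PMF (Finset (Sym2 (Fin n)))) (srt : SortRule d N)
    (ρ : ℝ) (M : ℕ) (pmin pmax : ℝ) (st : (Fin n → Fin n → ℝ) × List (Iteration n N)) :
    PMF ((Fin n → Fin n → ℝ) × List (Iteration n N)) :=
  (iid (gen st.1) N).bind fun x => (srt.order st.2 x).map fun τ =>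
    (calibrate pmin pmax (fun i j => (1 - ρ) * st.1 i j + ρ * empirical M (x, τ) i j),
      st.2 ++ [(x, τ)])

/-- The initial distribution: uniform. -/
def initial (n : ℕ) (i j : Fin n) : ℝ := if i = j then 0 else 1 / ((n : ℝ) - 1)

/-- The law of the first `K` iterations. -/
def ceRun {n N : ℕ} {d : Sym2 (Fin n) → ℝ}
    (gen : (Fin n → Fin n → ℝ) → PMF (Finset (Sym2 (Fin n)))) (srt : SortRule d N)
    (ρ : ℝ) (M : ℕ) (pmin pmax : ℝ) (K : ℕ) : PMF (List (Iteration n N)) :=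
  (iterSteps (ceStep gen srt ρ M pmin pmax) K (initial n, [])).map Prod.snd

/-- All evaluated solutions, in the order of their evaluation. -/
def evaluated {n N : ℕ} (h : List (Iteration n N)) : List (Finset (Sym2 (Fin n))) :=
  h.flatMap fun r => List.ofFn r.1

/-- The probability that an optimal solution is sampled within the first `K` iterations, for
`M = 1`, `ρ = 1`, `π_min = 1 / (n (n - 2))`, `π_max = 1 - 1 / n`. -/
def probIterations {n N : ℕ} {d : Sym2 (Fin n) → ℝ}
    (gen : (Fin n → Fin n → ℝ) → PMF (Finset (Sym2 (Fin n)))) (srt : SortRule d N)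
    (K : ℕ) : ℝ :=
  ((ceRun gen srt 1 1 (1 / ((n : ℝ) * ((n : ℝ) - 2))) (1 - 1 / (n : ℝ)) K).toOuterMeasure
    {h | ∃ s ∈ evaluated h, IsOptimal d s}).toReal

/-- The probability, for the same parameters, that an optimal solution is among the first `T`
evaluated solutions, i.e. that the runtime is at most `T`. (Each iteration evaluates `N ≥ 1`
solutions, so the first `T` iterations contain the first `T` evaluations.) -/
def probRuntime {n N : ℕ} {d : Sym2 (Fin n) → ℝ}
    (gen : (Fin n → Fin n → ℝ) → PMF (Finset (Sym2 (Fin n)))) (srt : SortRule d N)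
    (T : ℕ) : ℝ :=
  ((ceRun gen srt 1 1 (1 / ((n : ℝ) * ((n : ℝ) - 2))) (1 - 1 / (n : ℝ)) T).toOuterMeasure
    {h | ∃ s ∈ (evaluated h).take T, IsOptimal d s}).toReal

/-- `p n` is (at least) `1 - n ^ (-ω(1))`. -/
def AtLeastOneMinusSuperpoly (p : ℕ → ℝ) : Prop :=
  ∃ g : ℕ → ℝ, Tendsto g atTop atTop ∧ ∀ᶠ n : ℕ in atTop, 1 - (n : ℝ) ^ (-g n) ≤ p n

end CrossEntropyTSP

end

/-! The potential is `heavy`, the number k of edges of distance n in the current elite tour. A tour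
costs n + k(n - 1), so the elite solution of an iteration has the least k in its sample, however
ties are broken. With M = ρ = 1 the next distribution is `tourDist` of that tour, so after the first
iteration the sampling depends on the elite tour alone. Two estimates per generation method suffice
(`IsImproving`): from the calibration of T, one sample is no worse than T with probability at least
a constant c, and strictly better with probability at least p k.

Among N samples, "all are worse" has probability at most (1 - c)^N, and L k iterations without
leaving level k downwards have probability at most (1 - p k)^(N L k). If p k * L k ≥ γ and the
budgets L sum to at most n^7, a union bound over iterations and levels gives failure probability at
most n^8 exp(-γN) (`IsImproving.failure_le`), which is superpolynomially small as soon as N / ln n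
tends to infinity.

The combinatorial core is an exchange argument (`hasExchange`): a missing edge uv of the optimum can
be inserted into T at the price of at most three long edges, by a 2-exchange or a 3-exchange,
leaving a set contained in a Hamiltonian path. The same argument shows that an admissible edge added
to a proper subset of a tour again gives a proper subset of a tour (`IsLinear.insert`), so
edge-based generation never gets stuck and yields tours.

Vertex-based: after arriving along an edge of T the normalising sum is at most 1, so T is retraced
with constant probability. An improving path has at most two edges outside T, each costing a factor
of order n^(-2), and its first vertex costs 1/n. This gives p of order n^(-5), and n levels give n^6
iterations.

Edge-based: in one step the new edge e has probability of order n^(-3), but there are about n/2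
steps in which it may come, giving n^(-2). Kept edges a and b of T at the two ends of e are chosen
meanwhile with constant probability; they block the removed edges there, so at most one removed edge
still competes with the rest. Avoiding it costs 1/n, by a telescoping product of factors (r + 1)/(r
+ 2). Each of the k missing optimal edges thus contributes order n^(-3), and a sample is counted at
most three times; p k is of order k/n^3, and the harmonic sum gives n^3 ln n. -/

namespace CrossEntropyTSP

/-! ### Expectations of nonnegative functions -/

open scoped ENNReal

section Mean

variable {α β : Type}

/-- The expectation of `f` under `p`. -/
noncomputable def mean (p : PMF α) (f : α → ℝ≥0∞) : ℝ≥0∞ := ∑' a, p a * f a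

theorem mean_pure (a : α) (f : α → ℝ≥0∞) : mean (PMF.pure a) f = f a := by
  classical
  rw [mean, tsum_eq_single a]
  · simp
  · intro b hb
    simp [PMF.pure_apply, hb]

theorem mean_bind (p : PMF α) (q : α → PMF β) (f : β → ℝ≥0∞) :
    mean (p.bind q) f = mean p fun a => mean (q a) f := by
  simp only [mean, PMF.bind_apply, ← ENNReal.tsum_mul_right, ← ENNReal.tsum_mul_left]
  rw [ENNReal.tsum_comm]
  simp only [mul_assoc]

theorem mean_map (p : PMF α) (g : α → β) (f : β → ℝ≥0∞) :
    mean (p.map g) f = mean p fun a => f (g a) := by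
  rw [← PMF.bind_pure_comp, mean_bind]
  simp only [Function.comp, mean_pure]

theorem mean_mono {p : PMF α} {f g : α → ℝ≥0∞} (h : ∀ a ∈ p.support, f a ≤ g a) :
    mean p f ≤ mean p g := by
  refine ENNReal.tsum_le_tsum fun a => ?_
  by_cases ha : a ∈ p.support
  · gcongr
    exact h a ha
  · rw [PMF.mem_support_iff, not_not] at ha
    simp [ha]

theorem mean_congr {p : PMF α} {f g : α → ℝ≥0∞} (h : ∀ a ∈ p.support, f a = g a) :
    mean p f = mean p g :=
  le_antisymm (mean_mono fun a ha => (h a ha).le) (mean_mono fun a ha => (h a ha).ge)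

theorem mean_const (p : PMF α) (c : ℝ≥0∞) : mean p (fun _ => c) = c := by
  rw [mean, ENNReal.tsum_mul_right, p.tsum_coe, one_mul]

theorem mean_add (p : PMF α) (f g : α → ℝ≥0∞) :
    mean p (fun a => f a + g a) = mean p f + mean p g := by
  simp only [mean, mul_add]
  exact ENNReal.tsum_add

theorem mean_const_mul (p : PMF α) (c : ℝ≥0∞) (f : α → ℝ≥0∞) :
    mean p (fun a => c * f a) = c * mean p f := by
  simp only [mean, ← ENNReal.tsum_mul_left]
  exact tsum_congr fun a => mul_left_comm _ _ _

theorem mean_mul_const (p : PMF α) (c : ℝ≥0∞) (f : α → ℝ≥0∞) :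
    mean p (fun a => f a * c) = mean p f * c := by
  simp only [mul_comm _ c, mean_const_mul]

theorem mean_sum {ι : Type} (s : Finset ι) (p : PMF α) (f : ι → α → ℝ≥0∞) :
    mean p (fun a => ∑ i ∈ s, f i a) = ∑ i ∈ s, mean p (f i) := by
  classical
  induction s using Finset.induction_on with
  | empty => simp [mean]
  | insert i s hi ih => simp only [Finset.sum_insert hi, mean_add, ih]

/-- The probability of an event. -/
noncomputable def prob (p : PMF α) (S : α → Prop) : ℝ≥0∞ := mean p ({a | S a}.indicator 1)

theorem prob_eq_toOuterMeasure (p : PMF α) (S : α → Prop) :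
    prob p S = p.toOuterMeasure {a | S a} := by
  rw [PMF.toOuterMeasure_apply, prob, mean]
  refine tsum_congr fun a => ?_
  by_cases h : S a <;> simp [h]

theorem prob_mono {p : PMF α} {S T : α → Prop} (h : ∀ a ∈ p.support, S a → T a) :
    prob p S ≤ prob p T := by
  refine mean_mono fun a ha => ?_
  by_cases hS : S a
  · simp [hS, h a ha hS]
  · simp [hS]

theorem prob_le_one (p : PMF α) (S : α → Prop) : prob p S ≤ 1 := by
  refine (mean_mono (g := fun _ => 1) fun a _ => ?_).trans (mean_const p 1).le
  by_cases hS : S a <;> simp [hS]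

theorem prob_add_prob_not (p : PMF α) (S : α → Prop) :
    prob p S + prob p (fun a => ¬ S a) = 1 := by
  rw [prob, prob, ← mean_add]
  refine (mean_congr (g := fun _ => 1) fun a _ => ?_).trans (mean_const p 1)
  by_cases hS : S a <;> simp [hS]

theorem prob_map (p : PMF α) (g : α → β) (S : β → Prop) :
    prob (p.map g) S = prob p fun a => S (g a) :=
  mean_map p g _

theorem prob_bind (p : PMF α) (q : α → PMF β) (S : β → Prop) :
    prob (p.bind q) S = mean p fun a => prob (q a) S :=
  mean_bind p q _

theorem prob_pure_of {a : α} {S : α → Prop} (h : S a) : prob (PMF.pure a) S = 1 := by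
  rw [prob, mean_pure, Set.indicator_of_mem (by exact h), Pi.one_apply]

theorem prob_not_le {p : PMF α} {S : α → Prop} {c : ℝ} (hc : 0 ≤ c)
    (h : ENNReal.ofReal c ≤ prob p S) : prob p (fun a => ¬ S a) ≤ ENNReal.ofReal (1 - c) := by
  have h1 := prob_add_prob_not p S
  have h2 : prob p (fun a => ¬ S a) = 1 - prob p S := by
    rw [← h1, ENNReal.add_sub_cancel_left]
    exact ne_top_of_le_ne_top ENNReal.one_ne_top (prob_le_one p S)
  rw [h2, ENNReal.ofReal_sub _ hc, ENNReal.ofReal_one]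
  gcongr

/-! ### The building blocks of the random processes -/

variable [Fintype α]

/-- Bridge from `ENNReal` to the reals: the real function g bounds f after the choice from below,
and the normalising sum is moved to the left of the hypothesis, so that every one-step estimate
becomes an inequality between finite real sums. -/
theorem ofReal_le_mean_weightedChoice {s : Finset α} {w g : α → ℝ} {next : α → β} {stuck : β}
    {f : β → ℝ≥0∞} {c : ℝ} (hw : ∀ a ∈ s, 0 ≤ w a) (hpos : 0 < ∑ a ∈ s, w a)
    (hg : ∀ a ∈ s, 0 ≤ g a) (hf : ∀ a ∈ s, ENNReal.ofReal (g a) ≤ f (next a))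
    (h : c * ∑ a ∈ s, w a ≤ ∑ a ∈ s, w a * g a) :
    ENNReal.ofReal c ≤ mean (weightedChoice s w next stuck) f := by
  classical
  have hsum : (∑' a, if a ∈ s then ENNReal.ofReal (w a) else 0) =
      ENNReal.ofReal (∑ a ∈ s, w a) := by
    rw [tsum_fintype, ENNReal.ofReal_sum_of_nonneg hw, Finset.sum_ite_mem, Finset.univ_inter]
  have hne : (∑' a, if a ∈ s then ENNReal.ofReal (w a) else 0) ≠ 0 := by
    rw [hsum]
    simpa using hpos
  rw [weightedChoice, dif_pos (by convert hne), mean_map, mean]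
  simp only [PMF.normalize_apply]
  have h1 : (∑' a, if a ∈ s then ENNReal.ofReal (w a) else 0)⁻¹ *
      ENNReal.ofReal (∑ a ∈ s, w a * g a) ≤
      ∑' a, (if a ∈ s then ENNReal.ofReal (w a) else 0) *
        (∑' a, if a ∈ s then ENNReal.ofReal (w a) else 0)⁻¹ * f (next a) := by
    rw [ENNReal.ofReal_sum_of_nonneg fun a ha => mul_nonneg (hw a ha) (hg a ha), Finset.mul_sum]
    refine (Finset.sum_le_sum fun a ha => ?_).trans (ENNReal.sum_le_tsum s)
    rw [if_pos ha, ENNReal.ofReal_mul (hw a ha), ← mul_assoc,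
      mul_comm _ (ENNReal.ofReal (w a))]
    gcongr
    exact hf a ha
  refine le_trans ?_ (by convert h1)
  rw [hsum, ← ENNReal.ofReal_inv_of_pos hpos, ← ENNReal.ofReal_mul (inv_nonneg.2 hpos.le)]
  refine ENNReal.ofReal_le_ofReal ?_
  rw [inv_mul_eq_div, le_div_iff₀ hpos]
  exact h

theorem exists_of_mem_support_weightedChoice {s : Finset α} {w : α → ℝ} {next : α → β}
    {stuck b : β} (hpos : ∃ a ∈ s, 0 < w a) (hb : b ∈ (weightedChoice s w next stuck).support) :
    ∃ a ∈ s, b = next a := by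
  classical
  have hne : (∑' a, if a ∈ s then ENNReal.ofReal (w a) else 0) ≠ 0 := by
    obtain ⟨a, ha, hwa⟩ := hpos
    rw [ENNReal.summable.tsum_ne_zero_iff]
    exact ⟨a, by simpa [ha] using hwa⟩
  rw [weightedChoice, dif_pos (by convert hne), PMF.mem_support_map_iff] at hb
  obtain ⟨a, ha, rfl⟩ := hb
  rw [PMF.mem_support_normalize_iff] at ha
  refine ⟨a, ?_, rfl⟩
  by_contra has
  simp [has] at ha

end Mean

/-! ### Iterated steps and independent samples -/

section Steps

variable {α : Type}

theorem iterSteps_add (step : α → PMF α) (k l : ℕ) (a : α) :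
    iterSteps step (k + l) a = (iterSteps step k a).bind (iterSteps step l) := by
  induction k generalizing a with
  | zero => simp [iterSteps]
  | succ k ih =>
    rw [Nat.add_right_comm]
    simp only [iterSteps, PMF.bind_bind]
    congr 1
    funext b
    exact ih b

theorem iterSteps_one (step : α → PMF α) (a : α) : iterSteps step 1 a = step a := by
  simp only [iterSteps]
  exact PMF.bind_pure _

theorem iterSteps_succ' (step : α → PMF α) (k : ℕ) (a : α) :
    iterSteps step (k + 1) a = (iterSteps step k a).bind step := by
  rw [iterSteps_add]
  congr 1
  funext b
  exact iterSteps_one step b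

/-- A property that holds after `k` steps whenever `I` is an invariant indexed by time. -/
theorem iterSteps_support {step : α → PMF α} {I : ℕ → α → Prop} {K : ℕ}
    (hI : ∀ k < K, ∀ a, I k a → ∀ b ∈ (step a).support, I (k + 1) b) {a : α} (h0 : I 0 a) :
    ∀ k ≤ K, ∀ b ∈ (iterSteps step k a).support, I k b := by
  intro k
  induction k with
  | zero =>
    intro _ b hb
    simp only [iterSteps, PMF.support_pure, Set.mem_singleton_iff] at hb
    rwa [hb]
  | succ k ih =>
    intro hk b hb
    rw [iterSteps_succ', PMF.mem_support_bind_iff] at hb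
    obtain ⟨c, hc, hb⟩ := hb
    exact hI k hk c (ih (by lia) c hc) b hb

theorem prob_iid_forall (p : PMF α) (S : α → Prop) (N : ℕ) :
    prob (iid p N) (fun x => ∀ i, S (x i)) = prob p S ^ N := by
  induction N with
  | zero => rw [pow_zero, iid, prob_pure_of fun i => i.elim0]
  | succ N ih =>
    rw [iid, prob_bind, pow_succ', ← ih, prob, ← mean_mul_const]
    refine mean_congr fun a _ => ?_
    rw [prob_map, prob, prob, ← mean_const_mul]
    refine mean_congr fun x _ => ?_
    have h : (∀ i, S ((Fin.cons a x : Fin (N + 1) → α) i)) ↔ S a ∧ ∀ i, S (x i) := by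
      simp [Fin.forall_fin_succ]
    by_cases hS : S a <;> by_cases hx : ∀ i, S (x i) <;> simp [hS, hx, h]

theorem iid_support {p : PMF α} {N : ℕ} {x : Fin N → α} (hx : x ∈ (iid p N).support) (i : Fin N) :
    x i ∈ p.support := by
  induction N with
  | zero => exact i.elim0
  | succ N ih =>
    simp only [iid, PMF.mem_support_bind_iff, PMF.mem_support_map_iff] at hx
    obtain ⟨a, ha, y, hy, rfl⟩ := hx
    refine Fin.cases ?_ (fun j => ?_) i
    · simpa using ha
    · simpa using ih hy j

end Steps

end CrossEntropyTSP

namespace CrossEntropyTSP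

/-! ### Edges of walks and tours -/

section Walks

variable {n : ℕ}

/-- The edges of the walk through the vertices of a list. -/
def walkEdges : List (Fin n) → Finset (Sym2 (Fin n))
  | [] => ∅
  | [_] => ∅
  | x :: y :: l => insert s(x, y) (walkEdges (y :: l))

theorem walkEdges_cons_cons (x y : Fin n) (l : List (Fin n)) :
    walkEdges (x :: y :: l) = insert s(x, y) (walkEdges (y :: l)) := rfl

theorem walkEdges_singleton (x : Fin n) : walkEdges [x] = ∅ := rfl

theorem tourEdges_cons (x : Fin n) (t : List (Fin n)) :
    tourEdges (x :: t) = walkEdges (x :: (t ++ [x])) := by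
  have : ∀ (t : List (Fin n)) (y z : Fin n),
      (List.zipWith (fun i j => s(i, j)) (y :: t) (t ++ [z])).toFinset =
        walkEdges (y :: (t ++ [z])) := by
    intro t
    induction t with
    | nil => intro y z; simp [walkEdges]
    | cons a t ih =>
      intro y z
      have := ih a z
      simp only [List.cons_append, List.zipWith_cons_cons, List.toFinset_cons,
        walkEdges_cons_cons] at this ⊢
      rw [this]
  rw [tourEdges, List.rotate_cons_succ, List.rotate_zero]
  exact this t x x

theorem walkEdges_append (l₁ : List (Fin n)) (x : Fin n) (l₂ : List (Fin n)) :
    walkEdges (l₁ ++ x :: l₂) = walkEdges (l₁ ++ [x]) ∪ walkEdges (x :: l₂) := by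
  induction l₁ with
  | nil => simp [walkEdges]
  | cons a l ih =>
    cases l with
    | nil => simp [walkEdges]
    | cons b l =>
      simp only [List.cons_append, walkEdges_cons_cons, Finset.insert_union] at ih ⊢
      rw [ih]

theorem walkEdges_concat_concat (l : List (Fin n)) (x y : Fin n) :
    walkEdges (l ++ [x, y]) = insert s(x, y) (walkEdges (l ++ [x])) := by
  rw [walkEdges_append, walkEdges_cons_cons, walkEdges_singleton]
  ext e
  simp

theorem walkEdges_reverse (l : List (Fin n)) : walkEdges l.reverse = walkEdges l := by
  induction l with
  | nil => rfl
  | cons x l ih =>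
    cases l with
    | nil => rfl
    | cons y l =>
      rw [walkEdges_cons_cons, ← ih]
      simp only [List.reverse_cons, List.append_assoc, List.cons_append, List.nil_append]
      rw [walkEdges_concat_concat, Sym2.eq_swap]

theorem mem_of_mem_walkEdges {l : List (Fin n)} {e : Sym2 (Fin n)} (he : e ∈ walkEdges l)
    {v : Fin n} (hv : v ∈ e) : v ∈ l := by
  induction l with
  | nil => simp [walkEdges] at he
  | cons x l ih =>
    cases l with
    | nil => simp [walkEdges] at he
    | cons y l =>
      rw [walkEdges_cons_cons, Finset.mem_insert] at he
      rcases he with rfl | he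
      · rcases Sym2.mem_iff.1 hv with rfl | rfl <;> simp
      · exact List.mem_cons_of_mem _ (ih he)

theorem exists_append_of_mem_walkEdges {l : List (Fin n)} {e : Sym2 (Fin n)}
    (he : e ∈ walkEdges l) : ∃ l₁ x y l₂, l = l₁ ++ x :: y :: l₂ ∧ e = s(x, y) := by
  induction l with
  | nil => simp [walkEdges] at he
  | cons x l ih =>
    cases l with
    | nil => simp [walkEdges] at he
    | cons y l =>
      rw [walkEdges_cons_cons, Finset.mem_insert] at he
      rcases he with rfl | he
      · exact ⟨[], x, y, l, rfl, rfl⟩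
      · obtain ⟨l₁, a, b, l₂, h, h'⟩ := ih he
        exact ⟨x :: l₁, a, b, l₂, by rw [h]; rfl, h'⟩

theorem card_walkEdges {x : Fin n} {l : List (Fin n)} (hl : (x :: l).Nodup) :
    (walkEdges (x :: l)).card = l.length := by
  induction l generalizing x with
  | nil => rfl
  | cons y l ih =>
    rw [walkEdges_cons_cons, Finset.card_insert_of_notMem, ih hl.of_cons, List.length_cons]
    intro h
    exact (List.nodup_cons.1 hl).1 (mem_of_mem_walkEdges h (Sym2.mem_mk_left x y))

theorem adj_fromEdgeSet_iff {B : Finset (Sym2 (Fin n))} {x y : Fin n} :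
    (SimpleGraph.fromEdgeSet (B : Set (Sym2 (Fin n)))).Adj x y ↔ s(x, y) ∈ B ∧ x ≠ y := by
  simp

theorem reachable_of_walkEdges_subset {B : Finset (Sym2 (Fin n))} {l : List (Fin n)}
    {x y : Fin n} (h : walkEdges (x :: (l ++ [y])) ⊆ B) :
    (SimpleGraph.fromEdgeSet (B : Set (Sym2 (Fin n)))).Reachable x y := by
  have hadj : ∀ x y, s(x, y) ∈ B →
      (SimpleGraph.fromEdgeSet (B : Set (Sym2 (Fin n)))).Reachable x y := by
    intro x y hxy
    by_cases hne : x = y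
    · rw [hne]
    · exact (adj_fromEdgeSet_iff.2 ⟨hxy, hne⟩).reachable
  induction l generalizing x with
  | nil => exact hadj x y (h (by simp [walkEdges]))
  | cons z l ih =>
    rw [List.cons_append, walkEdges_cons_cons, Finset.insert_subset_iff] at h
    exact (hadj x z h.1).trans (ih h.2)

/-- The head of the list is isolated in the graph of the tail, so joining it to the next vertex
closes no cycle. -/
theorem isAcyclic_walkEdges {l : List (Fin n)} (hl : l.Nodup) :
    (SimpleGraph.fromEdgeSet (walkEdges l : Set (Sym2 (Fin n)))).IsAcyclic := by
  induction l with
  | nil => simp [walkEdges]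
  | cons x l ih =>
    cases l with
    | nil => simp [walkEdges]
    | cons y l =>
      have hx : x ∉ y :: l := (List.nodup_cons.1 hl).1
      have h : ¬ (SimpleGraph.fromEdgeSet
          (walkEdges (y :: l) : Set (Sym2 (Fin n)))).Reachable x y := by
        intro hr
        have hxy : x ≠ y := by
          rintro rfl
          simp at hx
        obtain ⟨w⟩ := hr
        cases w with
        | nil => exact hxy rfl
        | cons hadj _ =>
          exact hx (mem_of_mem_walkEdges (adj_fromEdgeSet_iff.1 hadj).1 (Sym2.mem_mk_left _ _))
      have := SimpleGraph.IsAcyclic.sup_edge_of_not_reachable h (ih hl.of_cons)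
      convert this using 1
      ext a b
      simp [walkEdges_cons_cons, SimpleGraph.edge_adj]
      tauto

theorem isAcyclic_mono {B C : Finset (Sym2 (Fin n))} (h : B ⊆ C)
    (hC : (SimpleGraph.fromEdgeSet (C : Set (Sym2 (Fin n)))).IsAcyclic) :
    (SimpleGraph.fromEdgeSet (B : Set (Sym2 (Fin n)))).IsAcyclic :=
  hC.anti (SimpleGraph.fromEdgeSet_mono (by exact_mod_cast h))

/-- A tour can be traversed from any of its vertices. -/
theorem IsTour.exists_cons {T : Finset (Sym2 (Fin n))} (hT : IsTour T) (u : Fin n) :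
    ∃ t, (u :: t).Nodup ∧ (u :: t).length = n ∧ T = walkEdges (u :: (t ++ [u])) := by
  obtain ⟨l, hl, hn, rfl⟩ := hT
  have hu : u ∈ l := by
    have : l.toFinset = Finset.univ := by
      apply Finset.eq_univ_of_card
      rw [List.toFinset_card_of_nodup hl, hn, Fintype.card_fin]
    rw [← List.mem_toFinset, this]
    exact Finset.mem_univ _
  obtain ⟨l₁, l₂, rfl⟩ := List.append_of_mem hu
  refine ⟨l₂ ++ l₁, ?_, ?_, ?_⟩
  · have := List.nodup_append_comm.1 hl
    simpa using this
  · simp at hn ⊢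
    lia
  · cases l₁ with
    | nil => rw [List.nil_append, tourEdges_cons, List.append_nil]
    | cons x l₁ =>
      rw [List.cons_append, tourEdges_cons]
      have h1 : x :: (l₁ ++ u :: l₂ ++ [x]) = (x :: l₁) ++ u :: (l₂ ++ [x]) := by simp
      have h2 : u :: (l₂ ++ x :: l₁ ++ [u]) = (u :: l₂) ++ x :: (l₁ ++ [u]) := by simp
      rw [h1, h2, walkEdges_append, walkEdges_append (u :: l₂), Finset.union_comm]
      simp

theorem isTour_of_walk {x : Fin n} {t : List (Fin n)} (h : (x :: t).Nodup)
    (hn : (x :: t).length = n) : IsTour (walkEdges (x :: (t ++ [x]))) :=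
  ⟨x :: t, h, hn, tourEdges_cons x t⟩

/-- Any edge of a tour can be taken as the closing edge. -/
theorem IsTour.exists_closing (hn : 3 ≤ n) {T : Finset (Sym2 (Fin n))} (hT : IsTour T)
    {x y : Fin n} (h : s(x, y) ∈ T) :
    ∃ m, (x :: (m ++ [y])).Nodup ∧ (x :: (m ++ [y])).length = n ∧
      s(x, y) ∉ walkEdges (x :: (m ++ [y])) ∧
      T = insert s(x, y) (walkEdges (x :: (m ++ [y]))) := by
  obtain ⟨t, ht, hlen, rfl⟩ := hT.exists_cons x
  obtain ⟨a, m, b, rfl⟩ : ∃ a m b, t = a :: (m ++ [b]) := by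
    cases t with
    | nil => simp at hlen; lia
    | cons a t =>
      rcases List.eq_nil_or_concat t with rfl | ⟨m, b, rfl⟩
      · simp at hlen; lia
      · exact ⟨a, m, b, by simp⟩
  have key : ∀ (a b : Fin n) (m : List (Fin n)), (x :: a :: (m ++ [b])).Nodup →
      s(x, b) ∉ walkEdges (x :: ((a :: m) ++ [b])) ∧
      walkEdges (x :: (a :: (m ++ [b]) ++ [x])) =
        insert s(x, b) (walkEdges (x :: ((a :: m) ++ [b]))) := by
    intro a b m h
    constructor
    · rw [List.cons_append, walkEdges_cons_cons, Finset.mem_insert]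
      rintro (h' | h')
      · simp at h h'
        rcases h' with h' | h' <;> simp_all
      · exact (List.nodup_cons.1 h).1 (mem_of_mem_walkEdges h' (Sym2.mem_mk_left x b))
    · have : x :: (a :: (m ++ [b]) ++ [x]) = (x :: a :: m) ++ [b, x] := by simp
      rw [this, walkEdges_concat_concat, Sym2.eq_swap]
      rfl
  have hx : x ∉ a :: (m ++ [b]) := (List.nodup_cons.1 ht).1
  have hyb : y = b ∨ y = a := by
    rw [(key a b m ht).2, Finset.mem_insert, List.cons_append, walkEdges_cons_cons,
      Finset.mem_insert] at h
    rcases h with h | h | h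
    · exact Or.inl (Sym2.congr_right.1 h)
    · exact Or.inr (Sym2.congr_right.1 h)
    · exact (hx (mem_of_mem_walkEdges h (Sym2.mem_mk_left x y))).elim
  -- The neighbour y of x is either the last or the first vertex of the remaining walk; in the
  -- second case the tour is traversed backwards.
  rcases hyb with rfl | rfl
  · exact ⟨a :: m, ht, hlen, (key a y m ht).1, (key a y m ht).2⟩
  · have hr : (x :: b :: (m.reverse ++ [y])).Nodup := by
      have := List.nodup_reverse.2 ht.of_cons
      rw [List.nodup_cons] at ht ⊢
      constructor
      · intro hmem
        apply ht.1
        simp at hmem ⊢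
        tauto
      · simpa using this
    refine ⟨b :: m.reverse, hr, by simpa using hlen, (key b y m.reverse hr).1, ?_⟩
    rw [← (key b y m.reverse hr).2, ← walkEdges_reverse]
    simp

theorem card_tour (hn : 3 ≤ n) {T : Finset (Sym2 (Fin n))} (hT : IsTour T) : T.card = n := by
  obtain ⟨t, ht, hlen, h⟩ := hT.exists_cons ⟨0, by lia⟩
  have hne : T.Nonempty := by
    cases t with
    | nil => simp at hlen; lia
    | cons a t => rw [h, List.cons_append, walkEdges_cons_cons]; exact Finset.insert_nonempty _ _
  obtain ⟨e, he⟩ := hne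
  induction e with | h x y => ?_
  obtain ⟨m, hm, hlen, hnot, h⟩ := hT.exists_closing hn he
  rw [h, Finset.card_insert_of_notMem hnot, card_walkEdges hm]
  simp at hlen ⊢
  lia

theorem degreeIn_tour (hn : 3 ≤ n) {T : Finset (Sym2 (Fin n))} (hT : IsTour T) (v : Fin n) :
    degreeIn T v = 2 := by
  obtain ⟨t, ht, hlen, rfl⟩ := hT.exists_cons v
  obtain ⟨a, m, b, rfl⟩ : ∃ a m b, t = a :: (m ++ [b]) := by
    cases t with
    | nil => simp at hlen; lia
    | cons a t =>
      rcases List.eq_nil_or_concat t with rfl | ⟨m, b, rfl⟩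
      · simp at hlen; lia
      · exact ⟨a, m, b, by simp⟩
  have hv : v ∉ a :: (m ++ [b]) := (List.nodup_cons.1 ht).1
  have hab : a ≠ b := by
    have := (List.nodup_cons.1 ht.of_cons).1
    rintro rfl
    simp at this
  have h1 : v :: (a :: (m ++ [b]) ++ [v]) = (v :: a :: m) ++ [b, v] := by simp
  have h2 : walkEdges (v :: (a :: (m ++ [b]) ++ [v])) =
      insert s(v, b) (insert s(v, a) (walkEdges (a :: (m ++ [b])))) := by
    rw [h1, walkEdges_concat_concat, Sym2.eq_swap]
    rfl
  have h3 : (walkEdges (a :: (m ++ [b]))).filter (fun e => v ∈ e) = ∅ := by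
    rw [Finset.filter_eq_empty_iff]
    exact fun e he hve => hv (mem_of_mem_walkEdges he hve)
  rw [degreeIn, h2, Finset.filter_insert, if_pos (Sym2.mem_mk_left v b), Finset.filter_insert,
    if_pos (Sym2.mem_mk_left v a), h3, Finset.card_insert_of_notMem, Finset.card_insert_of_notMem]
  · rfl
  · simp
  · simp only [Finset.mem_insert, Finset.notMem_empty, or_false]
    intro h
    exact hab (Sym2.congr_right.1 h).symm

/-- Take an edge of T outside B as the closing edge of the tour. -/
theorem exists_walk_of_ssubset (hn : 3 ≤ n) {B T : Finset (Sym2 (Fin n))} (hT : IsTour T)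
    (h : B ⊂ T) : ∃ l : List (Fin n), l.Nodup ∧ l.length = n ∧ B ⊆ walkEdges l := by
  obtain ⟨e, he, heB⟩ := Finset.exists_of_ssubset h
  induction e with | h x y => ?_
  obtain ⟨m, hm, hlen, hnot, rfl⟩ := hT.exists_closing hn he
  refine ⟨_, hm, hlen, fun e he => ?_⟩
  rcases Finset.mem_insert.1 (h.1 he) with rfl | h'
  · exact (heB he).elim
  · exact h'

theorem isAcyclic_of_ssubset (hn : 3 ≤ n) {B T : Finset (Sym2 (Fin n))} (hT : IsTour T)
    (h : B ⊂ T) : (SimpleGraph.fromEdgeSet (B : Set (Sym2 (Fin n)))).IsAcyclic := by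
  obtain ⟨l, hl, -, hB⟩ := exists_walk_of_ssubset hn hT h
  exact isAcyclic_mono hB (isAcyclic_walkEdges hl)

theorem exists_ssubset_of_walk (hn : 3 ≤ n) {B : Finset (Sym2 (Fin n))} {l : List (Fin n)}
    (hl : l.Nodup) (hlen : l.length = n) (hB : B ⊆ walkEdges l) :
    IsTour (tourEdges l) ∧ walkEdges l ⊆ tourEdges l ∧ B ⊂ tourEdges l := by
  have hT : IsTour (tourEdges l) := ⟨l, hl, hlen, rfl⟩
  cases l with
  | nil => simp at hlen; lia
  | cons x t =>
    have hsub : walkEdges (x :: t) ⊆ tourEdges (x :: t) := by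
      rw [tourEdges_cons]
      rcases List.eq_nil_or_concat t with rfl | ⟨m, b, rfl⟩
      · simp [walkEdges]
      · have : x :: (m ++ [b] ++ [x]) = (x :: m) ++ [b, x] := by simp
        simp only [List.concat_eq_append]
        rw [this, walkEdges_concat_concat]
        exact Finset.subset_insert _ _
    refine ⟨hT, hsub, Finset.ssubset_of_subset_of_ssubset hB ?_⟩
    refine (Finset.ssubset_iff_of_subset hsub).2 ?_
    by_contra! hcon
    have h1 := Finset.card_le_card (show tourEdges (x :: t) ⊆ walkEdges (x :: t) from hcon)
    rw [card_tour hn hT, card_walkEdges hl] at h1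
    simp at hlen
    lia

theorem not_isDiag_of_mem_tour (hn : 3 ≤ n) {T : Finset (Sym2 (Fin n))} (hT : IsTour T)
    {e : Sym2 (Fin n)} (he : e ∈ T) : ¬ e.IsDiag := by
  induction e with | h x y => ?_
  obtain ⟨m, hm, -, -, -⟩ := hT.exists_closing hn he
  simp at hm ⊢
  tauto

end Walks

end CrossEntropyTSP

namespace CrossEntropyTSP

/-! ### Exchanging edges of a tour -/

section Exchange

variable {n : ℕ}

/-- There is an exchange of the tour `T` that inserts the edge `{u, v}` and removes at most three
edges, all from `H`, at least one of them at `u` and one at `v`. -/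
def HasExchange (T H : Finset (Sym2 (Fin n))) (u v : Fin n) : Prop :=
  ∃ A ⊆ H, A.card ≤ 3 ∧ (∃ a ∈ A, u ∈ a) ∧ (∃ b ∈ A, v ∈ b) ∧ (∃ a ∈ T \ A, u ∈ a) ∧
    (∃ b ∈ T \ A, v ∈ b) ∧
    ∃ l : List (Fin n), l.Nodup ∧ l.length = n ∧ insert s(u, v) (T \ A) ⊆ walkEdges l

theorem HasExchange.symm {T H : Finset (Sym2 (Fin n))} {u v : Fin n} (h : HasExchange T H u v) :
    HasExchange T H v u := by
  obtain ⟨A, h1, h2, h3, h4, h5, h6, l, h7, h8, h9⟩ := h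
  exact ⟨A, h1, h2, h4, h3, h6, h5, l, h7, h8, by rwa [Sym2.eq_swap]⟩

theorem exists_mem_sdiff_of_filter_subset (hn : 3 ≤ n) {T A : Finset (Sym2 (Fin n))}
    (hT : IsTour T) {u : Fin n} {a : Sym2 (Fin n)} (h : ∀ e ∈ A, u ∈ e → e = a) :
    ∃ e ∈ T \ A, u ∈ e := by
  have h2 := degreeIn_tour hn hT u
  rw [degreeIn] at h2
  have h3 : ¬ T.filter (fun e => u ∈ e) ⊆ {a} := by
    intro hsub
    have := Finset.card_le_card hsub
    simp at this
    lia
  rw [Finset.not_subset] at h3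
  obtain ⟨e, he, hne⟩ := h3
  rw [Finset.mem_filter] at he
  refine ⟨e, Finset.mem_sdiff.2 ⟨he.1, fun hA => hne ?_⟩, he.2⟩
  exact Finset.mem_singleton.2 (h e hA he.2)

/-- The 2-exchange: if the edges leaving u and v in the same direction are both removable, the
segment behind v is reversed and attached to u through the new edge uv. -/
theorem hasExchange_of_same_side (hn : 3 ≤ n) {T H : Finset (Sym2 (Fin n))} {u v x z : Fin n}
    {p q : List (Fin n)} (hl : (u :: (x :: p ++ v :: z :: q)).Nodup)
    (hlen : (u :: (x :: p ++ v :: z :: q)).length = n)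
    (hT : T = walkEdges (u :: (x :: p ++ v :: (z :: q ++ [u]))))
    (hx : s(u, x) ∈ H) (hz : s(v, z) ∈ H) : HasExchange T H u v := by
  have htour : IsTour T := by
    have := isTour_of_walk hl hlen
    rw [hT]
    simpa using this
  have hl' := hl
  simp only [List.cons_append, List.nodup_cons, List.mem_cons, List.mem_append, List.nodup_append,
    not_or] at hl'
  refine ⟨{s(u, x), s(v, z)}, ?_, ?_, ⟨s(u, x), by simp, by simp⟩, ⟨s(v, z), by simp, by simp⟩,
    ?_, ?_, x :: p ++ v :: u :: (z :: q).reverse, ?_, ?_, ?_⟩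
  · intro e he
    simp at he
    rcases he with rfl | rfl <;> assumption
  · exact Finset.card_le_two.trans (by norm_num)
  · refine exists_mem_sdiff_of_filter_subset hn htour (a := s(u, x)) fun e he hu => ?_
    simp at he
    rcases he with rfl | rfl
    · rfl
    · simp at hu
      tauto
  · refine exists_mem_sdiff_of_filter_subset hn htour (a := s(v, z)) fun e he hu => ?_
    simp at he
    rcases he with rfl | rfl
    · simp at hu
      grind
    · rfl
  · have hperm : (x :: p ++ v :: u :: (z :: q).reverse).Perm (u :: (x :: p ++ v :: z :: q)) := by
      have h1 : (x :: p ++ v :: u :: (z :: q).reverse).Perm (x :: p ++ u :: v :: (z :: q)) := by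
        refine List.Perm.append_left _ ?_
        exact (List.Perm.swap u v _).trans (((List.reverse_perm _).cons v).cons u)
      exact h1.trans List.perm_middle
    exact hperm.nodup_iff.2 hl
  · simp at hlen ⊢
    lia
  · have h1 : walkEdges (x :: p ++ v :: u :: (z :: q).reverse) =
        walkEdges (x :: p ++ [v]) ∪ insert s(v, u) (walkEdges (z :: q ++ [u])) := by
      rw [walkEdges_append, walkEdges_cons_cons, ← walkEdges_reverse (z :: q ++ [u])]
      simp
    have h2 : T = insert s(u, x) (walkEdges (x :: p ++ [v]) ∪
        insert s(v, z) (walkEdges (z :: q ++ [u]))) := by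
      rw [hT, List.cons_append, walkEdges_cons_cons, ← List.cons_append, walkEdges_append]
      rfl
    rw [h1, h2]
    intro e he
    simp only [Finset.mem_insert, Finset.mem_sdiff, Finset.mem_union, Finset.mem_singleton] at he ⊢
    rw [Sym2.eq_swap (a := v) (b := u)]
    tauto

/-- The 3-exchange: the arc x … y between u and v is cut out at both ends, u is joined to v, and the
third removed edge cd on the other arc opens the resulting cycle. The arc is then appended at c,
using an auxiliary edge cx that belongs to the path but not to the claimed subset. -/
theorem hasExchange_of_opposite_side (hn : 3 ≤ n) {T H : Finset (Sym2 (Fin n))}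
    {u v x y c d : Fin n} {p r q₁ q₂ : List (Fin n)} (hpr : x :: p = r ++ [y])
    (hl : (u :: (x :: p ++ v :: (q₁ ++ c :: d :: q₂))).Nodup)
    (hlen : (u :: (x :: p ++ v :: (q₁ ++ c :: d :: q₂))).length = n)
    (hT : T = walkEdges (u :: (x :: p ++ v :: (q₁ ++ c :: d :: q₂ ++ [u]))))
    (hx : s(u, x) ∈ H) (hy : s(y, v) ∈ H) (hc : s(c, d) ∈ H) : HasExchange T H u v := by
  have htour : IsTour T := by
    have := isTour_of_walk hl hlen
    rw [hT]
    simpa using this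
  have hyp : y ∈ x :: p := by simp [hpr]
  have huv : u ≠ v ∧ u ≠ y ∧ u ≠ c ∧ u ≠ d := by
    have := (List.nodup_cons.1 hl).1
    refine ⟨?_, ?_, ?_, ?_⟩ <;> rintro rfl <;> apply this
    · simp
    · exact List.mem_append_left _ hyp
    · simp
    · simp
  have hv : v ≠ u ∧ v ≠ x ∧ v ≠ c ∧ v ≠ d := by
    have h3 := (List.nodup_append.1 hl.of_cons).2.1
    have h4 := (List.nodup_append.1 hl.of_cons).2.2 x (by simp) v (by simp)
    have := (List.nodup_cons.1 h3).1
    refine ⟨huv.1.symm, h4.symm, ?_, ?_⟩ <;> rintro rfl <;> apply this <;> simp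
  refine ⟨{s(u, x), s(y, v), s(c, d)}, ?_, Finset.card_le_three, ⟨s(u, x), by simp, by simp⟩,
    ⟨s(y, v), by simp, by simp⟩, ?_, ?_, (d :: q₂) ++ u :: v :: (q₁ ++ c :: x :: p), ?_, ?_, ?_⟩
  · intro e he
    simp at he
    rcases he with rfl | rfl | rfl <;> assumption
  · refine exists_mem_sdiff_of_filter_subset hn htour (a := s(u, x)) fun e he hu => ?_
    simp at he
    rcases he with rfl | rfl | rfl
    · rfl
    all_goals
      simp at hu
      tauto
  · refine exists_mem_sdiff_of_filter_subset hn htour (a := s(y, v)) fun e he hu => ?_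
    simp at he
    rcases he with rfl | rfl | rfl
    · simp at hu
      tauto
    · rfl
    · simp at hu
      tauto
  · have hperm : ((d :: q₂) ++ u :: v :: (q₁ ++ c :: x :: p)).Perm
        (u :: (x :: p ++ v :: (q₁ ++ c :: d :: q₂))) := by
      refine List.perm_middle.trans (List.Perm.cons u ?_)
      have h1 : (d :: q₂) ++ v :: (q₁ ++ c :: x :: p) =
        (d :: q₂) ++ ((v :: (q₁ ++ [c])) ++ (x :: p)) := by simp
      have h2 : x :: p ++ v :: (q₁ ++ c :: d :: q₂) =
        (x :: p) ++ ((v :: (q₁ ++ [c])) ++ (d :: q₂)) := by simp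
      rw [h1, h2]
      refine List.perm_append_comm.trans ?_
      rw [← List.append_assoc]
      exact List.perm_append_comm.append_right _
    exact hperm.nodup_iff.2 hl
  · simp at hlen ⊢
    lia
  · have h1 : walkEdges ((d :: q₂) ++ u :: v :: (q₁ ++ c :: x :: p)) =
        walkEdges (d :: q₂ ++ [u]) ∪ insert s(u, v) (walkEdges (v :: (q₁ ++ [c])) ∪
          insert s(c, x) (walkEdges (x :: p))) := by
      rw [walkEdges_append, walkEdges_cons_cons, ← List.cons_append,
        walkEdges_append (v :: q₁), walkEdges_cons_cons]
      rfl
    have h2 : T = insert s(u, x) (insert s(y, v) (walkEdges (x :: p)) ∪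
        (walkEdges (v :: (q₁ ++ [c])) ∪ insert s(c, d) (walkEdges (d :: q₂ ++ [u])))) := by
      have h3 : insert s(y, v) (walkEdges (x :: p)) = walkEdges (x :: p ++ [v]) := by
        rw [hpr]
        simp only [List.append_assoc, List.cons_append, List.nil_append]
        rw [walkEdges_concat_concat]
      have h4 : v :: (q₁ ++ c :: d :: q₂ ++ [u]) = (v :: q₁) ++ c :: d :: (q₂ ++ [u]) := by simp
      rw [hT, h3, List.cons_append, walkEdges_cons_cons, ← List.cons_append, walkEdges_append, h4,
        walkEdges_append (v :: q₁), walkEdges_cons_cons]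
      rfl
    rw [h1, h2]
    intro e he
    simp only [Finset.mem_insert, Finset.mem_sdiff, Finset.mem_union, Finset.mem_singleton] at he ⊢
    tauto

/-- If the arc from v through z and w to u contained no edge of H, it would close a cycle with uv
inside the acyclic graph. Its two end edges are not in H by assumption, so an edge of H lies
strictly inside it and serves as the third edge of the 3-exchange. -/
theorem hasExchange_of_opposite (hn : 3 ≤ n) {T H : Finset (Sym2 (Fin n))}
    {u v x y z w : Fin n} {p r q s : List (Fin n)}
    (hpr : x :: p = r ++ [y]) (hqs : z :: q = s ++ [w])
    (hl : (u :: (x :: p ++ v :: z :: q)).Nodup)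
    (hlen : (u :: (x :: p ++ v :: z :: q)).length = n)
    (hT : T = walkEdges (u :: (x :: p ++ v :: (z :: q ++ [u]))))
    (huv : s(u, v) ∉ T)
    (hac : (SimpleGraph.fromEdgeSet
      ((insert s(u, v) (T \ H) : Finset _) : Set (Sym2 (Fin n)))).IsAcyclic)
    (hx : s(u, x) ∈ H) (hy : s(y, v) ∈ H) (hz : s(v, z) ∉ H) (hw : s(w, u) ∉ H) :
    HasExchange T H u v := by
  have hne : u ≠ v := by
    rintro rfl
    simp at hl
  have hcon : ∃ g ∈ walkEdges (z :: q), g ∈ H := by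
    by_contra! hno
    have hsub : walkEdges (v :: (z :: q ++ [u])) ⊆ T \ H := by
      intro g hg
      rw [Finset.mem_sdiff]
      constructor
      · rw [hT, ← List.cons_append, walkEdges_append]
        exact Finset.mem_union_right _ hg
      · have h1 : v :: (z :: q ++ [u]) = (v :: s) ++ [w, u] := by rw [hqs]; simp
        rw [h1, walkEdges_concat_concat, List.cons_append, ← hqs, walkEdges_cons_cons,
          Finset.mem_insert, Finset.mem_insert] at hg
        rcases hg with rfl | rfl | hg
        · exact hw
        · exact hz
        · exact hno g hg
    have hreach := reachable_of_walkEdges_subset hsub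
    have hbr := (SimpleGraph.isAcyclic_iff_forall_isBridge.1 hac) (e := s(u, v))
      (by simp [hne])
    rw [SimpleGraph.isBridge_iff] at hbr
    refine hbr (hreach.symm.mono ?_)
    intro a b hab
    rw [adj_fromEdgeSet_iff] at hab
    have : s(a, b) ≠ s(u, v) := by
      intro h
      rw [h] at hab
      exact huv (Finset.mem_sdiff.1 hab.1).1
    simp [hab.2]
    simp at this hab
    tauto
  obtain ⟨g, hg, hgH⟩ := hcon
  obtain ⟨q₁, c, d, q₂, hq, rfl⟩ := exists_append_of_mem_walkEdges hg
  rw [hq] at hl hlen hT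
  exact hasExchange_of_opposite_side hn hpr hl hlen hT hx hy hgH

theorem hasExchange (hn : 3 ≤ n) {T H : Finset (Sym2 (Fin n))} {u v : Fin n} (hT : IsTour T)
    (hHT : H ⊆ T) (hne : u ≠ v) (huv : s(u, v) ∉ T) (hu : ∃ g ∈ H, u ∈ g) (hv : ∃ g ∈ H, v ∈ g)
    (hac : (SimpleGraph.fromEdgeSet
      ((insert s(u, v) (T \ H) : Finset _) : Set (Sym2 (Fin n)))).IsAcyclic) :
    HasExchange T H u v := by
  obtain ⟨t, ht, hlen, hTt⟩ := hT.exists_cons u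
  have hvt : v ∈ t := by
    have : (u :: t).toFinset = Finset.univ := by
      apply Finset.eq_univ_of_card
      rw [List.toFinset_card_of_nodup ht, hlen, Fintype.card_fin]
    have h1 : v ∈ (u :: t).toFinset := this ▸ Finset.mem_univ v
    simp at h1
    tauto
  obtain ⟨p, q, rfl⟩ := List.append_of_mem hvt
  obtain ⟨x, p, rfl⟩ : ∃ x p', p = x :: p' := by
    cases p with
    | nil => exact (huv (by rw [hTt]; simp [walkEdges_cons_cons])).elim
    | cons x p => exact ⟨x, p, rfl⟩
  obtain ⟨z, q, rfl⟩ : ∃ z q', q = z :: q' := by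
    cases q with
    | nil =>
      refine (huv ?_).elim
      rw [hTt, Sym2.eq_swap]
      have : u :: (x :: p ++ [v] ++ [u]) = (u :: x :: p) ++ [v, u] := by simp
      rw [this, walkEdges_concat_concat]
      exact Finset.mem_insert_self _ _
    | cons z q => exact ⟨z, q, rfl⟩
  obtain ⟨r, y, hpr⟩ : ∃ r y, x :: p = r ++ [y] := by
    rcases List.eq_nil_or_concat (x :: p) with h | ⟨r, y, h⟩
    · simp at h
    · exact ⟨r, y, by simpa using h⟩
  obtain ⟨s, w, hqs⟩ : ∃ s w, z :: q = s ++ [w] := by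
    rcases List.eq_nil_or_concat (z :: q) with h | ⟨r, y, h⟩
    · simp at h
    · exact ⟨r, y, by simpa using h⟩
  have hT1 : T = walkEdges (u :: (x :: p ++ v :: (z :: q ++ [u]))) := by
    rw [hTt]
    simp
  have hT2 : T = walkEdges (v :: (z :: q ++ u :: (x :: p ++ [v]))) := by
    rw [hT1]
    have h1 : u :: (x :: p ++ v :: (z :: q ++ [u])) = (u :: x :: p) ++ v :: (z :: q ++ [u]) := by
      simp
    have h2 : v :: (z :: q ++ u :: (x :: p ++ [v])) = (v :: z :: q) ++ u :: (x :: p ++ [v]) := by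
      simp
    rw [h1, h2, walkEdges_append, walkEdges_append (v :: z :: q), Finset.union_comm]
    rfl
  have hperm : (v :: (z :: q ++ u :: x :: p)).Perm (u :: (x :: p ++ v :: z :: q)) := by
    have h1 : v :: (z :: q ++ u :: x :: p) = (v :: z :: q) ++ (u :: x :: p) := by simp
    have h2 : u :: (x :: p ++ v :: z :: q) = (u :: x :: p) ++ (v :: z :: q) := by simp
    rw [h1, h2]
    exact List.perm_append_comm
  have hTsplit : T = insert s(u, x) (insert s(y, v) (walkEdges (x :: p)) ∪
      insert s(v, z) (insert s(w, u) (walkEdges (z :: q)))) := by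
    have h3 : insert s(y, v) (walkEdges (x :: p)) = walkEdges (x :: p ++ [v]) := by
      rw [hpr]
      simp only [List.append_assoc, List.cons_append, List.nil_append]
      rw [walkEdges_concat_concat]
    have h4 : insert s(w, u) (walkEdges (z :: q)) = walkEdges (z :: q ++ [u]) := by
      rw [hqs]
      simp only [List.append_assoc, List.cons_append, List.nil_append]
      rw [walkEdges_concat_concat]
    rw [hT1, h3, h4, List.cons_append, walkEdges_cons_cons, ← List.cons_append, walkEdges_append]
    rfl
  have hyp : y ∈ x :: p := by simp [hpr]
  have hwq : w ∈ z :: q := by simp [hqs]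
  have hup : u ∉ x :: p := fun h => (List.nodup_cons.1 ht).1 (List.mem_append_left _ h)
  have huq : u ∉ z :: q := fun h =>
    (List.nodup_cons.1 ht).1 (List.mem_append_right _ (List.mem_cons_of_mem _ h))
  have hvq : v ∉ z :: q := (List.nodup_cons.1 (List.nodup_append.1 ht.of_cons).2.1).1
  have hvp : v ∉ x :: p := fun h =>
    (List.nodup_append.1 ht.of_cons).2.2 v h v List.mem_cons_self rfl
  have hu' : s(u, x) ∈ H ∨ s(w, u) ∈ H := by
    obtain ⟨g, hg, hug⟩ := hu
    have := hHT hg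
    rw [hTsplit] at this
    simp only [Finset.mem_insert, Finset.mem_union] at this
    rcases this with rfl | (rfl | h) | rfl | rfl | h
    · exact Or.inl hg
    · rcases Sym2.mem_iff.1 hug with rfl | rfl
      · exact (hup hyp).elim
      · exact (hne rfl).elim
    · exact (hup (mem_of_mem_walkEdges h hug)).elim
    · rcases Sym2.mem_iff.1 hug with rfl | rfl
      · exact (hne rfl).elim
      · exact (huq List.mem_cons_self).elim
    · exact Or.inr hg
    · exact (huq (mem_of_mem_walkEdges h hug)).elim
  have hv' : s(y, v) ∈ H ∨ s(v, z) ∈ H := by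
    obtain ⟨g, hg, hvg⟩ := hv
    have := hHT hg
    rw [hTsplit] at this
    simp only [Finset.mem_insert, Finset.mem_union] at this
    rcases this with rfl | (rfl | h) | rfl | rfl | h
    · rcases Sym2.mem_iff.1 hvg with rfl | rfl
      · exact (hne rfl).elim
      · exact (hvp List.mem_cons_self).elim
    · exact Or.inl hg
    · exact (hvp (mem_of_mem_walkEdges h hvg)).elim
    · exact Or.inr hg
    · rcases Sym2.mem_iff.1 hvg with rfl | rfl
      · exact (hvq hwq).elim
      · exact (hne rfl).elim
    · exact (hvq (mem_of_mem_walkEdges h hvg)).elim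
  -- Each of u and v has an edge in H. Either two such edges point in the same direction around the
  -- tour, clockwise (h1) or anticlockwise (h2, read backwards), or exactly one of the two arcs
  -- between u and v has both its end edges in H and the other arc has neither.
  by_cases h1 : s(u, x) ∈ H ∧ s(v, z) ∈ H
  · exact hasExchange_of_same_side hn ht hlen hT1 h1.1 h1.2
  by_cases h2 : s(w, u) ∈ H ∧ s(y, v) ∈ H
  · refine hasExchange_of_same_side (x := w) (z := y) (p := s.reverse) (q := r.reverse) hn ?_ ?_ ?_
      (by rw [Sym2.eq_swap]; exact h2.1) (by rw [Sym2.eq_swap]; exact h2.2)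
    · have h3 : u :: (w :: s.reverse ++ v :: y :: r.reverse) =
          u :: (x :: p ++ v :: z :: q).reverse := by
        rw [hpr, hqs]
        simp
      rw [h3]
      exact ((List.reverse_perm _).cons u).nodup_iff.2 ht
    · have := congrArg List.length hpr
      have := congrArg List.length hqs
      simp at *
      lia
    · rw [hT1, hpr, hqs, ← walkEdges_reverse]
      simp
  by_cases h3 : s(u, x) ∈ H
  · exact hasExchange_of_opposite hn hpr hqs ht hlen hT1 huv hac h3 (by tauto) (by tauto)
      (by tauto)
  · refine (hasExchange_of_opposite hn hqs hpr (hperm.nodup_iff.2 ht)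
      (hperm.length_eq.trans hlen) hT2 ?_ ?_ (by tauto) (by tauto) h3 (by tauto)).symm
    · rwa [Sym2.eq_swap]
    · rwa [Sym2.eq_swap]

end Exchange

end CrossEntropyTSP

namespace CrossEntropyTSP

/-! ### The instance `G₁` -/

section Instance

variable {n : ℕ}

theorem isTour_g1Optimum (n : ℕ) : IsTour (g1Optimum n) :=
  ⟨List.finRange n, List.nodup_finRange n, List.length_finRange, rfl⟩

theorem mem_g1Optimum_iff {e : Sym2 (Fin n)} :
    e ∈ g1Optimum n ↔ ∃ i j : Fin n, e = s(i, j) ∧ (i.val + 1) % n = j.val := by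
  rw [g1Optimum, tourEdges, List.mem_toFinset, List.mem_iff_getElem]
  constructor
  · rintro ⟨k, hk, rfl⟩
    simp only [List.length_zipWith, List.length_rotate, List.length_finRange, min_self] at hk
    refine ⟨⟨k, hk⟩, ⟨(k + 1) % n, Nat.mod_lt _ (by lia)⟩, ?_, rfl⟩
    simp [List.getElem_rotate]
  · rintro ⟨i, j, rfl, h⟩
    refine ⟨i.val, by simp, ?_⟩
    simp [List.getElem_rotate, h]

theorem g1Dist_eq (n : ℕ) (e : Sym2 (Fin n)) :
    g1Dist n e = if e ∈ g1Optimum n then (1 : ℝ) else n := by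
  rw [g1Dist]
  simp only [← mem_g1Optimum_iff]

/-- The number of edges of distance `n`. -/
def heavy (s : Finset (Sym2 (Fin n))) : ℕ := (s \ g1Optimum n).card

theorem heavy_add_card_inter (hn : 3 ≤ n) {s : Finset (Sym2 (Fin n))} (hs : IsTour s) :
    heavy s + (s ∩ g1Optimum n).card = n := by
  rw [heavy, Finset.card_sdiff_add_card_inter, card_tour hn hs]

theorem heavy_le (hn : 3 ≤ n) {s : Finset (Sym2 (Fin n))} (hs : IsTour s) : heavy s ≤ n := by
  have := heavy_add_card_inter hn hs
  lia

/-- This affine dependence turns sorting by cost into sorting by `heavy`. -/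
theorem cost_g1Dist (hn : 3 ≤ n) {s : Finset (Sym2 (Fin n))} (hs : IsTour s) :
    cost (g1Dist n) s = n + heavy s * ((n : ℝ) - 1) := by
  have h : (heavy s : ℝ) + (s ∩ g1Optimum n).card = n := by
    exact_mod_cast heavy_add_card_inter hn hs
  rw [cost, Finset.sum_congr rfl fun e _ => g1Dist_eq n e, Finset.sum_ite,
    Finset.filter_mem_eq_inter, Finset.filter_notMem_eq_sdiff, Finset.sum_const, Finset.sum_const,
    nsmul_eq_mul, nsmul_eq_mul]
  rw [heavy] at h ⊢
  linear_combination h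

theorem heavy_le_of_cost_le (hn : 3 ≤ n) {s t : Finset (Sym2 (Fin n))} (hs : IsTour s)
    (ht : IsTour t) (h : cost (g1Dist n) s ≤ cost (g1Dist n) t) : heavy s ≤ heavy t := by
  rw [cost_g1Dist hn hs, cost_g1Dist hn ht] at h
  have hn' : (0 : ℝ) < (n : ℝ) - 1 := by
    have : (3 : ℝ) ≤ n := by exact_mod_cast hn
    linarith
  have : (heavy s : ℝ) ≤ heavy t := le_of_mul_le_mul_right (by linarith) hn'
  exact_mod_cast this

theorem heavy_eq_zero_iff (hn : 3 ≤ n) {s : Finset (Sym2 (Fin n))} (hs : IsTour s) :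
    heavy s = 0 ↔ s = g1Optimum n := by
  rw [heavy, Finset.card_eq_zero, Finset.sdiff_eq_empty_iff_subset]
  refine ⟨fun h => Finset.eq_of_subset_of_card_le h ?_, fun h => h.subset⟩
  rw [card_tour hn hs, card_tour hn (isTour_g1Optimum n)]

theorem isOptimal_iff (hn : 3 ≤ n) (s : Finset (Sym2 (Fin n))) :
    IsOptimal (g1Dist n) s ↔ s = g1Optimum n := by
  have h0 := (heavy_eq_zero_iff hn (isTour_g1Optimum n)).2 rfl
  have hn' : (0 : ℝ) < (n : ℝ) - 1 := by
    have : (3 : ℝ) ≤ n := by exact_mod_cast hn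
    linarith
  constructor
  · rintro ⟨hs, h⟩
    have := heavy_le_of_cost_le hn hs (isTour_g1Optimum n) (h _ (isTour_g1Optimum n))
    rw [h0] at this
    exact (heavy_eq_zero_iff hn hs).1 (by lia)
  · rintro rfl
    refine ⟨isTour_g1Optimum n, fun s hs => ?_⟩
    rw [cost_g1Dist hn hs, cost_g1Dist hn (isTour_g1Optimum n), h0]
    have : (0 : ℝ) ≤ heavy s * ((n : ℝ) - 1) := by positivity
    simpa using this

theorem card_g1Optimum_sdiff (hn : 3 ≤ n) {T : Finset (Sym2 (Fin n))} (hT : IsTour T) :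
    (g1Optimum n \ T).card = heavy T := by
  have h1 := heavy_add_card_inter hn hT
  have h2 := Finset.card_sdiff_add_card_inter (g1Optimum n) T
  rw [card_tour hn (isTour_g1Optimum n), Finset.inter_comm] at h2
  lia

/-- Only long edges are given up, so s retains all short edges of T and gains e. It need not be the
tour of the exchange itself: the remaining edges of s are arbitrary. -/
theorem heavy_lt_of_subset (hn : 3 ≤ n) {T A s : Finset (Sym2 (Fin n))} {e : Sym2 (Fin n)}
    (hT : IsTour T) (hs : IsTour s) (hA : A ⊆ T \ g1Optimum n) (he : e ∈ g1Optimum n) (heT : e ∉ T)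
    (h : insert e (T \ A) ⊆ s) : heavy s < heavy T := by
  have h1 := heavy_add_card_inter hn hT
  have h2 := heavy_add_card_inter hn hs
  have h3 : insert e (T ∩ g1Optimum n) ⊆ s ∩ g1Optimum n := by
    intro f hf
    rw [Finset.mem_insert, Finset.mem_inter] at hf
    rw [Finset.mem_inter]
    rcases hf with rfl | ⟨hf, hf'⟩
    · exact ⟨h (Finset.mem_insert_self _ _), he⟩
    · refine ⟨h (Finset.mem_insert_of_mem (Finset.mem_sdiff.2 ⟨hf, fun hfA => ?_⟩)), hf'⟩
      exact (Finset.mem_sdiff.1 (hA hfA)).2 hf'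
  have h4 := Finset.card_le_card h3
  rw [Finset.card_insert_of_notMem (by simp [heT])] at h4
  lia

theorem degreeIn_insert {B : Finset (Sym2 (Fin n))} {e : Sym2 (Fin n)} {v : Fin n} (he : e ∉ B)
    (hv : v ∈ e) : degreeIn (insert e B) v = degreeIn B v + 1 := by
  rw [degreeIn, Finset.filter_insert, if_pos hv, Finset.card_insert_of_notMem, degreeIn]
  simp [he]

theorem degreeIn_mono {B C : Finset (Sym2 (Fin n))} (h : B ⊆ C) (v : Fin n) :
    degreeIn B v ≤ degreeIn C v :=
  Finset.card_le_card (Finset.filter_subset_filter _ h)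

theorem exists_mem_sdiff_of_degreeIn_lt {B C : Finset (Sym2 (Fin n))} {v : Fin n}
    (h : degreeIn B v < degreeIn C v) : ∃ e ∈ C \ B, v ∈ e := by
  obtain ⟨e, he, heB⟩ := Finset.exists_mem_notMem_of_card_lt_card h
  rw [Finset.mem_filter] at he heB
  exact ⟨e, Finset.mem_sdiff.2 ⟨he.1, fun h => heB ⟨h, he.2⟩⟩, he.2⟩

/-- Here the removable edges are exactly the long ones. Without them, T together with uv is a proper
subset of the optimal cycle and hence acyclic; degree counting at u and at v supplies a long edge at
each. -/
theorem hasExchange_heavy (hn : 3 ≤ n) {T : Finset (Sym2 (Fin n))} (hT : IsTour T) {u v : Fin n}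
    (he : s(u, v) ∈ g1Optimum n) (heT : s(u, v) ∉ T) :
    HasExchange T (T \ g1Optimum n) u v := by
  have hopt := isTour_g1Optimum n
  have hne : u ≠ v := by simpa using not_isDiag_of_mem_tour hn hopt he
  have hinc : ∀ w ∈ s(u, v), ∃ g ∈ T \ g1Optimum n, w ∈ g := by
    intro w hw
    have h1 : degreeIn (g1Optimum n ∩ T) w < degreeIn T w := by
      have h3 : degreeIn (insert s(u, v) (g1Optimum n ∩ T)) w ≤ degreeIn (g1Optimum n) w := by
        refine degreeIn_mono (Finset.insert_subset he Finset.inter_subset_left) w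
      rw [degreeIn_insert (by simp [heT]) hw] at h3
      rw [degreeIn_tour hn hT]
      rw [degreeIn_tour hn hopt] at h3
      lia
    obtain ⟨g, hg, hwg⟩ := exists_mem_sdiff_of_degreeIn_lt h1
    refine ⟨g, ?_, hwg⟩
    simp at hg ⊢
    tauto
  have hss : insert s(u, v) (T \ (T \ g1Optimum n)) ⊂ g1Optimum n := by
    have hsub : insert s(u, v) (T \ (T \ g1Optimum n)) ⊆ g1Optimum n := by
      rw [Finset.sdiff_sdiff_self_left]
      exact Finset.insert_subset he Finset.inter_subset_right
    refine Finset.ssubset_iff_subset_ne.2 ⟨hsub, fun heq => ?_⟩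
    obtain ⟨g, hg, hug⟩ := hinc u (by simp)
    obtain ⟨g', hg', hvg⟩ := hinc v (by simp)
    -- An edge through both u and v would be uv, which is not in T. So T has at least two long edges
    -- and misses at least two optimal ones; a single insertion cannot complete the optimum.
    have hgg : g ≠ g' := by
      rintro rfl
      have := (Sym2.mem_and_mem_iff hne).1 ⟨hug, hvg⟩
      rw [this] at hg
      exact heT (Finset.mem_sdiff.1 hg).1
    have h2 : ({g, g'} : Finset _) ⊆ T \ g1Optimum n := by
      intro x hx
      simp only [Finset.mem_insert, Finset.mem_singleton] at hx
      rcases hx with rfl | rfl <;> assumption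
    have h3 := Finset.card_le_card h2
    rw [Finset.card_pair hgg] at h3
    have h4 := heavy_add_card_inter hn hT
    have h5 := congrArg Finset.card heq
    rw [Finset.sdiff_sdiff_self_left, card_tour hn hopt,
      Finset.card_insert_of_notMem (by simp [heT])] at h5
    rw [heavy] at h4
    lia
  exact hasExchange hn hT Finset.sdiff_subset hne heT (hinc u (by simp)) (hinc v (by simp))
    (isAcyclic_of_ssubset hn hopt hss)

end Instance

/-! ### Linear forests -/

section Linear

variable {n : ℕ}

/-- A proper subset of a tour. -/
def IsLinear (B : Finset (Sym2 (Fin n))) : Prop := ∃ T, IsTour T ∧ B ⊂ T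

theorem IsLinear.subset {B C : Finset (Sym2 (Fin n))} (hC : IsLinear C) (h : B ⊆ C) :
    IsLinear B := by
  obtain ⟨T, hT, hCT⟩ := hC
  exact ⟨T, hT, Finset.ssubset_of_subset_of_ssubset h hCT⟩

theorem isLinear_of_walk (hn : 3 ≤ n) {B : Finset (Sym2 (Fin n))} {l : List (Fin n)}
    (hl : l.Nodup) (hlen : l.length = n) (hB : B ⊆ walkEdges l) : IsLinear B :=
  ⟨_, (exists_ssubset_of_walk hn hl hlen hB).1, (exists_ssubset_of_walk hn hl hlen hB).2.2⟩

theorem isLinear_empty (hn : 3 ≤ n) : IsLinear (∅ : Finset (Sym2 (Fin n))) :=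
  isLinear_of_walk hn (List.nodup_finRange n) List.length_finRange (Finset.empty_subset _)

theorem not_isAcyclic_tour (hn : 3 ≤ n) {T : Finset (Sym2 (Fin n))} (hT : IsTour T) :
    ¬ (SimpleGraph.fromEdgeSet (T : Set (Sym2 (Fin n)))).IsAcyclic := by
  intro hac
  have hne : T.Nonempty := by
    rw [← Finset.card_pos, card_tour hn hT]
    lia
  obtain ⟨e, he⟩ := hne
  induction e with | h x y => ?_
  obtain ⟨m, hm, -, hnot, hTm⟩ := hT.exists_closing hn he
  have hxy : x ≠ y := by
    rintro rfl
    simp at hm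
  have hbr := (SimpleGraph.isAcyclic_iff_forall_isBridge.1 hac) (e := s(x, y)) (by simp [he, hxy])
  rw [SimpleGraph.isBridge_iff] at hbr
  refine hbr ((reachable_of_walkEdges_subset (subset_refl (walkEdges (x :: (m ++ [y]))))).mono ?_)
  intro a b hab
  rw [adj_fromEdgeSet_iff] at hab
  have h1 : s(a, b) ≠ s(x, y) := by
    intro h
    rw [h] at hab
    exact hnot hab.1
  rw [hTm]
  simp [hab.2]
  simp at h1 hab
  tauto

theorem mem_admissible_iff {B : Finset (Sym2 (Fin n))} {e : Sym2 (Fin n)} :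
    e ∈ admissible B ↔ ¬ e.IsDiag ∧ e ∉ B ∧
      (SimpleGraph.fromEdgeSet (↑(insert e B) : Set (Sym2 (Fin n)))).IsAcyclic ∧
      ∀ v, degreeIn (insert e B) v ≤ 2 := by
  classical
  simp only [admissible, Finset.mem_filter, Finset.mem_univ, true_and]

theorem mem_admissible_of_isLinear (hn : 3 ≤ n) {B : Finset (Sym2 (Fin n))} {e : Sym2 (Fin n)}
    (he : e ∉ B) (h : IsLinear (insert e B)) : e ∈ admissible B := by
  obtain ⟨T, hT, hB⟩ := h
  refine mem_admissible_iff.2 ⟨not_isDiag_of_mem_tour hn hT (hB.1 (Finset.mem_insert_self _ _)), he,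
    isAcyclic_of_ssubset hn hT hB, fun v => ?_⟩
  rw [← degreeIn_tour hn hT v]
  exact degreeIn_mono hB.1 v

/-- If e lies outside the witnessing tour T, apply the exchange argument with all edges of T outside
B removable: the degree bound yields such an edge at each end of e, and admissibility is the
required acyclicity. -/
theorem IsLinear.insert (hn : 3 ≤ n) {B : Finset (Sym2 (Fin n))} {e : Sym2 (Fin n)}
    (hB : IsLinear B) (he : e ∈ admissible B) : IsLinear (insert e B) := by
  obtain ⟨T, hT, hBT⟩ := hB
  obtain ⟨hdiag, heB, hac, hdeg⟩ := mem_admissible_iff.1 he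
  by_cases heT : e ∈ T
  · refine ⟨T, hT, Finset.ssubset_iff_subset_ne.2 ⟨Finset.insert_subset heT hBT.1, ?_⟩⟩
    intro h
    rw [h] at hac
    exact not_isAcyclic_tour hn hT hac
  · induction e with | h u v => ?_
    have hinc : ∀ w ∈ s(u, v), ∃ g ∈ T \ B, w ∈ g := by
      intro w hw
      refine exists_mem_sdiff_of_degreeIn_lt ?_
      have := hdeg w
      rw [degreeIn_insert heB hw] at this
      rw [degreeIn_tour hn hT]
      lia
    have h1 : T \ (T \ B) = B := by
      rw [Finset.sdiff_sdiff_self_left]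
      exact Finset.inter_eq_right.2 hBT.1
    obtain ⟨A, hA, -, -, -, -, -, l, hl, hlen, hsub⟩ := hasExchange hn hT
      Finset.sdiff_subset (by simpa using hdiag) heT (hinc u (by simp)) (hinc v (by simp))
      (by rwa [h1])
    refine isLinear_of_walk hn hl hlen ((Finset.insert_subset_insert _ ?_).trans hsub)
    intro f hf
    rw [Finset.mem_sdiff]
    refine ⟨hBT.1 hf, fun hfA => ?_⟩
    exact (Finset.mem_sdiff.1 (hA hfA)).2 hf

/-- Exactly one edge t of T is missing, and the vertices of degree one in B are exactly its ends. -/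
theorem closeTour_eq (hn : 3 ≤ n) {B T : Finset (Sym2 (Fin n))} (hT : IsTour T) (hBT : B ⊂ T)
    (hcard : B.card = n - 1) : closeTour B = T := by
  obtain ⟨t, ht, htB⟩ := Finset.exists_of_ssubset hBT
  have hTB : T = insert t B := by
    symm
    apply Finset.eq_of_subset_of_card_le (Finset.insert_subset ht hBT.1)
    rw [Finset.card_insert_of_notMem htB, hcard, card_tour hn hT]
    lia
  have hdeg : ∀ v, degreeIn B v = 1 ↔ v ∈ t := by
    intro v
    have h2 := degreeIn_tour hn hT v
    rw [hTB] at h2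
    by_cases hv : v ∈ t
    · rw [degreeIn_insert htB hv] at h2
      simp only [hv, iff_true]
      lia
    · rw [degreeIn, Finset.filter_insert, if_neg hv] at h2
      rw [degreeIn, h2]
      simp [hv]
  have htd := not_isDiag_of_mem_tour hn hT ht
  rw [closeTour, hTB, Finset.insert_eq, Finset.union_comm]
  congr 1
  ext e
  simp only [Finset.mem_filter, Finset.mem_univ, true_and, Finset.mem_singleton, hdeg]
  constructor
  · rintro ⟨hd, he⟩
    induction e with | h x y => ?_
    have hxy : x ≠ y := by simpa using hd
    exact ((Sym2.mem_and_mem_iff hxy).1 ⟨he x (by simp), he y (by simp)⟩).symm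
  · rintro rfl
    exact ⟨htd, fun v hv => hv⟩

end Linear

end CrossEntropyTSP

namespace CrossEntropyTSP

/-! ### Vertex-based generation from a calibrated tour -/

section Vertex

variable {n : ℕ}

/-- The distribution that results from the calibration of the tour `T`. -/
noncomputable def tourDist (T : Finset (Sym2 (Fin n))) (i j : Fin n) : ℝ :=
  if i = j then 0 else if s(i, j) ∈ T then 1 - 1 / (n : ℝ) else 1 / ((n : ℝ) * ((n : ℝ) - 2))

theorem one_div_mul_pos (hn : 3 ≤ n) : 0 < 1 / ((n : ℝ) * ((n : ℝ) - 2)) := by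
  have : (3 : ℝ) ≤ n := by exact_mod_cast hn
  have : 0 < (n : ℝ) - 2 := by linarith
  positivity

theorem one_sub_one_div_pos (hn : 3 ≤ n) : 0 < 1 - 1 / (n : ℝ) := by
  have : (3 : ℝ) ≤ n := by exact_mod_cast hn
  rw [sub_pos, div_lt_one (by linarith)]
  linarith

theorem tourDist_pos (hn : 3 ≤ n) (T : Finset (Sym2 (Fin n))) {i j : Fin n} (h : i ≠ j) :
    0 < tourDist T i j := by
  rw [tourDist, if_neg h]
  split_ifs
  · exact one_sub_one_div_pos hn
  · exact one_div_mul_pos hn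

theorem exp_neg_two_mul_le {x : ℝ} (h0 : 0 ≤ x) (h : x ≤ 1 / 2) : Real.exp (-(2 * x)) ≤ 1 - x := by
  have h1 := Real.add_one_le_exp (2 * x)
  rw [Real.exp_neg, inv_le_comm₀ (Real.exp_pos _) (by linarith)]
  refine le_trans ?_ h1
  rw [inv_le_iff_one_le_mul₀ (by linarith)]
  nlinarith

theorem exp_le_one_sub_div_pow {a : ℝ} (ha : 0 ≤ a) (hn : 2 * a ≤ n) (hn0 : 0 < n) {k : ℕ}
    (hk : k ≤ n) : Real.exp (-(2 * a)) ≤ (1 - a / n) ^ k := by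
  have hn' : (0 : ℝ) < n := by exact_mod_cast hn0
  have hx : a / n ≤ 1 / 2 := by
    rw [div_le_iff₀ hn']
    linarith
  have hx0 : 0 ≤ a / n := by positivity
  calc Real.exp (-(2 * a)) = Real.exp (-(2 * (a / n))) ^ n := by
        rw [← Real.exp_nat_mul]
        congr 1
        field_simp
    _ ≤ (1 - a / n) ^ n := pow_le_pow_left₀ (Real.exp_pos _).le (exp_neg_two_mul_le hx0 hx) _
    _ ≤ (1 - a / n) ^ k := pow_le_pow_of_le_one (by linarith) (by linarith) hk

theorem vertexGen_support (hn : 3 ≤ n) {P : Fin n → Fin n → ℝ} (hP : ∀ i j, i ≠ j → 0 < P i j)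
    {s : Finset (Sym2 (Fin n))} (hs : s ∈ (vertexGen P).support) : IsTour s := by
  rw [vertexGen, PMF.mem_support_map_iff] at hs
  obtain ⟨l, hl, rfl⟩ := hs
  have h := iterSteps_support (step := vertexStep P)
    (I := fun k (l : List (Fin n)) => l.Nodup ∧ l.length = k) (K := n) ?_ (a := [])
    (by simp) n le_rfl l hl
  · exact ⟨l, h.1, h.2, rfl⟩
  · rintro k hk l ⟨hnd, hlen⟩ b hb
    cases l with
    | nil =>
      obtain ⟨a, -, rfl⟩ := exists_of_mem_support_weightedChoice
        ⟨⟨0, by lia⟩, Finset.mem_univ _, one_pos⟩ hb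
      simp at hlen ⊢
      lia
    | cons v l =>
      have hex : ∃ a, a ∉ v :: l := by
        by_contra! hall
        have h1 : (v :: l).toFinset = Finset.univ := by
          ext x
          simpa using hall x
        have h2 := List.toFinset_card_of_nodup hnd
        rw [h1, Finset.card_univ, Fintype.card_fin] at h2
        lia
      obtain ⟨a, ha⟩ := hex
      obtain ⟨a, ha, rfl⟩ := exists_of_mem_support_weightedChoice
        ⟨a, by simpa using ha, hP v a (by rintro rfl; simp at ha)⟩ hb
      rw [Finset.mem_filter] at ha
      exact ⟨List.nodup_cons.2 ⟨ha.2, hnd⟩, by simpa using hlen⟩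

theorem card_filter_mk_mem (T : Finset (Sym2 (Fin n))) (v : Fin n) :
    (Finset.univ.filter fun k => s(v, k) ∈ T).card = degreeIn T v := by
  rw [degreeIn]
  refine Finset.card_bij (fun k _ => s(v, k)) ?_ ?_ ?_
  · intro k hk
    simp at hk ⊢
    exact hk
  · intro a _ b _ h
    exact Sym2.congr_right.1 h
  · intro e he
    rw [Finset.mem_filter] at he
    obtain ⟨k, rfl⟩ := Sym2.mem_iff_exists.1 he.2
    exact ⟨k, by simpa using he.1, rfl⟩

theorem sum_tourDist_le (hn : 3 ≤ n) (T : Finset (Sym2 (Fin n))) {v : Fin n} {l : List (Fin n)}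
    {a : ℕ} (ha : (Finset.univ.filter fun k => s(v, k) ∈ T ∧ k ∉ v :: l).card ≤ a)
    {b : ℕ} (hb : (Finset.univ.filter fun k => k ∉ v :: l).card ≤ b) :
    ∑ k ∈ Finset.univ.filter (fun k => k ∉ v :: l), tourDist T v k ≤
      a * (1 - 1 / (n : ℝ)) + b * (1 / ((n : ℝ) * ((n : ℝ) - 2))) := by
  have hw := one_div_mul_pos hn
  have hW := one_sub_one_div_pos hn
  have h1 : ∀ k ∈ Finset.univ.filter (fun k => k ∉ v :: l), tourDist T v k ≤
      (if s(v, k) ∈ T then (1 - 1 / (n : ℝ)) else 0) + 1 / ((n : ℝ) * ((n : ℝ) - 2)) := by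
    intro k hk
    rw [tourDist]
    split_ifs <;> linarith
  refine (Finset.sum_le_sum h1).trans ?_
  rw [Finset.sum_add_distrib, ← Finset.sum_filter, Finset.filter_filter, Finset.sum_const,
    Finset.sum_const, nsmul_eq_mul, nsmul_eq_mul]
  have h2 : (Finset.univ.filter fun k => k ∉ v :: l ∧ s(v, k) ∈ T).card ≤ a := by
    simpa only [and_comm] using ha
  gcongr

theorem ofReal_le_prob_vertexStep (hn : 3 ≤ n) (T : Finset (Sym2 (Fin n))) {v v' : Fin n}
    {l : List (Fin n)} (hv' : v' ∉ v :: l) {D : ℝ} (hD : 0 < D)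
    (hsum : ∑ k ∈ Finset.univ.filter (fun k => k ∉ v :: l), tourDist T v k ≤ D) :
    ENNReal.ofReal (tourDist T v v' / D) ≤
      prob (vertexStep (tourDist T) (v :: l)) (· = v' :: v :: l) := by
  have hmem : v' ∈ Finset.univ.filter (fun k => k ∉ v :: l) := by simpa using hv'
  have hpos : ∀ a ∈ Finset.univ.filter (fun k => k ∉ v :: l), 0 < tourDist T v a := by
    intro a ha
    rw [Finset.mem_filter] at ha
    refine tourDist_pos hn T ?_
    rintro rfl
    simp at ha
  refine ofReal_le_mean_weightedChoice (g := fun a => if a = v' then 1 else 0)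
    (fun a ha => (hpos a ha).le) (Finset.sum_pos hpos ⟨v', hmem⟩) ?_ ?_ ?_
  · intro a _
    split_ifs <;> norm_num
  · intro a _
    split_ifs with h
    · simp [h]
    · simp
  · simp only [mul_ite, mul_one, mul_zero]
    rw [Finset.sum_ite_eq' _ v', if_pos hmem, div_mul_eq_mul_div, div_le_iff₀ hD]
    exact mul_le_mul_of_nonneg_left hsum (hpos v' hmem).le

theorem card_sdiff_cons_cons (T : Finset (Sym2 (Fin n))) {x y : Fin n} {l : List (Fin n)}
    (h : (x :: y :: l).Nodup) : (walkEdges (x :: y :: l) \ T).card =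
      (walkEdges (y :: l) \ T).card + if s(x, y) ∈ T then 0 else 1 := by
  rw [walkEdges_cons_cons]
  split_ifs with hT
  · rw [Finset.insert_sdiff_of_mem _ hT, add_zero]
  · rw [Finset.insert_sdiff_of_notMem _ hT, Finset.card_insert_of_notMem]
    intro hmem
    exact (List.nodup_cons.1 h).1
      (mem_of_mem_walkEdges (Finset.mem_sdiff.1 hmem).1 (Sym2.mem_mk_left x y))

/-- The factor by which the next choice is less likely if the last one was not an edge of `T`. -/
noncomputable def lastFactor (T : Finset (Sym2 (Fin n))) : List (Fin n) → ℝ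
  | x :: y :: _ => if s(x, y) ∈ T then 1 else 3
  | _ => 3

theorem one_le_lastFactor (T : Finset (Sym2 (Fin n))) (l : List (Fin n)) :
    1 ≤ lastFactor T l := by
  unfold lastFactor
  split
  · split_ifs <;> norm_num
  · norm_num

/-- After an edge of T, at most one neighbour of v along T is unvisited, and the sum is at most (1 -
1/n) + (n - 2)/(n(n - 2)) = 1; this is what the choice of `π_min` achieves. Otherwise both
neighbours may be unvisited and the crude bound 3 applies. -/
theorem sum_tourDist_le_lastFactor (hn : 3 ≤ n) {T : Finset (Sym2 (Fin n))} (hT : IsTour T)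
    {v : Fin n} {l : List (Fin n)} (hl : (v :: l).Nodup) :
    ∑ k ∈ Finset.univ.filter (fun k => k ∉ v :: l), tourDist T v k ≤ lastFactor T (v :: l) := by
  have hn3 : (3 : ℝ) ≤ n := by exact_mod_cast hn
  have h2 : (Finset.univ.filter fun k => s(v, k) ∈ T).card = 2 := by
    rw [card_filter_mk_mem, degreeIn_tour hn hT]
  have hcrude : ∑ k ∈ Finset.univ.filter (fun k => k ∉ v :: l), tourDist T v k ≤ 3 := by
    refine (sum_tourDist_le hn T (a := 2) (b := n) ?_ ?_).trans ?_
    · rw [← h2]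
      exact Finset.card_le_card fun k hk => by
        simp only [Finset.mem_filter] at hk ⊢
        tauto
    · refine (Finset.card_le_univ _).trans_eq (Fintype.card_fin n)
    · have h3 : (n : ℝ) * (1 / ((n : ℝ) * ((n : ℝ) - 2))) ≤ 1 := by
        rw [mul_one_div, div_le_one (by nlinarith)]
        nlinarith
      have h4 : 0 ≤ 1 / (n : ℝ) := by positivity
      push_cast
      linarith
  cases l with
  | nil => exact hcrude
  | cons y l =>
    rw [lastFactor]
    split_ifs with hy
    · refine (sum_tourDist_le hn T (a := 1) (b := n - 2) ?_ ?_).trans ?_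
      · rw [← Nat.lt_succ_iff]
        refine lt_of_lt_of_eq (Finset.card_lt_card ((Finset.ssubset_iff_of_subset ?_).2 ⟨y, ?_, ?_⟩)) h2
        · intro k hk
          simp only [Finset.mem_filter] at hk ⊢
          tauto
        · simpa using hy
        · simp
      · have hvy : v ≠ y := by
          rintro rfl
          simp at hl
        have hsub : (Finset.univ.filter fun k => k ∉ v :: y :: l) ⊆ Finset.univ \ {v, y} := by
          intro k hk
          simp at hk ⊢
          tauto
        refine (Finset.card_le_card hsub).trans ?_
        rw [Finset.card_sdiff_of_subset (Finset.subset_univ _), Finset.card_pair hvy,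
          Finset.card_univ, Fintype.card_fin]
      · rw [Nat.cast_sub (by lia)]
        push_cast
        have : (n : ℝ) - 2 ≠ 0 := by linarith
        field_simp
        linarith
    · exact hcrude

/-- A lower bound for the probability of visiting the vertices in a given order. -/
theorem ofReal_le_prob_iterSteps_vertexStep (hn : 3 ≤ n) {T : Finset (Sym2 (Fin n))}
    (hT : IsTour T) {v : Fin n} {l : List (Fin n)} (hl : (v :: l).Nodup) :
    ENNReal.ofReal (1 / (3 * n) * (1 - 1 / (n : ℝ)) ^ l.length *
      (1 / ((n : ℝ) * ((n : ℝ) - 2)) / 3) ^ (walkEdges (v :: l) \ T).card *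
        lastFactor T (v :: l)) ≤
      prob (iterSteps (vertexStep (tourDist T)) (v :: l).length []) (· = v :: l) := by
  have hn3 : (3 : ℝ) ≤ n := by exact_mod_cast hn
  have hw := one_div_mul_pos hn
  have hW := one_sub_one_div_pos hn
  have hW1 : 1 - 1 / (n : ℝ) ≤ 1 := by
    have : 0 ≤ 1 / (n : ℝ) := by positivity
    linarith
  induction l generalizing v with
  | nil =>
    rw [List.length_singleton, iterSteps_one]
    refine ofReal_le_mean_weightedChoice (g := fun a => if a = v then 1 else 0)
      (fun a _ => zero_le_one) ?_ ?_ ?_ ?_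
    · simp
      lia
    · intro a _
      split_ifs <;> norm_num
    · intro a _
      split_ifs with h
      · simp [h]
      · simp
    · simp only [walkEdges_singleton, lastFactor, List.length_nil, Finset.empty_sdiff,
        Finset.card_empty, pow_zero, mul_one, Finset.sum_const, Finset.card_univ, Fintype.card_fin,
        nsmul_eq_mul, one_mul, Finset.sum_ite_eq', Finset.mem_univ, if_true]
      apply le_of_eq
      field_simp
  | cons y l ih =>
    have hlast := zero_lt_one.trans_le (one_le_lastFactor T (y :: l))
    have hstep := ofReal_le_prob_vertexStep hn T (List.nodup_cons.1 hl).1 hlast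
      (sum_tourDist_le_lastFactor hn hT hl.of_cons)
    have hvy : y ≠ v := by
      rintro rfl
      simp at hl
    have hprev := ih hl.of_cons
    rw [show (v :: y :: l).length = (y :: l).length + 1 from rfl, iterSteps_succ', prob_bind]
    have h1 : prob (iterSteps (vertexStep (tourDist T)) (y :: l).length []) (· = y :: l) *
        ENNReal.ofReal (tourDist T y v / lastFactor T (y :: l)) ≤
        mean (iterSteps (vertexStep (tourDist T)) (y :: l).length [])
          fun a => prob (vertexStep (tourDist T) a) (· = v :: y :: l) := by
      rw [prob, ← mean_mul_const]
      refine mean_mono fun a _ => ?_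
      by_cases ha : a = y :: l
      · rw [ha]
        simpa using hstep
      · simp [ha]
    refine le_trans ?_ h1
    refine le_trans ?_ (mul_le_mul_left hprev _)
    rw [← ENNReal.ofReal_mul (by positivity)]
    refine ENNReal.ofReal_le_ofReal ?_
    rw [card_sdiff_cons_cons T hl, lastFactor, tourDist, if_neg hvy, Sym2.eq_swap, List.length_cons]
    set L := lastFactor T (y :: l)
    set W := 1 - 1 / (n : ℝ)
    set w := 1 / ((n : ℝ) * ((n : ℝ) - 2))
    set j := (walkEdges (y :: l) \ T).card
    have hK : 0 < 1 / (3 * (n : ℝ)) * W ^ l.length * (w / 3) ^ j := by positivity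
    -- The last factor carried in the bound is the normalising sum not yet paid for; it cancels
    -- against the denominator of the next step. For a step outside T the new last factor 3 in turn
    -- compensates the 1/3 in w/3.
    have h3 : ∀ x : ℝ, 1 / (3 * (n : ℝ)) * W ^ l.length * (w / 3) ^ j * L * (x / L) =
        1 / (3 * (n : ℝ)) * W ^ l.length * (w / 3) ^ j * x := by
      intro x
      field_simp
    rw [h3]
    split_ifs with hvT
    · apply le_of_eq
      ring
    · have h4 : 1 / (3 * (n : ℝ)) * W ^ (l.length + 1) * (w / 3) ^ (j + 1) * 3 =
        1 / (3 * (n : ℝ)) * W ^ l.length * (w / 3) ^ j * w * W := by ring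
      rw [h4]
      exact mul_le_of_le_one_right (by positivity) hW1

/-- For each first vertex, one traversal of T has probability at least exp(-2)/(3n). The n
traversals are disjoint events, so summing over the first vertex removes the factor 1/n. -/
theorem ofReal_le_prob_vertexGen_le (hn : 3 ≤ n) {T : Finset (Sym2 (Fin n))} (hT : IsTour T) :
    ENNReal.ofReal (Real.exp (-2) / 3) ≤
      prob (vertexGen (tourDist T)) (fun s => heavy s ≤ heavy T) := by
  have hn3 : (3 : ℝ) ≤ n := by exact_mod_cast hn
  choose t ht hlen hTt using fun v => hT.exists_cons v
  have hexp : Real.exp (-2) ≤ (1 - 1 / (n : ℝ)) ^ (n - 1) := by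
    simpa using exp_le_one_sub_div_pow zero_le_one (by linarith) (by lia) (Nat.sub_le n 1)
  have hone : ∀ v, ENNReal.ofReal (1 / n * (Real.exp (-2) / 3)) ≤
      prob (iterSteps (vertexStep (tourDist T)) n []) (· = v :: t v) := by
    intro v
    have h := ofReal_le_prob_iterSteps_vertexStep hn hT (ht v)
    rw [hlen v] at h
    refine le_trans (ENNReal.ofReal_le_ofReal ?_) h
    have h0 : (walkEdges (v :: t v) \ T).card = 0 := by
      rw [Finset.card_eq_zero, Finset.sdiff_eq_empty_iff_subset]
      have := (exists_ssubset_of_walk hn (ht v) (hlen v) (subset_refl _)).2.1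
      rwa [tourEdges_cons, ← hTt v] at this
    have h1 : (t v).length = n - 1 := by
      have := hlen v
      simp at this
      lia
    rw [h0, pow_zero, mul_one, h1]
    have h2 := one_le_lastFactor T (v :: t v)
    have h3 : 1 / (n : ℝ) * (Real.exp (-2) / 3) ≤ 1 / (3 * n) * (1 - 1 / (n : ℝ)) ^ (n - 1) := by
      calc 1 / (n : ℝ) * (Real.exp (-2) / 3) = 1 / (3 * n) * Real.exp (-2) := by field_simp
        _ ≤ _ := by gcongr
    refine h3.trans (le_mul_of_one_le_right ?_ h2)
    have := one_sub_one_div_pos hn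
    positivity
  have hsum : ∑ v : Fin n, prob (iterSteps (vertexStep (tourDist T)) n []) (· = v :: t v) ≤
      prob (vertexGen (tourDist T)) (fun s => heavy s ≤ heavy T) := by
    rw [vertexGen, prob_map]
    simp only [prob]
    rw [← mean_sum]
    refine mean_mono fun a _ => ?_
    by_cases ha : ∃ v, a = v :: t v
    · obtain ⟨v, rfl⟩ := ha
      rw [Finset.sum_eq_single v]
      · rw [Set.indicator_of_mem, Set.indicator_of_mem]
        · simp [tourEdges_cons, ← hTt v]
        · simp
      · intro b _ hb
        rw [Set.indicator_of_notMem]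
        simp [hb.symm]
      · simp
    · rw [Finset.sum_eq_zero]
      · exact zero_le
      · intro v _
        rw [Set.indicator_of_notMem]
        exact fun h => ha ⟨v, h⟩
  refine le_trans ?_ hsum
  refine le_trans ?_ (Finset.sum_le_sum fun v _ => hone v)
  rw [Finset.sum_const, Finset.card_univ, Fintype.card_fin, nsmul_eq_mul, ← ENNReal.ofReal_natCast,
    ← ENNReal.ofReal_mul (by positivity)]
  refine ENNReal.ofReal_le_ofReal (le_of_eq ?_)
  field_simp

/-- Kept in additive form for two uses: a Hamiltonian path s, with n - 1 edges, has at most two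
edges outside T, and a tour s has at most three. -/
theorem card_sdiff_le_two (hn : 3 ≤ n) {T A s : Finset (Sym2 (Fin n))} (hT : IsTour T)
    (hA : A.card ≤ 3) (hs : T \ A ⊆ s) : (s \ T).card + n ≤ s.card + 3 := by
  have h1 := Finset.card_sdiff_add_card_inter s T
  have h2 : (T \ A).card ≤ (s ∩ T).card :=
    Finset.card_le_card (Finset.subset_inter hs Finset.sdiff_subset)
  have h3 := Finset.le_card_sdiff A T
  rw [card_tour hn hT] at h3
  lia

/-- A single improving path is followed: 1/(3n) for the start, exp(-2) for the edges of T, and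
1/(3n^2) for each of at most two other edges. -/
theorem ofReal_le_prob_vertexGen_lt (hn : 3 ≤ n) {T : Finset (Sym2 (Fin n))} (hT : IsTour T)
    (hheavy : 0 < heavy T) :
    ENNReal.ofReal (Real.exp (-2) / (27 * (n : ℝ) ^ 5)) ≤
      prob (vertexGen (tourDist T)) (fun s => heavy s < heavy T) := by
  have hn3 : (3 : ℝ) ≤ n := by exact_mod_cast hn
  rw [← card_g1Optimum_sdiff hn hT, Finset.card_pos] at hheavy
  obtain ⟨e, he⟩ := hheavy
  rw [Finset.mem_sdiff] at he
  induction e with | h u v => ?_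
  obtain ⟨A, hA, hA3, -, -, -, -, l, hl, hlen, hsub⟩ := hasExchange_heavy hn hT he.1 he.2
  obtain ⟨htour, hsub', -⟩ := exists_ssubset_of_walk hn hl hlen hsub
  have hlt := heavy_lt_of_subset hn hT htour hA he.1 he.2 (hsub.trans hsub')
  cases l with
  | nil => simp at hlen; lia
  | cons x l =>
    have hbad : (walkEdges (x :: l) \ T).card ≤ 2 := by
      have h1 := card_sdiff_le_two hn hT hA3 ((Finset.subset_insert _ _).trans hsub)
      rw [card_walkEdges hl] at h1
      simp at hlen
      lia
    have h := ofReal_le_prob_iterSteps_vertexStep hn hT hl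
    rw [hlen] at h
    have h1 : prob (iterSteps (vertexStep (tourDist T)) n []) (· = x :: l) ≤
        prob (vertexGen (tourDist T)) (fun s => heavy s < heavy T) := by
      rw [vertexGen, prob_map]
      refine prob_mono fun a _ ha => ?_
      rw [ha]
      exact hlt
    refine le_trans (ENNReal.ofReal_le_ofReal ?_) (h.trans h1)
    have hexp : Real.exp (-2) ≤ (1 - 1 / (n : ℝ)) ^ l.length := by
      refine (le_of_eq ?_).trans
        (exp_le_one_sub_div_pow zero_le_one (by linarith) (by lia) (k := l.length) ?_)
      · norm_num
      · simp at hlen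
        lia
    have hw := one_div_mul_pos hn
    have hw2 : 1 / (n : ℝ) ^ 2 ≤ 1 / ((n : ℝ) * ((n : ℝ) - 2)) := by
      apply one_div_le_one_div_of_le
      · nlinarith
      · nlinarith
    have hw1 : 1 / ((n : ℝ) * ((n : ℝ) - 2)) / 3 ≤ 1 := by
      rw [div_div, div_le_one (by nlinarith)]
      nlinarith
    calc Real.exp (-2) / (27 * (n : ℝ) ^ 5)
        = 1 / (3 * n) * Real.exp (-2) * (1 / (n : ℝ) ^ 2 / 3) ^ 2 := by field_simp; norm_num
      _ ≤ 1 / (3 * n) * (1 - 1 / (n : ℝ)) ^ l.length *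
          (1 / ((n : ℝ) * ((n : ℝ) - 2)) / 3) ^ 2 := by
          have := one_sub_one_div_pos hn
          gcongr
      _ ≤ 1 / (3 * n) * (1 - 1 / (n : ℝ)) ^ l.length *
          (1 / ((n : ℝ) * ((n : ℝ) - 2)) / 3) ^ (walkEdges (x :: l) \ T).card := by
          have := one_sub_one_div_pos hn
          gcongr ?_ * ?_
          exact pow_le_pow_of_le_one (by positivity) hw1 hbad
      _ ≤ _ := by
          have := one_sub_one_div_pos hn
          exact le_mul_of_one_le_right (by positivity) (one_le_lastFactor T _)

end Vertex

end CrossEntropyTSP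

namespace CrossEntropyTSP

/-! ### Edge-based generation from a calibrated tour -/

section Edge

variable {n : ℕ}

theorem edgeWeight_pos {P : Fin n → Fin n → ℝ} (hP : ∀ i j, i ≠ j → 0 < P i j) {e : Sym2 (Fin n)}
    (he : ¬ e.IsDiag) : 0 < edgeWeight P e := by
  induction e with | h x y => ?_
  have hxy : x ≠ y := by simpa using he
  exact add_pos (hP x y hxy) (hP y x hxy.symm)

theorem edgeWeight_tourDist (T : Finset (Sym2 (Fin n))) {e : Sym2 (Fin n)} (he : ¬ e.IsDiag) :
    edgeWeight (tourDist T) e =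
      2 * if e ∈ T then 1 - 1 / (n : ℝ) else 1 / ((n : ℝ) * ((n : ℝ) - 2)) := by
  induction e with | h x y => ?_
  have hxy : x ≠ y := by simpa using he
  change tourDist T x y + tourDist T y x = _
  rw [tourDist, tourDist, if_neg hxy, if_neg hxy.symm, Sym2.eq_swap (a := y), two_mul]

theorem not_isDiag_of_mem_admissible {B : Finset (Sym2 (Fin n))} {e : Sym2 (Fin n)}
    (he : e ∈ admissible B) : ¬ e.IsDiag :=
  (mem_admissible_iff.1 he).1

theorem subset_closeTour (B : Finset (Sym2 (Fin n))) : B ⊆ closeTour B :=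
  Finset.subset_union_left

theorem IsLinear.card_lt (hn : 3 ≤ n) {B : Finset (Sym2 (Fin n))} (hB : IsLinear B) :
    B.card < n := by
  obtain ⟨T, hT, hBT⟩ := hB
  exact (Finset.card_lt_card hBT).trans_eq (card_tour hn hT)

theorem exists_mem_admissible (hn : 3 ≤ n) {B : Finset (Sym2 (Fin n))} (hB : IsLinear B)
    (hcard : B.card < n - 1) : ∃ e, e ∈ admissible B := by
  obtain ⟨T, hT, hBT⟩ := hB
  obtain ⟨e, heT, heB⟩ := Finset.exists_of_ssubset hBT
  refine ⟨e, mem_admissible_of_isLinear hn heB ⟨T, hT, ?_⟩⟩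
  refine Finset.ssubset_iff_subset_ne.2 ⟨Finset.insert_subset heT hBT.1, fun h => ?_⟩
  have := congrArg Finset.card h
  rw [Finset.card_insert_of_notMem heB, card_tour hn hT] at this
  lia

theorem iterSteps_edgeStep_support (hn : 3 ≤ n) {P : Fin n → Fin n → ℝ}
    (hP : ∀ i j, i ≠ j → 0 < P i j) {B : Finset (Sym2 (Fin n))}
    (hB : B ∈ (iterSteps (edgeStep P) (n - 1) ∅).support) : IsLinear B ∧ B.card = n - 1 := by
  refine iterSteps_support (step := edgeStep P) (I := fun k B => IsLinear B ∧ B.card = k)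
    (K := n - 1) ?_ (a := ∅) ⟨isLinear_empty hn, rfl⟩ (n - 1) le_rfl B hB
  rintro k hk B ⟨hlin, rfl⟩ C hC
  obtain ⟨e, he⟩ := exists_mem_admissible hn hlin hk
  obtain ⟨e, he, rfl⟩ := exists_of_mem_support_weightedChoice
    ⟨e, he, edgeWeight_pos hP (not_isDiag_of_mem_admissible he)⟩ hC
  exact ⟨hlin.insert hn he, Finset.card_insert_of_notMem (mem_admissible_iff.1 he).2.1⟩

theorem edgeGen_support (hn : 3 ≤ n) {P : Fin n → Fin n → ℝ} (hP : ∀ i j, i ≠ j → 0 < P i j)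
    {s : Finset (Sym2 (Fin n))} (hs : s ∈ (edgeGen P).support) : IsTour s := by
  rw [edgeGen, PMF.mem_support_map_iff] at hs
  obtain ⟨B, hB, rfl⟩ := hs
  obtain ⟨⟨T, hT, hBT⟩, hcard⟩ := iterSteps_edgeStep_support hn hP hB
  rwa [closeTour_eq hn hT hBT hcard]

theorem prob_eq_one {α : Type} {p : PMF α} {S : α → Prop} (h : ∀ a ∈ p.support, S a) :
    prob p S = 1 := by
  rw [prob, ← mean_const p 1]
  refine mean_congr fun a ha => ?_
  simp [h a ha]

/-- Edges are never removed. -/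
theorem subset_of_mem_support_iterSteps_edgeStep {P : Fin n → Fin n → ℝ} {k : ℕ}
    {B C : Finset (Sym2 (Fin n))} (hC : C ∈ (iterSteps (edgeStep P) k B).support) : B ⊆ C := by
  refine iterSteps_support (step := edgeStep P) (I := fun _ C => B ⊆ C) (K := k) ?_
    (subset_refl B) k le_rfl C hC
  intro _ _ D hBD E hE
  rw [edgeStep, weightedChoice] at hE
  split_ifs at hE with h
  · rw [PMF.mem_support_map_iff] at hE
    obtain ⟨e, -, rfl⟩ := hE
    exact hBD.trans (Finset.subset_insert _ _)
  · rw [PMF.mem_support_pure_iff] at hE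
    rwa [hE]

/-- An end of an admissible edge has degree at most one in B but two in T, so it is covered by one
of the edges in T \ B; these cover at most twice as many vertices as there are edges. -/
theorem card_admissible_le (hn : 3 ≤ n) {B T : Finset (Sym2 (Fin n))} (hT : IsTour T) :
    (admissible B).card ≤ 4 * (T \ B).card ^ 2 := by
  set U : Finset (Fin n) := (T \ B).biUnion fun e => Finset.univ.filter fun v => v ∈ e with hU
  have hUcard : U.card ≤ (T \ B).card * 2 := by
    refine Finset.card_biUnion_le_card_mul _ _ _ fun e _ => ?_
    induction e with | h x y => ?_
    have : (Finset.univ.filter fun v => v ∈ s(x, y)) ⊆ {x, y} := by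
      intro v hv
      simpa using hv
    exact (Finset.card_le_card this).trans Finset.card_le_two
  have hsub : admissible B ⊆ (U ×ˢ U).image fun p => s(p.1, p.2) := by
    intro e he
    have hend : ∀ v ∈ e, v ∈ U := by
      intro v hv
      obtain ⟨-, heB, -, hdeg⟩ := mem_admissible_iff.1 he
      have h1 := hdeg v
      rw [degreeIn_insert heB hv] at h1
      obtain ⟨f, hf, hvf⟩ := exists_mem_sdiff_of_degreeIn_lt (B := B) (C := T) (v := v)
        (by rw [degreeIn_tour hn hT]; lia)
      rw [hU, Finset.mem_biUnion]
      exact ⟨f, hf, by simpa using hvf⟩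
    induction e with | h x y => ?_
    rw [Finset.mem_image]
    exact ⟨(x, y), Finset.mem_product.2 ⟨hend x (by simp), hend y (by simp)⟩, rfl⟩
  refine (Finset.card_le_card hsub).trans (Finset.card_image_le.trans ?_)
  rw [Finset.card_product]
  nlinarith

/-- The relative weight of an edge. -/
noncomputable def relWeight (T : Finset (Sym2 (Fin n))) (e : Sym2 (Fin n)) : ℝ :=
  if e ∈ T then 1 else 1 / (((n : ℝ) - 1) * ((n : ℝ) - 2))

theorem relWeight_pos (hn : 3 ≤ n) (T : Finset (Sym2 (Fin n))) (e : Sym2 (Fin n)) :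
    0 < relWeight T e := by
  have : (3 : ℝ) ≤ n := by exact_mod_cast hn
  have h1 : 0 < (n : ℝ) - 1 := by linarith
  have h2 : 0 < (n : ℝ) - 2 := by linarith
  rw [relWeight]
  split_ifs <;> positivity

theorem edgeWeight_eq_relWeight (hn : 3 ≤ n) (T : Finset (Sym2 (Fin n))) {e : Sym2 (Fin n)}
    (he : ¬ e.IsDiag) :
    edgeWeight (tourDist T) e = 2 * (1 - 1 / (n : ℝ)) * relWeight T e := by
  have : (3 : ℝ) ≤ n := by exact_mod_cast hn
  have h1 : (n : ℝ) - 1 ≠ 0 := by linarith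
  have h2 : (n : ℝ) - 2 ≠ 0 := by linarith
  rw [edgeWeight_tourDist T he, relWeight]
  split_ifs
  · ring
  · field_simp

/-- At most a edges of weight 1, plus at most 4m^2 edges of weight at most 2/n^2 outside T; the
latter bound on the weight needs n ≥ 6. -/
theorem sum_relWeight_le (hn : 6 ≤ n) {B T : Finset (Sym2 (Fin n))} (hT : IsTour T) {a m : ℕ}
    (ha : (admissible B ∩ T).card ≤ a) (hm : (T \ B).card ≤ m) :
    ∑ e ∈ admissible B, relWeight T e ≤ a + 8 * (m : ℝ) ^ 2 / (n : ℝ) ^ 2 := by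
  have hn6 : (6 : ℝ) ≤ n := by exact_mod_cast hn
  have hκ : 1 / (((n : ℝ) - 1) * ((n : ℝ) - 2)) ≤ 2 / (n : ℝ) ^ 2 := by
    rw [div_le_div_iff₀ (by nlinarith) (by positivity)]
    nlinarith
  have h1 : ∀ e ∈ admissible B, relWeight T e ≤
      (if e ∈ T then (1 : ℝ) else 0) + 2 / (n : ℝ) ^ 2 := by
    intro e _
    have : 0 ≤ 2 / (n : ℝ) ^ 2 := by positivity
    rw [relWeight]
    split_ifs <;> linarith
  refine (Finset.sum_le_sum h1).trans ?_
  rw [Finset.sum_add_distrib, Finset.sum_ite_mem, Finset.sum_const, Finset.sum_const, nsmul_eq_mul,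
    nsmul_eq_mul, mul_one]
  have h2 : ((admissible B).card : ℝ) ≤ 4 * (m : ℝ) ^ 2 := by
    have h3 := card_admissible_le (B := B) (by lia) hT
    have h4 : 4 * (T \ B).card ^ 2 ≤ 4 * m ^ 2 := by gcongr
    exact_mod_cast h3.trans h4
  have h5 : ((admissible B ∩ T).card : ℝ) ≤ a := by exact_mod_cast ha
  have h6 : ((admissible B).card : ℝ) * (2 / (n : ℝ) ^ 2) ≤ 8 * (m : ℝ) ^ 2 / (n : ℝ) ^ 2 := by
    calc _ ≤ 4 * (m : ℝ) ^ 2 * (2 / (n : ℝ) ^ 2) := by gcongr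
      _ = _ := by ring
  linarith

/-- Conditioning on the first edge, where only edges of S are credited. The common factor 2(1 - 1/n)
of all edge weights cancels, leaving relative weights. -/
theorem ofReal_le_prob_iterSteps_edgeStep (hn : 3 ≤ n) (T : Finset (Sym2 (Fin n)))
    {B S : Finset (Sym2 (Fin n))} {Q : Finset (Sym2 (Fin n)) → Prop} {g : Sym2 (Fin n) → ℝ}
    {c D : ℝ} {k : ℕ} (hS : S ⊆ admissible B) (hne : S.Nonempty) (hc : 0 ≤ c)
    (hg0 : ∀ e ∈ S, 0 ≤ g e)
    (hg : ∀ e ∈ S, ENNReal.ofReal (g e) ≤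
      prob (iterSteps (edgeStep (tourDist T)) k (insert e B)) Q)
    (hD : ∑ e ∈ admissible B, relWeight T e ≤ D)
    (h : c * D ≤ ∑ e ∈ S, relWeight T e * g e) :
    ENNReal.ofReal c ≤ prob (iterSteps (edgeStep (tourDist T)) (k + 1) B) Q := by
  classical
  have hW := one_sub_one_div_pos hn
  have hwt : ∀ e ∈ admissible B, 0 < edgeWeight (tourDist T) e := fun e he =>
    edgeWeight_pos (fun _ _ h => tourDist_pos hn T h) (not_isDiag_of_mem_admissible he)
  rw [iterSteps, prob_bind]
  refine ofReal_le_mean_weightedChoice (g := fun e => if e ∈ S then g e else 0)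
    (fun e he => (hwt e he).le) (Finset.sum_pos hwt (hne.mono hS)) ?_ ?_ ?_
  · intro e _
    split_ifs with he
    · exact hg0 e he
    · exact le_rfl
  · intro e _
    split_ifs with he
    · exact hg e he
    · simp
  · simp only [mul_ite, mul_zero]
    have h1 : ∑ e ∈ S, edgeWeight (tourDist T) e * g e =
        2 * (1 - 1 / (n : ℝ)) * ∑ e ∈ S, relWeight T e * g e := by
      rw [Finset.mul_sum]
      refine Finset.sum_congr rfl fun e he => ?_
      rw [edgeWeight_eq_relWeight hn T (not_isDiag_of_mem_admissible (hS he)), mul_assoc]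
    rw [Finset.sum_ite_mem, Finset.inter_eq_right.2 hS, h1,
      Finset.sum_congr rfl fun e he =>
        edgeWeight_eq_relWeight hn T (not_isDiag_of_mem_admissible he),
      ← Finset.mul_sum, mul_left_comm]
    refine mul_le_mul_of_nonneg_left ?_ (by positivity)
    exact (mul_le_mul_of_nonneg_left hD hc).trans h

theorem exp_mul_le_exp {x : ℝ} (y : ℝ) {z : ℝ} (h : z = y - x) :
    Real.exp z * (1 + x) ≤ Real.exp y := by
  have h1 := Real.add_one_le_exp x
  calc Real.exp z * (1 + x) ≤ Real.exp z * Real.exp x := by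
        gcongr
        linarith
    _ = Real.exp y := by
        rw [← Real.exp_add, h]
        congr 1
        ring

/-- With m edges of T left, all of them admissible as long as two or more remain, the total relative
weight is at most m(1 + 8/n). Staying inside T thus costs a factor of at least exp(-8/n) per step.
-/
theorem ofReal_le_prob_subset_tour (hn : 6 ≤ n) {T : Finset (Sym2 (Fin n))} (hT : IsTour T)
    (k : ℕ) {B : Finset (Sym2 (Fin n))} (hB : B ⊆ T) (hk : B.card + k = n - 1) :
    ENNReal.ofReal (Real.exp (-(8 * k / n))) ≤
      prob (iterSteps (edgeStep (tourDist T)) k B) (· ⊆ T) := by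
  have hn0 : (0 : ℝ) < n := by
    have : 0 < n := by lia
    exact_mod_cast this
  induction k generalizing B with
  | zero =>
    rw [iterSteps, prob_pure_of (S := (· ⊆ T)) hB]
    simp
  | succ k ih =>
    have hcard := card_tour (by lia) hT
    have hm : (T \ B).card = k + 2 := by
      rw [Finset.card_sdiff_of_subset hB]
      lia
    have hadm : T \ B ⊆ admissible B := by
      intro e he
      rw [Finset.mem_sdiff] at he
      refine mem_admissible_of_isLinear (by lia) he.2 ⟨T, hT, ?_⟩
      refine Finset.ssubset_iff_subset_ne.2 ⟨Finset.insert_subset he.1 hB, fun h => ?_⟩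
      have := congrArg Finset.card h
      rw [Finset.card_insert_of_notMem he.2] at this
      lia
    have ha : (admissible B ∩ T).card ≤ k + 2 := by
      rw [← hm]
      refine Finset.card_le_card fun e he => ?_
      rw [Finset.mem_inter] at he
      exact Finset.mem_sdiff.2 ⟨he.2, (mem_admissible_iff.1 he.1).2.1⟩
    refine ofReal_le_prob_iterSteps_edgeStep (by lia) T hadm ?_ (Real.exp_pos _).le
      (g := fun _ => Real.exp (-(8 * k / n))) (fun _ _ => (Real.exp_pos _).le) ?_
      (sum_relWeight_le hn hT ha hm.le) ?_
    · rw [← Finset.card_pos]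
      lia
    · intro e he
      rw [Finset.mem_sdiff] at he
      refine ih (Finset.insert_subset he.1 hB) ?_
      rw [Finset.card_insert_of_notMem he.2]
      lia
    · have h1 : ∀ e ∈ T \ B, relWeight T e * Real.exp (-(8 * k / n)) =
          Real.exp (-(8 * k / n)) := by
        intro e he
        rw [relWeight, if_pos (Finset.mem_sdiff.1 he).1, one_mul]
      rw [Finset.sum_congr rfl h1, Finset.sum_const, hm, nsmul_eq_mul]
      have h2 : ((k + 2 : ℕ) : ℝ) ≤ n := by
        have : k + 2 ≤ n := by lia
        exact_mod_cast this
      have h3 : ((k + 2 : ℕ) : ℝ) + 8 * ((k + 2 : ℕ) : ℝ) ^ 2 / (n : ℝ) ^ 2 ≤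
          ((k + 2 : ℕ) : ℝ) * (1 + 8 / n) := by
        have : 8 * ((k + 2 : ℕ) : ℝ) ^ 2 / (n : ℝ) ^ 2 ≤ 8 * ((k + 2 : ℕ) : ℝ) * n / (n : ℝ) ^ 2 := by
          rw [pow_two, ← mul_assoc]
          gcongr
        have h4 : 8 * ((k + 2 : ℕ) : ℝ) * n / (n : ℝ) ^ 2 = ((k + 2 : ℕ) : ℝ) * (8 / n) := by
          field_simp
        linarith
      calc _ ≤ Real.exp (-(8 * ((k + 1 : ℕ) : ℝ) / n)) * (((k + 2 : ℕ) : ℝ) * (1 + 8 / n)) := by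
            gcongr
        _ = ((k + 2 : ℕ) : ℝ) * (Real.exp (-(8 * ((k + 1 : ℕ) : ℝ) / n)) * (1 + 8 / n)) := by ring
        _ ≤ _ := by
            refine mul_le_mul_of_nonneg_left (exp_mul_le_exp _ ?_) (by positivity)
            push_cast
            ring

theorem ofReal_le_prob_edgeGen_le (hn : 6 ≤ n) {T : Finset (Sym2 (Fin n))} (hT : IsTour T) :
    ENNReal.ofReal (Real.exp (-8)) ≤
      prob (edgeGen (tourDist T)) (fun s => heavy s ≤ heavy T) := by
  have h := ofReal_le_prob_subset_tour hn hT (n - 1) (Finset.empty_subset T) (by simp)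
  refine le_trans (ENNReal.ofReal_le_ofReal (Real.exp_le_exp.2 ?_)) (h.trans ?_)
  · have hn0 : (0 : ℝ) < n := by
      have : 0 < n := by lia
      exact_mod_cast this
    rw [neg_le_neg_iff, div_le_iff₀ hn0]
    have : ((n - 1 : ℕ) : ℝ) ≤ n := by exact_mod_cast Nat.sub_le n 1
    linarith
  · rw [edgeGen, prob_map]
    refine prob_mono fun B hB hBT => ?_
    obtain ⟨-, hcard⟩ := iterSteps_edgeStep_support (by lia)
      (fun _ _ h => tourDist_pos (by lia) T h) hB
    rw [closeTour_eq (by lia) hT (Finset.ssubset_iff_subset_ne.2 ⟨hBT, ?_⟩) hcard]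
    rintro rfl
    rw [card_tour (by lia) hT] at hcard
    lia

end Edge

end CrossEntropyTSP

namespace CrossEntropyTSP

/-! ### Edge-based generation: probability of a strict improvement -/

section Improvement

variable {n : ℕ}

/-- The edge set `R`, which consists of a new edge `e` and of all but at most three edges of the
tour `T`, is a linear forest, and after the choice of `e`, `a` and `b` at most one edge of `T`
outside of `R` remains admissible. -/
structure IsInsertion (T R : Finset (Sym2 (Fin n))) (e a b : Sym2 (Fin n)) : Prop where
  isTour : IsTour T
  isLinear : IsLinear R
  mem : e ∈ R
  notMem : e ∉ T
  mem_of_ne : ∀ f ∈ R, f ≠ e → f ∈ T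
  card_sdiff_le : (T \ R).card ≤ 3
  left_mem : a ∈ R
  right_mem : b ∈ R
  left_mem_tour : a ∈ T
  right_mem_tour : b ∈ T
  ne : a ≠ b
  card_admissible : ∀ B ⊆ R, e ∈ B → a ∈ B → b ∈ B →
    (admissible B ∩ T).card ≤ (R \ B).card + 1

theorem two_le_degreeIn {B : Finset (Sym2 (Fin n))} {e f : Sym2 (Fin n)} {v : Fin n} (he : e ∈ B)
    (hf : f ∈ B) (hef : e ≠ f) (hev : v ∈ e) (hfv : v ∈ f) : 2 ≤ degreeIn B v := by
  rw [← Finset.card_pair hef, degreeIn]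
  refine Finset.card_le_card fun x hx => ?_
  simp only [Finset.mem_insert, Finset.mem_singleton] at hx
  rw [Finset.mem_filter]
  rcases hx with rfl | rfl
  · exact ⟨he, hev⟩
  · exact ⟨hf, hfv⟩

/-- The witnesses are kept edges of T at u and at v. Once they and uv are chosen, u and v have
degree two and block the removed edges at u and at v, which are distinct because uv is not in T; of
at most three removed edges, at most one stays admissible. -/
theorem HasExchange.exists_isInsertion (hn : 3 ≤ n) {T H : Finset (Sym2 (Fin n))} {u v : Fin n}
    (h : HasExchange T H u v) (hT : IsTour T) (hne : u ≠ v) (huv : s(u, v) ∉ T) (hHT : H ⊆ T) :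
    ∃ A ⊆ H, A.card ≤ 3 ∧ ∃ a b, IsInsertion T (insert s(u, v) (T \ A)) s(u, v) a b := by
  obtain ⟨A, hA, hA3, ⟨a, ha, hua⟩, ⟨b, hb, hvb⟩, ⟨a', ha', hua'⟩, ⟨b', hb', hvb'⟩, l, hl, hlen,
    hsub⟩ := h
  have hdist : ∀ f g, f ∈ T → u ∈ f → v ∈ g → f ≠ g := by
    rintro f _ hf huf hvf rfl
    rw [(Sym2.mem_and_mem_iff hne).1 ⟨huf, hvf⟩] at hf
    exact huv hf
  refine ⟨A, hA, hA3, a', b', hT, isLinear_of_walk hn hl hlen hsub, Finset.mem_insert_self _ _, huv,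
    fun f hf hfe => ?_, ?_, Finset.mem_insert_of_mem ha', Finset.mem_insert_of_mem hb',
    (Finset.mem_sdiff.1 ha').1, (Finset.mem_sdiff.1 hb').1,
    hdist _ _ (Finset.mem_sdiff.1 ha').1 hua' hvb', fun B hB heB haB hbB => ?_⟩
  · exact (Finset.mem_sdiff.1 (Finset.mem_of_mem_insert_of_ne hf hfe)).1
  · refine (Finset.card_le_card fun f hf => ?_).trans hA3
    simp only [Finset.mem_sdiff, Finset.mem_insert, not_or, not_and, not_not] at hf
    exact hf.2.2 hf.1
  · have hab : a ≠ b := hdist _ _ (hHT (hA ha)) hua hvb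
    have hblock : ∀ w ∈ s(u, v), ∀ c ∈ B, c ∈ T → w ∈ c → ∀ f ∈ admissible B, w ∉ f := by
      intro w hw c hc hcT hwc f hf hwf
      obtain ⟨-, hfB, -, hdeg⟩ := mem_admissible_iff.1 hf
      have h1 := hdeg w
      rw [degreeIn_insert hfB hwf] at h1
      have h2 := two_le_degreeIn heB hc (by rintro rfl; exact huv hcT) hw hwc
      lia
    have hsub2 : admissible B ∩ T ⊆
        (insert s(u, v) (T \ A) \ B) ∪ (A \ {a, b}) := by
      intro f hf
      rw [Finset.mem_inter] at hf
      have hu := hblock u (by simp) a' haB (Finset.mem_sdiff.1 ha').1 hua' f hf.1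
      have hv := hblock v (by simp) b' hbB (Finset.mem_sdiff.1 hb').1 hvb' f hf.1
      have hfB := (mem_admissible_iff.1 hf.1).2.1
      rw [Finset.mem_union]
      by_cases hfA : f ∈ A
      · right
        simp only [Finset.mem_sdiff, Finset.mem_insert, Finset.mem_singleton, not_or]
        refine ⟨hfA, ?_, ?_⟩ <;> rintro rfl
        · exact hu hua
        · exact hv hvb
      · left
        simp [hf.2, hfA, hfB]
    refine (Finset.card_le_card hsub2).trans ((Finset.card_union_le _ _).trans ?_)
    have h3 : ({a, b} : Finset _) ⊆ A := by
      intro x hx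
      simp only [Finset.mem_insert, Finset.mem_singleton] at hx
      rcases hx with rfl | rfl <;> assumption
    rw [Finset.card_sdiff_of_subset h3, Finset.card_pair hab]
    lia

variable {T R : Finset (Sym2 (Fin n))} {e a b : Sym2 (Fin n)}

theorem IsInsertion.sdiff_subset_admissible (hn : 3 ≤ n) (h : IsInsertion T R e a b)
    {B : Finset (Sym2 (Fin n))} (hB : B ⊆ R) : R \ B ⊆ admissible B := by
  intro f hf
  rw [Finset.mem_sdiff] at hf
  exact mem_admissible_of_isLinear hn hf.2 (h.isLinear.subset (Finset.insert_subset hf.1 hB))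

/-- With r + 1 edges of R missing, at most r + 2 edges of T are admissible, and the next edge
belongs to R with probability at least (r + 1)/((r + 2)(1 + 16/n)). The fractions telescope to 1/(r
+ 1). Steps beyond the r needed do no harm, since edges are never removed. -/
theorem IsInsertion.ofReal_le_prob_of_mem (hn : 6 ≤ n) (h : IsInsertion T R e a b) (r k : ℕ)
    {B : Finset (Sym2 (Fin n))} (hB : B ⊆ R) (he : e ∈ B) (ha : a ∈ B) (hb : b ∈ B)
    (hr : (R \ B).card = r) (hk : r ≤ k) :
    ENNReal.ofReal (Real.exp (-(16 * r / n)) / (r + 1)) ≤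
      prob (iterSteps (edgeStep (tourDist T)) k B) (R ⊆ ·) := by
  have hn0 : (0 : ℝ) < n := by
    have : 0 < n := by lia
    exact_mod_cast this
  induction r generalizing B k with
  | zero =>
    rw [Finset.card_eq_zero, Finset.sdiff_eq_empty_iff_subset] at hr
    rw [prob_eq_one fun C hC => hr.trans (subset_of_mem_support_iterSteps_edgeStep hC)]
    simp
  | succ r ih =>
    obtain ⟨k, rfl⟩ : ∃ k', k = k' + 1 := ⟨k - 1, by lia⟩
    have hm : (T \ B).card ≤ r + 4 := by
      have hsub : T \ B ⊆ (R \ B) ∪ (T \ R) := by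
        intro f hf
        simp only [Finset.mem_union, Finset.mem_sdiff] at hf ⊢
        tauto
      have h1 := (Finset.card_le_card hsub).trans (Finset.card_union_le _ _)
      have h2 := h.card_sdiff_le
      lia
    have hmn : (T \ B).card ≤ n :=
      (Finset.card_le_card Finset.sdiff_subset).trans_eq (card_tour (by lia) h.isTour)
    have hmem : ∀ f ∈ R \ B, f ∈ T := by
      intro f hf
      rw [Finset.mem_sdiff] at hf
      refine h.mem_of_ne f hf.1 ?_
      rintro rfl
      exact hf.2 he
    have hadm : (admissible B ∩ T).card ≤ r + 2 := by
      have := h.card_admissible B hB he ha hb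
      lia
    refine ofReal_le_prob_iterSteps_edgeStep (by lia) T
      (h.sdiff_subset_admissible (by lia) hB) ?_ (by positivity)
      (g := fun _ => Real.exp (-(16 * r / n)) / (r + 1)) (fun _ _ => by positivity) ?_
      (sum_relWeight_le hn h.isTour hadm le_rfl) ?_
    · rw [← Finset.card_pos]
      lia
    · intro f hf
      rw [Finset.mem_sdiff] at hf
      refine ih k (Finset.insert_subset hf.1 hB) (Finset.mem_insert_of_mem he)
        (Finset.mem_insert_of_mem ha) (Finset.mem_insert_of_mem hb) ?_ (by lia)
      rw [Finset.sdiff_insert, Finset.card_erase_of_mem (Finset.mem_sdiff.2 hf)]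
      lia
    · have h1 : ∀ f ∈ R \ B, relWeight T f * (Real.exp (-(16 * r / n)) / (r + 1)) =
          Real.exp (-(16 * r / n)) / (r + 1) := by
        intro f hf
        rw [relWeight, if_pos (hmem f hf), one_mul]
      rw [Finset.sum_congr rfl h1, Finset.sum_const, hr, nsmul_eq_mul]
      have h2 : (((T \ B).card : ℕ) : ℝ) ≤ n := by exact_mod_cast hmn
      have h3 : (((T \ B).card : ℕ) : ℝ) ≤ r + 4 := by exact_mod_cast hm
      have h4 : ((r + 2 : ℕ) : ℝ) + 8 * (((T \ B).card : ℕ) : ℝ) ^ 2 / (n : ℝ) ^ 2 ≤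
          ((r : ℝ) + 2) * (1 + 16 / n) := by
        -- One factor of the square is bounded by n, the other by r + 4 ≤ 2(r + 2).
        have h5 : 8 * (((T \ B).card : ℕ) : ℝ) ^ 2 / (n : ℝ) ^ 2 ≤
            8 * (2 * ((r : ℝ) + 2)) * n / (n : ℝ) ^ 2 := by
          rw [pow_two, ← mul_assoc]
          gcongr
          linarith
        have h6 : 8 * (2 * ((r : ℝ) + 2)) * n / (n : ℝ) ^ 2 = ((r : ℝ) + 2) * (16 / n) := by
          field_simp
          ring
        push_cast
        linarith
      push_cast
      calc _ ≤ Real.exp (-(16 * ((r : ℝ) + 1) / n)) / ((r : ℝ) + 1 + 1) *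
            (((r : ℝ) + 2) * (1 + 16 / n)) := by
            push_cast at h4
            gcongr
        _ = Real.exp (-(16 * ((r : ℝ) + 1) / n)) * (1 + 16 / n) := by
            field_simp
            ring
        _ ≤ Real.exp (-(16 * r / n)) := exp_mul_le_exp _ (by ring)
        _ = _ := by field_simp

/-- A lower bound for the probability that a given edge is chosen in a given step. -/
noncomputable def chooseWeight (T : Finset (Sym2 (Fin n))) (f : Sym2 (Fin n)) : ℝ :=
  relWeight T f / (2 * n)

theorem relWeight_eq_chooseWeight (hn : 0 < n) (T : Finset (Sym2 (Fin n))) (f : Sym2 (Fin n)) :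
    relWeight T f = 2 * n * chooseWeight T f := by
  have : (0 : ℝ) < n := by exact_mod_cast hn
  rw [chooseWeight]
  field_simp

/-- The induction step of `IsInsertion.ofReal_le_prob`. The descending factorial counts the ways to
place s outstanding edges at distinct steps; its recursion separates the case that one of them is
chosen now (s terms) from the case that one of y other edges of R is. -/
theorem descFactorial_mul_le {n m y p c : ℝ} (hn : 40 ≤ n) (hm : m ≤ n) (hnm : n ≤ 2 * m)
    (hmy : m ≤ y + 6) (hy : y ≤ n) (hp : 0 ≤ p) (hc : 0 ≤ c) (D s : ℕ) :
    (1 - 20 / n) ^ (D + 1) * p * (D + 1).descFactorial s * c * (m + 8 * m ^ 2 / n ^ 2) ≤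
      s * (2 * n * ((1 - 20 / n) ^ D * p * D.descFactorial (s - 1) * c)) +
        y * ((1 - 20 / n) ^ D * p * D.descFactorial s * c) := by
  have hn0 : 0 < n := by linarith
  have hm0 : 0 ≤ m := by linarith
  have hlam : 0 ≤ 1 - 20 / n := by
    rw [sub_nonneg, div_le_one hn0]
    linarith
  have hdesc : ((D + 1).descFactorial s : ℝ) =
      D.descFactorial s + s * D.descFactorial (s - 1) := by
    cases s with
    | zero => simp
    | succ t =>
      rw [Nat.succ_descFactorial_succ, Nat.descFactorial_succ, Nat.add_sub_cancel]
      by_cases ht : t ≤ D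
      · push_cast [Nat.cast_sub ht]
        ring
      · rw [Nat.descFactorial_eq_zero_iff_lt.2 (by lia)]
        simp
  have hZ : m + 8 * m ^ 2 / n ^ 2 ≤ m * (1 + 8 / n) := by
    have h1 : 8 * m ^ 2 / n ^ 2 ≤ 8 * m * n / n ^ 2 := by
      rw [pow_two m, ← mul_assoc]
      gcongr
    have h2 : 8 * m * n / n ^ 2 = m * (8 / n) := by field_simp
    linarith
  -- Origin of 20 = 8 + 12: the 8/n comes from weight outside T, and up to six edges missing from y
  -- are a fraction of at most 12/n of m, because m ≥ n/2.
  have hm1 : (1 - 20 / n) * (m * (1 + 8 / n)) ≤ y := by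
    have h1 : (1 - 20 / n) * (1 + 8 / n) ≤ 1 - 12 / n := by
      have h2 : (1 - 20 / n) * (1 + 8 / n) = 1 - 12 / n - 160 / n ^ 2 := by
        field_simp
        ring
      have : 0 ≤ 160 / n ^ 2 := by positivity
      linarith
    have h3 : 6 ≤ m * (12 / n) := by
      rw [mul_div_assoc', le_div_iff₀ hn0]
      linarith
    have h4 : m * ((1 - 20 / n) * (1 + 8 / n)) ≤ m * (1 - 12 / n) := by gcongr
    linarith
  have hm2 : (1 - 20 / n) * (m * (1 + 8 / n)) ≤ 2 * n := by linarith
  set lam := 1 - 20 / n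
  calc _ ≤ lam ^ (D + 1) * p * ((D + 1).descFactorial s : ℝ) * c * (m * (1 + 8 / n)) := by
        gcongr
    _ = lam ^ D * p * c * (s * (lam * (m * (1 + 8 / n)) * D.descFactorial (s - 1)) +
        lam * (m * (1 + 8 / n)) * D.descFactorial s) := by
        rw [hdesc]
        ring
    _ ≤ lam ^ D * p * c * (s * (2 * n * D.descFactorial (s - 1)) + y * D.descFactorial s) := by
        gcongr
    _ = _ := by ring

/-- D counts the steps left until n/2 edges are chosen. All of e, a, b must come by then, while
every other step picks some edge of R; the last factor is the price of completing R afterwards. -/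
theorem IsInsertion.ofReal_le_prob (hn : 40 ≤ n) (h : IsInsertion T R e a b) (D k : ℕ)
    {B : Finset (Sym2 (Fin n))} (hB : B ⊆ R) (hD : B.card + D = n / 2)
    (hk : B.card + k = n - 1) :
    ENNReal.ofReal ((1 - 20 / (n : ℝ)) ^ D * (∏ f ∈ {e, a, b} \ B, chooseWeight T f) *
      D.descFactorial ({e, a, b} \ B).card * (Real.exp (-16) / n)) ≤
      prob (iterSteps (edgeStep (tourDist T)) k B) (R ⊆ ·) := by
  have hn40 : (40 : ℝ) ≤ n := by exact_mod_cast hn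
  have hn0 : (0 : ℝ) < n := by linarith
  have hRcard := h.isLinear.card_lt (by lia)
  have hq : ∀ f, 0 < chooseWeight T f := fun f => by
    have := relWeight_pos (by lia) T f
    rw [chooseWeight]
    positivity
  have hlam : 0 ≤ 1 - 20 / (n : ℝ) := by
    rw [sub_nonneg, div_le_one hn0]
    linarith
  induction D generalizing B k with
  | zero =>
    by_cases hX : {e, a, b} \ B = ∅
    · rw [hX]
      rw [Finset.sdiff_eq_empty_iff_subset] at hX
      have hc := Finset.card_sdiff_of_subset hB
      have h1 := h.ofReal_le_prob_of_mem (by lia) (R \ B).card k hB (hX (by simp)) (hX (by simp))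
        (hX (by simp)) rfl (by lia)
      refine le_trans (ENNReal.ofReal_le_ofReal ?_) h1
      simp only [pow_zero, Finset.prod_empty, Finset.card_empty, Nat.descFactorial_zero,
        Nat.cast_one, mul_one, one_mul]
      have h2 : ((R \ B).card : ℝ) + 1 ≤ n := by
        have : (R \ B).card + 1 ≤ n := by lia
        exact_mod_cast this
      gcongr
      rw [div_le_iff₀ hn0]
      linarith
    -- No step is left but some edge is outstanding: the descending factorial vanishes and the bound
    -- is zero.
    · rw [← ne_eq, ← Finset.nonempty_iff_ne_empty, ← Finset.card_pos] at hX
      rw [Nat.descFactorial_eq_zero_iff_lt.2 hX]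
      simp
  | succ D ih =>
    obtain ⟨k, rfl⟩ : ∃ k', k = k' + 1 := ⟨k - 1, by lia⟩
    have hTcard := card_tour (by lia) h.isTour
    set X : Finset (Sym2 (Fin n)) := {e, a, b} with hX
    have hXR : X ⊆ R := by
      intro f hf
      simp only [hX, Finset.mem_insert, Finset.mem_singleton] at hf
      rcases hf with rfl | rfl | rfl
      · exact h.mem
      · exact h.left_mem
      · exact h.right_mem
    set m := (T \ B).card with hm
    have hmn : m ≤ n := (Finset.card_le_card Finset.sdiff_subset).trans_eq hTcard
    have hmlow : n ≤ 2 * m := by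
      have := Finset.le_card_sdiff B T
      lia
    have hadm : (admissible B ∩ T).card ≤ m := by
      refine Finset.card_le_card fun f hf => ?_
      rw [Finset.mem_inter] at hf
      exact Finset.mem_sdiff.2 ⟨hf.2, (mem_admissible_iff.1 hf.1).2.1⟩
    set Y := (R \ B) \ X with hY
    -- Three edges for T \ R and three for e, a, b.
    have hYcard : m ≤ Y.card + 6 := by
      have hsub : T \ B ⊆ Y ∪ ((T \ R) ∪ X) := by
        intro f hf
        simp only [hY, Finset.mem_union, Finset.mem_sdiff] at hf ⊢
        tauto
      have h1 := (Finset.card_le_card hsub).trans (Finset.card_union_le _ _)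
      have h2 := Finset.card_union_le (T \ R) X
      have h3 := h.card_sdiff_le
      have h4 : X.card ≤ 3 := Finset.card_le_three
      lia
    have hsplit : R \ B = (X \ B) ∪ Y := by
      ext f
      have := @hXR f
      simp only [hY, Finset.mem_union, Finset.mem_sdiff]
      tauto
    have hdisj : Disjoint (X \ B) Y := by
      rw [Finset.disjoint_left]
      intro f hf hfY
      exact (Finset.mem_sdiff.1 hfY).2 (Finset.mem_sdiff.1 hf).1
    set c₂ := Real.exp (-16) / (n : ℝ)
    set p := ∏ f ∈ X \ B, chooseWeight T f with hp
    have hp0 : 0 < p := Finset.prod_pos fun f _ => hq f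
    set G : Finset (Sym2 (Fin n)) → ℝ := fun C => (1 - 20 / (n : ℝ)) ^ D *
      (∏ f ∈ X \ C, chooseWeight T f) * D.descFactorial (X \ C).card * c₂ with hG
    have hc₂ : 0 ≤ c₂ := by positivity
    have hG0 : ∀ C, 0 ≤ G C := by
      intro C
      have : 0 ≤ ∏ f ∈ X \ C, chooseWeight T f := Finset.prod_nonneg fun f _ => (hq f).le
      positivity
    refine ofReal_le_prob_iterSteps_edgeStep (by lia) T (h.sdiff_subset_admissible (by lia) hB) ?_
      (by positivity) (g := fun f => G (insert f B)) (fun _ _ => hG0 _) ?_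
      (sum_relWeight_le (by lia) h.isTour hadm le_rfl) ?_
    · rw [← Finset.card_pos, Finset.card_sdiff_of_subset hB]
      have h1 : Y.card ≤ (R \ B).card := Finset.card_le_card Finset.sdiff_subset
      rw [Finset.card_sdiff_of_subset hB] at h1
      lia
    · intro f hf
      rw [Finset.mem_sdiff] at hf
      refine ih k (Finset.insert_subset hf.1 hB) ?_ ?_ <;>
      · rw [Finset.card_insert_of_notMem hf.2]
        lia
    · rw [hsplit, Finset.sum_union hdisj]
      set s := (X \ B).card with hs
      have hsumY : ∑ f ∈ Y, relWeight T f * G (insert f B) =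
          Y.card * ((1 - 20 / (n : ℝ)) ^ D * p * D.descFactorial s * c₂) := by
        rw [← nsmul_eq_mul, ← Finset.sum_const]
        refine Finset.sum_congr rfl fun f hf => ?_
        rw [hY, Finset.mem_sdiff, Finset.mem_sdiff] at hf
        have hfT : f ∈ T := h.mem_of_ne f hf.1.1 (by rintro rfl; exact hf.2 (by simp [hX]))
        have hXf : X \ insert f B = X \ B := by
          rw [Finset.sdiff_insert, Finset.erase_eq_of_notMem]
          simp [hf.2]
        simp only [hG]
        rw [relWeight, if_pos hfT, one_mul, hXf]
      have hsumX : ∑ f ∈ X \ B, relWeight T f * G (insert f B) =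
          s * (2 * n * ((1 - 20 / (n : ℝ)) ^ D * p * D.descFactorial (s - 1) * c₂)) := by
        rw [← nsmul_eq_mul, ← Finset.sum_const]
        refine Finset.sum_congr rfl fun f hf => ?_
        simp only [hG]
        rw [relWeight_eq_chooseWeight (by lia), Finset.sdiff_insert, Finset.card_erase_of_mem hf, hp,
          ← Finset.mul_prod_erase _ _ hf]
        ring
      rw [hsumY, hsumX]
      have hYn : Y.card ≤ n := by
        have : Y.card ≤ R.card :=
          Finset.card_le_card (Finset.sdiff_subset.trans Finset.sdiff_subset)
        lia
      exact descFactorial_mul_le hn40 (by exact_mod_cast hmn) (by exact_mod_cast hmlow)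
        (by exact_mod_cast hYcard) (by exact_mod_cast hYn) hp0.le hc₂ D s

theorem IsInsertion.ofReal_le_prob_edgeGen (hn : 40 ≤ n) (h : IsInsertion T R e a b) :
    ENNReal.ofReal (Real.exp (-56) / (512 * (n : ℝ) ^ 3)) ≤
      prob (edgeGen (tourDist T)) (R ⊆ ·) := by
  have hn40 : (40 : ℝ) ≤ n := by exact_mod_cast hn
  have h1 := h.ofReal_le_prob hn (n / 2) (n - 1) (Finset.empty_subset R) (by simp) (by simp)
  have h2 : prob (iterSteps (edgeStep (tourDist T)) (n - 1) ∅) (R ⊆ ·) ≤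
      prob (edgeGen (tourDist T)) (R ⊆ ·) := by
    rw [edgeGen, prob_map]
    exact prob_mono fun B _ hB => hB.trans (subset_closeTour B)
  refine le_trans (ENNReal.ofReal_le_ofReal ?_) (h1.trans h2)
  have hea : e ≠ a := by
    rintro rfl
    exact h.notMem h.left_mem_tour
  have heb : e ≠ b := by
    rintro rfl
    exact h.notMem h.right_mem_tour
  have hκ : 1 / (n : ℝ) ^ 2 ≤ 1 / (((n : ℝ) - 1) * ((n : ℝ) - 2)) := by
    apply one_div_le_one_div_of_le <;> nlinarith
  have hexp : Real.exp (-40) ≤ (1 - 20 / (n : ℝ)) ^ (n / 2) := by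
    refine (le_of_eq ?_).trans (exp_le_one_sub_div_pow (a := 20) (by norm_num) (by linarith)
      (by lia) (Nat.div_le_self n 2))
    norm_num
  have hdesc : ((n : ℝ) / 4) ^ 3 ≤ ((n / 2).descFactorial 3 : ℝ) := by
    obtain ⟨j, hj⟩ : ∃ j, n / 2 = j + 3 := ⟨n / 2 - 3, by lia⟩
    have h3 : (n : ℝ) ≤ 2 * j + 7 := by
      have : n ≤ 2 * j + 7 := by lia
      exact_mod_cast this
    rw [hj]
    have h4 : ((j + 3).descFactorial 3 : ℝ) = (j + 3) * (j + 2) * (j + 1) := by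
      simp only [Nat.succ_descFactorial_succ, Nat.descFactorial_zero]
      push_cast
      ring
    rw [h4]
    calc ((n : ℝ) / 4) ^ 3 = (n / 4) * (n / 4) * (n / 4) := by ring
      _ ≤ _ := by gcongr <;> linarith
  rw [Finset.sdiff_empty, Finset.card_eq_three.2 ⟨e, a, b, hea, heb, h.ne, rfl⟩,
    Finset.prod_insert (by simp [hea, heb]), Finset.prod_pair h.ne, chooseWeight, chooseWeight,
    chooseWeight, relWeight, if_neg h.notMem, relWeight, if_pos h.left_mem_tour, relWeight,
    if_pos h.right_mem_tour]
  have h56 : Real.exp (-56) = Real.exp (-40) * Real.exp (-16) := by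
    rw [← Real.exp_add]
    norm_num
  -- Here 512 = 2^3 * 4^3: three choice weights with denominator 2n, and a descending factorial of
  -- at least (n/4)^3. The only surviving power beyond their cancellation is n^(-2) for e and n^(-1)
  -- for the completion.
  calc Real.exp (-56) / (512 * (n : ℝ) ^ 3)
      = Real.exp (-40) * ((1 / (n : ℝ) ^ 2) / (2 * n) * (1 / (2 * n) * (1 / (2 * n)))) *
        ((n : ℝ) / 4) ^ 3 * (Real.exp (-16) / n) := by
        rw [h56]
        field_simp
        norm_num
    _ ≤ _ := by
        have hpow := (Real.exp_pos (-40)).le.trans hexp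
        have hκ' := (one_div_pos.2 (by positivity : (0 : ℝ) < (n : ℝ) ^ 2)).le.trans hκ
        gcongr

/-- Sum over all missing optimal edges f the probability that the sample contains the set built for
f. Each such event is an improvement, and they overlap at most threefold: a sample in one of them
has at most three edges outside T, and every f that occurs is one of these. Hence 1536 = 3 * 512. -/
theorem ofReal_le_prob_edgeGen_lt (hn : 40 ≤ n) (hT : IsTour T) :
    ENNReal.ofReal (Real.exp (-56) / 1536 * heavy T / (n : ℝ) ^ 3) ≤
      prob (edgeGen (tourDist T)) (fun s => heavy s < heavy T) := by
  classical
  have hex : ∀ f ∈ g1Optimum n \ T, ∃ A ⊆ T \ g1Optimum n, A.card ≤ 3 ∧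
      ∃ a b, IsInsertion T (insert f (T \ A)) f a b := by
    intro f hf
    rw [Finset.mem_sdiff] at hf
    induction f with | h u v => ?_
    have hne : u ≠ v := by
      simpa using not_isDiag_of_mem_tour (by lia) (isTour_g1Optimum n) hf.1
    exact (hasExchange_heavy (by lia) hT hf.1 hf.2).exists_isInsertion (by lia) hT hne hf.2
      Finset.sdiff_subset
  choose! A hA hA3 a b hins using hex
  have hsum : ∑ f ∈ g1Optimum n \ T,
      prob (edgeGen (tourDist T)) (insert f (T \ A f) ⊆ ·) ≤
      3 * prob (edgeGen (tourDist T)) (fun s => heavy s < heavy T) := by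
    simp only [prob]
    rw [← mean_sum, ← mean_const_mul]
    refine mean_mono fun s hs => ?_
    have hs' := edgeGen_support (by lia) (fun _ _ h => tourDist_pos (by lia) T h) hs
    simp only [Set.indicator, Set.mem_ofPred_eq, Pi.one_apply]
    rw [← Finset.sum_filter, Finset.sum_const, nsmul_eq_mul, mul_one]
    set F := (g1Optimum n \ T).filter fun f => insert f (T \ A f) ⊆ s with hF
    by_cases hne : F.Nonempty
    · obtain ⟨f, hf⟩ := hne
      have hf' := hf
      rw [hF, Finset.mem_filter, Finset.mem_sdiff] at hf'
      have hfm := Finset.mem_sdiff.2 hf'.1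
      have hlt := heavy_lt_of_subset (by lia) hT hs' (hA f hfm) hf'.1.1 hf'.1.2 hf'.2
      rw [if_pos hlt, mul_one]
      have hFs : F ⊆ s \ T := by
        intro g hg
        rw [hF, Finset.mem_filter, Finset.mem_sdiff] at hg
        exact Finset.mem_sdiff.2 ⟨hg.2 (Finset.mem_insert_self _ _), hg.1.2⟩
      have h1 := card_sdiff_le_two (by lia) hT (hA3 f hfm)
        ((Finset.subset_insert _ _).trans hf'.2)
      rw [card_tour (by lia) hs'] at h1
      have h2 : F.card ≤ 3 := by
        have := Finset.card_le_card hFs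
        lia
      exact_mod_cast h2
    · rw [Finset.not_nonempty_iff_eq_empty] at hne
      rw [hne]
      simp
  have hlow : (heavy T : ENNReal) * ENNReal.ofReal (Real.exp (-56) / (512 * (n : ℝ) ^ 3)) ≤
      3 * prob (edgeGen (tourDist T)) (fun s => heavy s < heavy T) := by
    refine le_trans ?_ hsum
    rw [← card_g1Optimum_sdiff (by lia) hT, ← nsmul_eq_mul, ← Finset.sum_const]
    exact Finset.sum_le_sum fun f hf => (hins f hf).ofReal_le_prob_edgeGen hn
  have h3 : ENNReal.ofReal (Real.exp (-56) / 1536 * heavy T / (n : ℝ) ^ 3) * 3 =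
      (heavy T : ENNReal) * ENNReal.ofReal (Real.exp (-56) / (512 * (n : ℝ) ^ 3)) := by
    rw [← ENNReal.ofReal_natCast, ← ENNReal.ofReal_mul (by positivity),
      ← ENNReal.ofReal_ofNat 3, ← ENNReal.ofReal_mul (by positivity)]
    congr 1
    ring
  rw [← h3, mul_comm] at hlow
  exact (ENNReal.mul_le_mul_iff_right (by norm_num) (by norm_num)).1 hlow

end Improvement

end CrossEntropyTSP

namespace CrossEntropyTSP

/-! ### The cross-entropy algorithm -/

section Algorithm

open scoped ENNReal

variable {n N : ℕ}

/-- The old distribution has coefficient zero and the empirical entries are 0 or 1, so they are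
reset to the two bounds and only the elite tour matters. -/
theorem calibrate_empirical (hn : 3 ≤ n) (hN : 0 < N) (P : Fin n → Fin n → ℝ)
    (x : Fin N → Finset (Sym2 (Fin n))) (τ : Equiv.Perm (Fin N)) :
    calibrate (1 / ((n : ℝ) * ((n : ℝ) - 2))) (1 - 1 / (n : ℝ))
      (fun i j => (1 - 1) * P i j + 1 * empirical 1 (x, τ) i j) = tourDist (x (τ ⟨0, hN⟩)) := by
  have hn3 : (3 : ℝ) ≤ n := by exact_mod_cast hn
  have hw := one_div_mul_pos hn
  have hw1 : 1 / ((n : ℝ) * ((n : ℝ) - 2)) ≤ 1 := by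
    rw [div_le_one (by nlinarith)]
    nlinarith
  have hW1 : 1 - 1 / (n : ℝ) < 1 := by
    have : 0 < 1 / (n : ℝ) := by positivity
    linarith
  funext i j
  have hemp : empirical 1 (x, τ) i j = if s(i, j) ∈ x (τ ⟨0, hN⟩) then 1 else 0 := by
    rw [empirical, Nat.cast_one, div_one, Finset.sum_eq_single ⟨0, hN⟩]
    · simp
    · intro k _ hk
      rw [if_neg]
      rintro ⟨h, -⟩
      exact hk (Fin.ext (by simpa using h))
    · simp
  rw [calibrate, tourDist, hemp]
  by_cases hij : i = j
  · simp [hij]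
  · rw [if_neg hij, if_neg hij]
    split_ifs <;> linarith

/-- An optimal solution has been evaluated. -/
def Found (d : Sym2 (Fin n) → ℝ) (h : List (Iteration n N)) : Prop :=
  ∃ s ∈ evaluated h, IsOptimal d s

variable {d : Sym2 (Fin n) → ℝ} {gen : (Fin n → Fin n → ℝ) → PMF (Finset (Sym2 (Fin n)))}
  {srt : SortRule d N} {ρ pmin pmax : ℝ} {M : ℕ}

theorem ceStep_support {st st' : (Fin n → Fin n → ℝ) × List (Iteration n N)}
    (h : st' ∈ (ceStep gen srt ρ M pmin pmax st).support) : ∃ r, st'.2 = st.2 ++ [r] := by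
  rw [ceStep, PMF.mem_support_bind_iff] at h
  obtain ⟨x, -, h⟩ := h
  rw [PMF.mem_support_map_iff] at h
  obtain ⟨τ, -, rfl⟩ := h
  exact ⟨(x, τ), rfl⟩

theorem iterSteps_ceStep_support {K : ℕ} {st st' : (Fin n → Fin n → ℝ) × List (Iteration n N)}
    (h : st' ∈ (iterSteps (ceStep gen srt ρ M pmin pmax) K st).support) :
    ∃ l : List (Iteration n N), l.length = K ∧ st'.2 = st.2 ++ l := by
  refine iterSteps_support (step := ceStep gen srt ρ M pmin pmax)
    (I := fun k st' => ∃ l : List (Iteration n N), l.length = k ∧ st'.2 = st.2 ++ l) (K := K) ?_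
    ⟨[], rfl, by simp⟩ K le_rfl st' h
  rintro k - a ⟨l, rfl, ha⟩ b hb
  obtain ⟨r, hr⟩ := ceStep_support hb
  exact ⟨l ++ [r], by simp, by rw [hr, ha, List.append_assoc]⟩

theorem evaluated_append (h l : List (Iteration n N)) :
    evaluated (h ++ l) = evaluated h ++ evaluated l := by
  simp [evaluated]

theorem Found.append {h : List (Iteration n N)} (hf : Found d h) (l : List (Iteration n N)) :
    Found d (h ++ l) := by
  obtain ⟨s, hs, hopt⟩ := hf
  exact ⟨s, by rw [evaluated_append]; exact List.mem_append_left _ hs, hopt⟩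

theorem length_evaluated (h : List (Iteration n N)) : (evaluated h).length = h.length * N := by
  induction h with
  | nil => simp [evaluated]
  | cons r h ih =>
    rw [evaluated, List.flatMap_cons, List.length_append, List.length_ofFn, List.length_cons,
      Nat.succ_mul, Nat.add_comm]
    exact congrArg (· + N) ih

theorem prob_eq_zero {α : Type} {p : PMF α} {S : α → Prop} (h : ∀ a ∈ p.support, ¬ S a) :
    prob p S = 0 := by
  have h1 := prob_add_prob_not p S
  rw [prob_eq_one h] at h1
  have h2 : prob p S + 1 = 0 + 1 := by rw [h1, zero_add]
  exact (ENNReal.add_left_inj ENNReal.one_ne_top).1 h2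

theorem prob_not_found_of_found {K : ℕ} {st : (Fin n → Fin n → ℝ) × List (Iteration n N)}
    (hf : Found d st.2) :
    prob (iterSteps (ceStep gen srt ρ M pmin pmax) K st) (fun st' => ¬ Found d st'.2) = 0 := by
  refine prob_eq_zero fun st' hst' => ?_
  obtain ⟨l, -, hl⟩ := iterSteps_ceStep_support hst'
  rw [not_not, hl]
  exact hf.append l

/-- Two properties are allowed so that success within K iterations can be transferred both to a
longer run and to a truncated list of evaluations. -/
theorem prob_not_mono_time {α : Type} {step : α → PMF α} {K r : ℕ} {a : α} {S Q : α → Prop}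
    (h : ∀ b ∈ (iterSteps step K a).support, S b → ∀ c ∈ (iterSteps step r b).support, Q c) :
    prob (iterSteps step (K + r) a) (fun c => ¬ Q c) ≤
      prob (iterSteps step K a) (fun b => ¬ S b) := by
  rw [iterSteps_add, prob_bind, prob]
  refine mean_mono fun b hb => ?_
  by_cases hS : S b
  · rw [prob_eq_zero fun c hc => not_not.2 (h b hb hS c hc)]
    exact zero_le
  · rw [Set.indicator_of_mem (by exact hS)]
    exact prob_le_one _ _

/-- The first solution after sorting has the smallest number of long edges. -/
theorem heavy_first_le (hn : 3 ≤ n) (hN : 0 < N) {srt : SortRule (g1Dist n) N}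
    {past : List (Iteration n N)} {x : Fin N → Finset (Sym2 (Fin n))} (hx : ∀ i, IsTour (x i))
    {τ : Equiv.Perm (Fin N)} (hτ : τ ∈ (srt.order past x).support) (i : Fin N) :
    heavy (x (τ ⟨0, hN⟩)) ≤ heavy (x i) := by
  have h := srt.sorted past x τ hτ (show (⟨0, hN⟩ : Fin N) ≤ τ.symm i from Fin.le_def.2 (by simp))
  simp only [Equiv.apply_symm_apply] at h
  exact heavy_le_of_cost_le hn (hx _) (hx i) h

/-- The probability that `K` further iterations, starting from the given state, do not yield an
optimal solution. -/
noncomputable def failure (gen : (Fin n → Fin n → ℝ) → PMF (Finset (Sym2 (Fin n))))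
    (srt : SortRule (g1Dist n) N) (K : ℕ) (st : (Fin n → Fin n → ℝ) × List (Iteration n N)) :
    ℝ≥0∞ :=
  prob (iterSteps (ceStep gen srt 1 1 (1 / ((n : ℝ) * ((n : ℝ) - 2))) (1 - 1 / (n : ℝ))) K st)
    fun st' => ¬ Found (g1Dist n) st'.2

theorem failure_succ (hn : 3 ≤ n) (hN : 0 < N) (srt : SortRule (g1Dist n) N) (K : ℕ)
    (st : (Fin n → Fin n → ℝ) × List (Iteration n N)) :
    failure gen srt (K + 1) st = mean (iid (gen st.1) N) fun x => mean (srt.order st.2 x) fun τ =>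
      failure gen srt K (tourDist (x (τ ⟨0, hN⟩)), st.2 ++ [(x, τ)]) := by
  rw [failure, iterSteps, prob_bind, ceStep, mean_bind]
  simp only [mean_map, calibrate_empirical hn hN]
  rfl

theorem failure_of_heavy_eq_zero (hn : 3 ≤ n) {srt : SortRule (g1Dist n) N} {K : ℕ}
    {P : Fin n → Fin n → ℝ} {past : List (Iteration n N)} {x : Fin N → Finset (Sym2 (Fin n))}
    {τ : Equiv.Perm (Fin N)} {i : Fin N} (hi : IsTour (x i)) (h0 : heavy (x i) = 0) :
    failure gen srt K (P, past ++ [(x, τ)]) = 0 := by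
  refine prob_not_found_of_found ⟨x i, ?_, ?_⟩
  · simp [evaluated]
  · rw [isOptimal_iff hn]
    exact (heavy_eq_zero_iff hn hi).1 h0

/-- The properties of a generation method that the analysis uses: from the calibration of a tour,
a tour that is not worse is drawn with probability at least `c`, and a better one with probability
at least `p k` if `k` edges are long. -/
structure IsImproving (gen : (Fin n → Fin n → ℝ) → PMF (Finset (Sym2 (Fin n)))) (c : ℝ)
    (p : ℕ → ℝ) : Prop where
  nonneg : 0 ≤ c
  le_one : c ≤ 1
  rate_nonneg : ∀ k, 0 ≤ p k
  rate_le_one : ∀ k ≤ n, p k ≤ 1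
  isTour : ∀ P : Fin n → Fin n → ℝ, (∀ i j, i ≠ j → 0 < P i j) → ∀ s ∈ (gen P).support, IsTour s
  prob_le : ∀ T, IsTour T → ENNReal.ofReal c ≤
    prob (gen (tourDist T)) (fun s => heavy s ≤ heavy T)
  prob_lt : ∀ T, IsTour T → 0 < heavy T → ENNReal.ofReal (p (heavy T)) ≤
    prob (gen (tourDist T)) (fun s => heavy s < heavy T)

theorem prob_iid_not_le {α : Type} {p : PMF α} {S : α → Prop} {c : ℝ} (hc : 0 ≤ c) (hc1 : c ≤ 1)
    (h : ENNReal.ofReal c ≤ prob p S) (N : ℕ) :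
    prob (iid p N) (fun x => ∀ i, ¬ S (x i)) ≤ ENNReal.ofReal ((1 - c) ^ N) := by
  rw [prob_iid_forall p (fun a => ¬ S a), ENNReal.ofReal_pow (by linarith)]
  gcongr
  exact prob_not_le hc h

/-- L k is the iteration budget of level k, and D is what remains for the current level beyond the
budgets reserved for lower ones. The three terms charge for a fall-back in some iteration, for an
overrun at a later level, and for an overrun at the current level. -/
theorem IsImproving.failure_tourDist_le (hn : 3 ≤ n) (hN : 0 < N) {c : ℝ} {p : ℕ → ℝ}
    (hgen : IsImproving gen c p) (srt : SortRule (g1Dist n) N) {L : ℕ → ℕ} {η : ℝ} (hη : 0 ≤ η)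
    (hL : ∀ k, 0 < k → k ≤ n → (1 - p k) ^ (N * L k) ≤ η) (K : ℕ) {T : Finset (Sym2 (Fin n))}
    (hT : IsTour T) (hpos : 0 < heavy T) (past : List (Iteration n N)) (D : ℕ)
    (hK : K = ∑ i ∈ Finset.range (heavy T), L i + D) :
    failure gen srt K (tourDist T, past) ≤ ENNReal.ofReal (K * (1 - c) ^ N +
      ((heavy T : ℝ) - 1) * η + (1 - p (heavy T)) ^ (N * D)) := by
  have hc0 : 0 ≤ 1 - c := by linarith [hgen.le_one]
  have hδ : 0 ≤ (1 - c) ^ N := by positivity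
  have hk1 : ∀ k : ℕ, 0 < k → (0 : ℝ) ≤ ((k : ℝ) - 1) * η := by
    intro k hk
    have : (1 : ℝ) ≤ k := by exact_mod_cast hk
    exact mul_nonneg (by linarith) hη
  induction K generalizing T past D with
  | zero =>
    -- With D = 0, here and in the next case, the last term is a zeroth power and hence 1, so the
    -- bound is trivial.
    obtain rfl : D = 0 := by lia
    refine (prob_le_one _ _).trans ?_
    rw [← ENNReal.ofReal_one]
    refine ENNReal.ofReal_le_ofReal ?_
    have := hk1 _ hpos
    simp only [mul_zero, pow_zero, Nat.cast_zero, zero_mul]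
    linarith
  | succ K ih =>
    cases D with
    | zero =>
      refine (prob_le_one _ _).trans ?_
      rw [← ENNReal.ofReal_one]
      refine ENNReal.ofReal_le_ofReal ?_
      have := hk1 _ hpos
      have : 0 ≤ ((K + 1 : ℕ) : ℝ) * (1 - c) ^ N := by positivity
      simp only [mul_zero, pow_zero]
      linarith
    | succ D =>
      set k := heavy T with hk
      have hq : 0 ≤ 1 - p k := by linarith [hgen.rate_le_one k (heavy_le hn hT)]
      have hKδ : 0 ≤ (K : ℝ) * (1 - c) ^ N := by positivity
      rw [failure_succ hn hN]
      -- The first indicator pays for samples that are all worse than T, the middle term covers a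
      -- strict improvement, and at an unchanged level the second indicator keeps the last term with
      -- one unit of budget less.
      have hbound : ∀ x ∈ (iid (gen (tourDist T)) N).support,
          (mean (srt.order past x) fun τ =>
            failure gen srt K (tourDist (x (τ ⟨0, hN⟩)), past ++ [(x, τ)])) ≤
          ({x | ∀ i, ¬ heavy (x i) ≤ k} : Set (Fin N → _)).indicator 1 x +
          ENNReal.ofReal (K * (1 - c) ^ N + ((k : ℝ) - 1) * η) +
          ({x | ∀ i, ¬ heavy (x i) < k} : Set (Fin N → _)).indicator 1 x *
            ENNReal.ofReal ((1 - p k) ^ (N * D)) := by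
        intro x hx
        have htour : ∀ i, IsTour (x i) := fun i =>
          hgen.isTour _ (fun _ _ h => tourDist_pos hn T h) _ (iid_support hx i)
        refine (mean_mono fun τ hτ => ?_).trans (mean_const (srt.order past x) _).le
        have hmin := heavy_first_le hn hN htour hτ
        set T' := x (τ ⟨0, hN⟩) with hT'
        have hT'tour : IsTour T' := htour _
        rcases Nat.eq_zero_or_pos (heavy T') with h0 | hpos'
        · rw [failure_of_heavy_eq_zero hn hT'tour h0]
          exact zero_le
        rcases lt_trichotomy (heavy T') k with hlt | heq | hgt
        -- After an improvement the reserved budgets include a full L for the new level, so its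
        -- overrun term is at most η; this is paid by the decrease of the level.
        · have hsum : ∑ i ∈ Finset.range (heavy T'), L i + L (heavy T') ≤
              ∑ i ∈ Finset.range k, L i := by
            rw [← Finset.sum_range_succ]
            exact Finset.sum_le_sum_of_subset (Finset.range_subset_range.2 hlt)
          obtain ⟨D', hD'⟩ : ∃ D', K = ∑ i ∈ Finset.range (heavy T'), L i + (L (heavy T') + D') :=
            ⟨K - ∑ i ∈ Finset.range (heavy T'), L i - L (heavy T'), by lia⟩
          refine (ih hT'tour hpos' _ _ hD').trans ?_
          refine le_trans ?_ (le_self_add : _ ≤ _)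
          refine le_trans ?_ (le_add_self : _ ≤ _)
          refine ENNReal.ofReal_le_ofReal ?_
          have hle := heavy_le hn hT'tour
          have hq' : 0 ≤ 1 - p (heavy T') := by linarith [hgen.rate_le_one _ hle]
          have h1 : (1 - p (heavy T')) ^ (N * (L (heavy T') + D')) ≤ η := by
            refine le_trans ?_ (hL _ hpos' hle)
            refine pow_le_pow_of_le_one hq' (by linarith [hgen.rate_nonneg (heavy T')]) ?_
            gcongr
            lia
          have h2 : (heavy T' : ℝ) + 1 ≤ k := by exact_mod_cast hlt
          nlinarith
        · have h1 : ∀ i, ¬ heavy (x i) < k := fun i => not_lt.2 (heq ▸ hmin i)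
          rw [Set.indicator_of_mem (s := {x : Fin N → Finset (Sym2 (Fin n)) | ∀ i, ¬ heavy (x i) < k}) (by exact h1), Pi.one_apply,
            one_mul, add_assoc, ← ENNReal.ofReal_add (by linarith [hk1 k hpos]) (by positivity)]
          refine le_trans ?_ (le_add_self : _ ≤ _)
          have := ih hT'tour hpos' (past ++ [(x, τ)]) D (by rw [heq]; lia)
          rwa [heq] at this
        · have h1 : ∀ i, ¬ heavy (x i) ≤ k := fun i => not_le.2 (hgt.trans_le (hmin i))
          rw [Set.indicator_of_mem (s := {x : Fin N → Finset (Sym2 (Fin n)) | ∀ i, ¬ heavy (x i) ≤ k}) (by exact h1), Pi.one_apply,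
            add_assoc]
          exact (prob_le_one _ _).trans (le_self_add : _ ≤ _)
      refine (mean_mono hbound).trans ?_
      rw [mean_add, mean_add, mean_const, mean_mul_const]
      have h1 := prob_iid_not_le hgen.nonneg hgen.le_one (hgen.prob_le T hT) N
      have h2 := prob_iid_not_le (hgen.rate_nonneg k) (by linarith) (hgen.prob_lt T hT hpos) N
      refine (add_le_add (add_le_add_left h1 _) (mul_le_mul_left h2 _)).trans ?_
      rw [← ENNReal.ofReal_mul (by positivity), ← ENNReal.ofReal_add hδ (by linarith [hk1 k hpos]),
        ← ENNReal.ofReal_add (by linarith [hk1 k hpos]) (by positivity)]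
      refine ENNReal.ofReal_le_ofReal (le_of_eq ?_)
      rw [← pow_add]
      push_cast
      ring_nf

/-- The additional first iteration samples from the uniform distribution and only has to produce
some tour; its level is at most n. -/
theorem IsImproving.failure_initial_le (hn : 3 ≤ n) (hN : 0 < N) {c : ℝ} {p : ℕ → ℝ}
    (hgen : IsImproving gen c p) (srt : SortRule (g1Dist n) N) {L : ℕ → ℕ} {η : ℝ} (hη : 0 ≤ η)
    (hL : ∀ k, 0 < k → k ≤ n → (1 - p k) ^ (N * L k) ≤ η) :
    failure gen srt (∑ i ∈ Finset.range (n + 1), L i + 1) (initial n, []) ≤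
      ENNReal.ofReal ((∑ i ∈ Finset.range (n + 1), L i : ℕ) * (1 - c) ^ N + n * η) := by
  rw [failure_succ hn hN]
  set K := ∑ i ∈ Finset.range (n + 1), L i with hK
  refine (mean_mono fun x hx => ?_).trans (mean_const (iid (gen (initial n)) N) _).le
  have htour : ∀ i, IsTour (x i) := by
    refine fun i => hgen.isTour _ (fun i j hij => ?_) _ (iid_support hx i)
    have : (3 : ℝ) ≤ n := by exact_mod_cast hn
    change 0 < if i = j then (0 : ℝ) else 1 / ((n : ℝ) - 1)
    rw [if_neg hij]
    exact one_div_pos.2 (by linarith)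
  refine (mean_mono fun τ hτ => ?_).trans (mean_const (srt.order [] x) _).le
  set T' := x (τ ⟨0, hN⟩) with hT'
  have hT'tour : IsTour T' := htour _
  rcases Nat.eq_zero_or_pos (heavy T') with h0 | hpos'
  · rw [failure_of_heavy_eq_zero hn hT'tour h0]
    exact zero_le
  · have hle := heavy_le hn hT'tour
    have hsum : ∑ i ∈ Finset.range (heavy T'), L i + L (heavy T') ≤ K := by
      rw [← Finset.sum_range_succ]
      exact Finset.sum_le_sum_of_subset (Finset.range_subset_range.2 (by lia))
    obtain ⟨D', hD'⟩ : ∃ D', K = ∑ i ∈ Finset.range (heavy T'), L i + (L (heavy T') + D') :=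
      ⟨K - ∑ i ∈ Finset.range (heavy T'), L i - L (heavy T'), by lia⟩
    refine (hgen.failure_tourDist_le hn hN srt hη hL K hT'tour hpos' _ _ hD').trans ?_
    refine ENNReal.ofReal_le_ofReal ?_
    have hq' : 0 ≤ 1 - p (heavy T') := by linarith [hgen.rate_le_one _ hle]
    have h1 : (1 - p (heavy T')) ^ (N * (L (heavy T') + D')) ≤ η := by
      refine le_trans ?_ (hL _ hpos' hle)
      refine pow_le_pow_of_le_one hq' (by linarith [hgen.rate_nonneg (heavy T')]) ?_
      gcongr
      lia
    have h2 : (heavy T' : ℝ) ≤ n := by exact_mod_cast hle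
    nlinarith

/-! ### From failure bounds to success probabilities -/

theorem one_sub_le_toReal_prob {α : Type} {p : PMF α} {S : α → Prop} {ε : ℝ} (hε : 0 ≤ ε)
    (h : prob p (fun a => ¬ S a) ≤ ENNReal.ofReal ε) : 1 - ε ≤ (prob p S).toReal := by
  have h1 := prob_add_prob_not p S
  have h2 := congrArg ENNReal.toReal h1
  rw [ENNReal.toReal_add (ne_top_of_le_ne_top ENNReal.one_ne_top (prob_le_one _ _))
    (ne_top_of_le_ne_top ENNReal.one_ne_top (prob_le_one _ _)), ENNReal.toReal_one] at h2
  have h3 := ENNReal.toReal_le_of_le_ofReal hε h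
  linarith

theorem one_sub_le_probIterations {srt : SortRule (g1Dist n) N} {K J : ℕ} (hKJ : K ≤ J) {ε : ℝ}
    (hε : 0 ≤ ε) (h : failure gen srt K (initial n, []) ≤ ENNReal.ofReal ε) :
    1 - ε ≤ probIterations gen srt J := by
  rw [probIterations, ceRun, ← prob_eq_toOuterMeasure, prob_map]
  refine one_sub_le_toReal_prob hε (le_trans ?_ h)
  obtain ⟨r, rfl⟩ := Nat.exists_eq_add_of_le hKJ
  refine prob_not_mono_time
    (S := fun st : (Fin n → Fin n → ℝ) × List (Iteration n N) => Found (g1Dist n) st.2)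
    (Q := fun st => Found (g1Dist n) st.2) fun b _ hb st hst => ?_
  obtain ⟨l, -, hl⟩ := iterSteps_ceStep_support hst
  rw [hl]
  exact hb.append l

/-- The first K iterations evaluate K * N ≤ J solutions, so truncation after J evaluations loses
none of them. -/
theorem one_sub_le_probRuntime {srt : SortRule (g1Dist n) N} {K J : ℕ} (hKJ : K ≤ J)
    (hNJ : K * N ≤ J) {ε : ℝ} (hε : 0 ≤ ε)
    (h : failure gen srt K (initial n, []) ≤ ENNReal.ofReal ε) :
    1 - ε ≤ probRuntime gen srt J := by
  rw [probRuntime, ceRun, ← prob_eq_toOuterMeasure, prob_map]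
  refine one_sub_le_toReal_prob hε (le_trans ?_ h)
  obtain ⟨r, hr⟩ := Nat.exists_eq_add_of_le hKJ
  have := prob_not_mono_time (K := K) (r := r) (a := (initial n, []))
    (step := ceStep gen srt 1 1 (1 / ((n : ℝ) * ((n : ℝ) - 2))) (1 - 1 / (n : ℝ)))
    (S := fun st => Found (g1Dist n) st.2)
    (Q := fun st => ∃ s ∈ (evaluated st.2).take J, IsOptimal (g1Dist n) s) ?_
  · rwa [← hr] at this
  · rintro b hb ⟨s, hs, hopt⟩ st hst
    obtain ⟨l, -, hl⟩ := iterSteps_ceStep_support hst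
    obtain ⟨l', hl', hb'⟩ := iterSteps_ceStep_support hb
    refine ⟨s, ?_, hopt⟩
    have hlen : (evaluated b.2).length ≤ J := by
      rw [length_evaluated, hb']
      simpa [hl'] using hNJ
    rw [hl, evaluated_append, List.take_append, List.take_of_length_le hlen]
    exact List.mem_append_left _ hs

end Algorithm

end CrossEntropyTSP

namespace CrossEntropyTSP

/-! ### Asymptotics -/

section Asymptotics

/-- Both error types are at most exp(-γN) per event: at most n^7 iterations and n levels. The
exponent 7 is merely a crude polynomial bound serving both generation methods. -/
theorem IsImproving.failure_le {n N : ℕ} {gen : (Fin n → Fin n → ℝ) → PMF (Finset (Sym2 (Fin n)))}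
    {c : ℝ} {p : ℕ → ℝ} (hn : 3 ≤ n) (hN : 0 < N) (hgen : IsImproving gen c p) {L : ℕ → ℕ} {γ : ℝ}
    (hγ : γ ≤ c) (hL : ∀ k, 0 < k → k ≤ n → γ ≤ p k * L k)
    (hK : ∑ i ∈ Finset.range (n + 1), L i ≤ n ^ 7) (srt : SortRule (g1Dist n) N) :
    failure gen srt (∑ i ∈ Finset.range (n + 1), L i + 1) (initial n, []) ≤
      ENNReal.ofReal ((n : ℝ) ^ 8 * Real.exp (-γ * N)) := by
  have hpow : ∀ x : ℝ, x ≤ 1 → ∀ m : ℕ, (1 - x) ^ m ≤ Real.exp (-(x * m)) := by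
    intro x hx m
    calc (1 - x) ^ m ≤ Real.exp (-x) ^ m :=
          pow_le_pow_left₀ (by linarith) (Real.one_sub_le_exp_neg x) m
      _ = Real.exp (-(x * m)) := by
          rw [← Real.exp_nat_mul]
          congr 1
          ring
  have hη : ∀ k, 0 < k → k ≤ n → (1 - p k) ^ (N * L k) ≤ Real.exp (-γ * N) := by
    intro k hk hkn
    refine (hpow _ (hgen.rate_le_one k hkn) _).trans (Real.exp_le_exp.2 ?_)
    have := mul_le_mul_of_nonneg_right (hL k hk hkn) (Nat.cast_nonneg (α := ℝ) N)
    push_cast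
    linarith
  refine (hgen.failure_initial_le hn hN srt (Real.exp_pos _).le hη).trans
    (ENNReal.ofReal_le_ofReal ?_)
  have hδ : (1 - c) ^ N ≤ Real.exp (-γ * N) := by
    refine (hpow _ hgen.le_one _).trans (Real.exp_le_exp.2 ?_)
    have := mul_le_mul_of_nonneg_right hγ (Nat.cast_nonneg (α := ℝ) N)
    linarith
  have hKn : ((∑ i ∈ Finset.range (n + 1), L i : ℕ) : ℝ) ≤ (n : ℝ) ^ 7 := by exact_mod_cast hK
  have hn3 : (3 : ℝ) ≤ n := by exact_mod_cast hn
  have hn7 : (n : ℝ) ≤ (n : ℝ) ^ 7 := le_self_pow₀ (by linarith) (by norm_num)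
  have hδ0 : 0 ≤ (1 - c) ^ N := pow_nonneg (by linarith [hgen.le_one]) N
  calc _ ≤ (n : ℝ) ^ 7 * Real.exp (-γ * N) + n * Real.exp (-γ * N) := by gcongr
    _ = ((n : ℝ) ^ 7 + n) * Real.exp (-γ * N) := by ring
    _ ≤ (n : ℝ) ^ 8 * Real.exp (-γ * N) := by
        gcongr
        have : (3 : ℝ) * (n : ℝ) ^ 7 ≤ n * (n : ℝ) ^ 7 := by gcongr
        have h8 : (n : ℝ) ^ 8 = n * (n : ℝ) ^ 7 := by ring
        have : (0 : ℝ) ≤ (n : ℝ) ^ 7 := by positivity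
        linarith

theorem sub_one_le_natDiv (a b : ℕ) (hb : 0 < b) : (a : ℝ) / b - 1 ≤ (a / b : ℕ) := by
  have hb' : (0 : ℝ) < b := by exact_mod_cast hb
  have h := Nat.lt_mul_div_succ a hb
  have h' : (a : ℝ) < b * ((a / b : ℕ) + 1) := by exact_mod_cast h
  rw [sub_le_iff_le_add, div_le_iff₀ hb']
  linarith

theorem isImproving_vertexGen {n : ℕ} (hn : 3 ≤ n) :
    IsImproving (n := n) vertexGen (Real.exp (-2) / 3)
      (fun _ => Real.exp (-2) / (27 * (n : ℝ) ^ 5)) := by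
  have hn3 : (3 : ℝ) ≤ n := by exact_mod_cast hn
  have hexp : Real.exp (-2) ≤ 1 := Real.exp_le_one_iff.2 (by norm_num)
  have h5 : (1 : ℝ) ≤ (n : ℝ) ^ 5 := one_le_pow₀ (by linarith)
  exact
  { nonneg := by positivity
    le_one := by linarith
    rate_nonneg := fun _ => by positivity
    rate_le_one := fun _ _ => by
      rw [div_le_one (by positivity)]
      linarith
    isTour := fun _ hP _ hs => vertexGen_support hn hP hs
    prob_le := fun _ hT => ofReal_le_prob_vertexGen_le hn hT
    prob_lt := fun _ hT h => ofReal_le_prob_vertexGen_lt hn hT h }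

theorem isImproving_edgeGen {n : ℕ} (hn : 40 ≤ n) :
    IsImproving (n := n) edgeGen (Real.exp (-8))
      (fun k => Real.exp (-56) / 1536 * k / (n : ℝ) ^ 3) := by
  have hn3 : (40 : ℝ) ≤ n := by exact_mod_cast hn
  have hexp : Real.exp (-56) ≤ 1 := Real.exp_le_one_iff.2 (by norm_num)
  exact
  { nonneg := by positivity
    le_one := Real.exp_le_one_iff.2 (by norm_num)
    rate_nonneg := fun _ => by positivity
    rate_le_one := fun k hk => by
      have hkn : (k : ℝ) ≤ n := by exact_mod_cast hk
      have h3 : (n : ℝ) ≤ (n : ℝ) ^ 3 := le_self_pow₀ (by linarith) (by norm_num)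
      rw [div_le_one (by positivity)]
      have h4 : Real.exp (-56) / 1536 ≤ 1 := by linarith
      have := mul_le_mul_of_nonneg_right h4 (Nat.cast_nonneg (α := ℝ) k)
      linarith
    isTour := fun _ hP _ hs => edgeGen_support (by lia) hP hs
    prob_le := fun _ hT => ofReal_le_prob_edgeGen_le (by lia) hT
    prob_lt := fun _ hT _ => ofReal_le_prob_edgeGen_lt hn hT }

theorem exists_failure_vertexGen_le : ∃ γ : ℝ, 0 < γ ∧ ∀ᶠ n : ℕ in atTop, ∃ K : ℕ,
    (K : ℝ) ≤ (n : ℝ) ^ 6 / 4 ∧ ∀ N : ℕ, 0 < N → ∀ srt : SortRule (g1Dist n) N,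
      failure vertexGen srt K (initial n, []) ≤
        ENNReal.ofReal ((n : ℝ) ^ 8 * Real.exp (-γ * N)) := by
  refine ⟨Real.exp (-2) / 432, by positivity, ?_⟩
  filter_upwards [eventually_ge_atTop 3] with n hn
  have hn3 : (3 : ℝ) ≤ n := by exact_mod_cast hn
  have h5 : (243 : ℝ) ≤ (n : ℝ) ^ 5 := by
    calc (243 : ℝ) = 3 ^ 5 := by norm_num
      _ ≤ (n : ℝ) ^ 5 := by gcongr
  have hexp := Real.exp_pos (-2)
  -- Small enough that n + 1 budgets and the first iteration fit into n^6/4; rounding down still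
  -- leaves n^5/16, whence 432 = 27 * 16.
  set L : ℕ → ℕ := fun _ => n ^ 5 / 8 with hL
  have hsum : ∑ i ∈ Finset.range (n + 1), L i = (n + 1) * (n ^ 5 / 8) := by
    rw [Finset.sum_const, Finset.card_range, smul_eq_mul]
  have hdiv : ((n ^ 5 / 8 : ℕ) : ℝ) ≤ (n : ℝ) ^ 5 / 8 := by
    have := Nat.cast_div_le (α := ℝ) (m := n ^ 5) (n := 8)
    push_cast at this
    exact this
  have hK : ((∑ i ∈ Finset.range (n + 1), L i + 1 : ℕ) : ℝ) ≤ (n : ℝ) ^ 6 / 4 := by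
    rw [hsum]
    push_cast
    have h1 : ((n : ℝ) + 1) * ((n ^ 5 / 8 : ℕ) : ℝ) ≤ ((n : ℝ) + 1) * ((n : ℝ) ^ 5 / 8) := by gcongr
    have h6 : 3 * (n : ℝ) ^ 5 ≤ (n : ℝ) ^ 6 := by
      have : (n : ℝ) ^ 6 = n * (n : ℝ) ^ 5 := by ring
      rw [this]
      gcongr
    linarith
  refine ⟨_, hK, fun N hN srt => ?_⟩
  refine (isImproving_vertexGen hn).failure_le hn hN (by linarith) (fun k _ _ => ?_) ?_ srt
  · have h1 := sub_one_le_natDiv (n ^ 5) 8 (by norm_num)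
    have h2 : (n : ℝ) ^ 5 / 16 ≤ ((n ^ 5 / 8 : ℕ) : ℝ) := by
      push_cast at h1 ⊢
      linarith
    calc Real.exp (-2) / 432 = Real.exp (-2) / (27 * (n : ℝ) ^ 5) * ((n : ℝ) ^ 5 / 16) := by
          field_simp
          norm_num
      _ ≤ _ := by gcongr
  · rw [hsum]
    calc (n + 1) * (n ^ 5 / 8) ≤ (n * n) * n ^ 5 := by
          gcongr
          · nlinarith
          · exact Nat.div_le_self _ _
      _ = n ^ 7 := by ring

theorem exists_failure_edgeGen_le : ∃ γ : ℝ, 0 < γ ∧ ∀ᶠ n : ℕ in atTop, ∃ K : ℕ,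
    (K : ℝ) ≤ (n : ℝ) ^ 3 * Real.log n / 4 ∧ ∀ N : ℕ, 0 < N → ∀ srt : SortRule (g1Dist n) N,
      failure edgeGen srt K (initial n, []) ≤
        ENNReal.ofReal ((n : ℝ) ^ 8 * Real.exp (-γ * N)) := by
  refine ⟨Real.exp (-56) / 1536 / 32, by positivity, ?_⟩
  filter_upwards [eventually_ge_atTop 40] with n hn
  have hn40 : (40 : ℝ) ≤ n := by exact_mod_cast hn
  have hlog : 1 ≤ Real.log n := by
    rw [Real.le_log_iff_exp_le (by linarith)]
    linarith [Real.exp_one_lt_d9]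
  have hlogn : Real.log n ≤ n := (Real.log_le_sub_one_of_pos (by linarith)).trans (by linarith)
  have h3 : (64000 : ℝ) ≤ (n : ℝ) ^ 3 := by
    calc (64000 : ℝ) = 40 ^ 3 := by norm_num
      _ ≤ (n : ℝ) ^ 3 := by gcongr
  -- Inversely proportional to the level, since the improvement rate is proportional to it; the sum
  -- is harmonic. Division by zero in ℕ gives budget 0 at level 0, and rounding down costs at most a
  -- factor 2, whence 32 in γ.
  set L : ℕ → ℕ := fun i => n ^ 3 / (16 * i) with hL
  have hsum : ((∑ i ∈ Finset.range (n + 1), L i : ℕ) : ℝ) ≤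
      (n : ℝ) ^ 3 / 16 * (1 + Real.log n) := by
    have hH := harmonic_le_one_add_log n
    rw [harmonic] at hH
    push_cast at hH
    rw [Finset.sum_range_succ']
    have h0 : L 0 = 0 := by simp [hL]
    rw [h0, add_zero]
    push_cast
    calc ∑ i ∈ Finset.range n, (L (i + 1) : ℝ)
        ≤ ∑ i ∈ Finset.range n, (n : ℝ) ^ 3 / 16 * ((i : ℝ) + 1)⁻¹ := by
          refine Finset.sum_le_sum fun i _ => ?_
          have := Nat.cast_div_le (α := ℝ) (m := n ^ 3) (n := 16 * (i + 1))
          refine this.trans (le_of_eq ?_)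
          push_cast
          field_simp
      _ = (n : ℝ) ^ 3 / 16 * ∑ i ∈ Finset.range n, ((i : ℝ) + 1)⁻¹ := by rw [Finset.mul_sum]
      _ ≤ _ := by gcongr
  have hmono : (n : ℝ) ^ 3 ≤ (n : ℝ) ^ 3 * Real.log n := le_mul_of_one_le_right (by positivity) hlog
  have hK : ((∑ i ∈ Finset.range (n + 1), L i + 1 : ℕ) : ℝ) ≤ (n : ℝ) ^ 3 * Real.log n / 4 := by
    rw [Nat.cast_add, Nat.cast_one]
    linarith
  refine ⟨_, hK, fun N hN srt => ?_⟩
  have hexp := Real.exp_pos (-56)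
  refine (isImproving_edgeGen hn).failure_le (by lia) hN ?_ (fun k hk hkn => ?_) ?_ srt
  · have : Real.exp (-56) ≤ Real.exp (-8) := Real.exp_le_exp.2 (by norm_num)
    linarith
  · have hk0 : (0 : ℝ) < k := by exact_mod_cast hk
    have hknR : (k : ℝ) ≤ n := by exact_mod_cast hkn
    have h1 := sub_one_le_natDiv (n ^ 3) (16 * k) (by lia)
    have h2 : (n : ℝ) ^ 3 / (32 * k) ≤ (L k : ℝ) := by
      refine le_trans ?_ h1
      push_cast
      have h4 : (n : ℝ) ^ 3 / (16 * k) = 2 * ((n : ℝ) ^ 3 / (32 * k)) := by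
        field_simp
        norm_num
      have h5 : 1 ≤ (n : ℝ) ^ 3 / (32 * k) := by
        rw [one_le_div (by positivity)]
        have h6 : 32 * (n : ℝ) ≤ (n : ℝ) ^ 3 := by
          rw [pow_succ]
          gcongr
          nlinarith
        linarith
      linarith
    calc Real.exp (-56) / 1536 / 32
        = Real.exp (-56) / 1536 * k / (n : ℝ) ^ 3 * ((n : ℝ) ^ 3 / (32 * k)) := by field_simp
      _ ≤ _ := by gcongr
  · have h1 : ((∑ i ∈ Finset.range (n + 1), L i : ℕ) : ℝ) ≤ (n : ℝ) ^ 7 := by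
      push_cast at hK
      have h2 : (n : ℝ) ^ 3 * Real.log n ≤ (n : ℝ) ^ 3 * n := by gcongr
      have h4 : (n : ℝ) ^ 3 * n = (n : ℝ) ^ 4 := by ring
      have h7 : (n : ℝ) ^ 4 ≤ (n : ℝ) ^ 7 := pow_le_pow_right₀ (by linarith) (by norm_num)
      have h8 : (0 : ℝ) ≤ (n : ℝ) ^ 4 := by positivity
      push_cast
      linarith
    exact_mod_cast h1

/-- Rewrite n^8 exp(-γN) as n to the power 8 - γN/ln n. -/
theorem atLeastOneMinusSuperpoly_of_le {N : ℕ → ℕ}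
    (hN : Tendsto (fun n : ℕ => (N n : ℝ) / Real.log n) atTop atTop) {γ : ℝ} (hγ : 0 < γ)
    {q : ℕ → ℝ} (h : ∀ᶠ n : ℕ in atTop, 1 - (n : ℝ) ^ 8 * Real.exp (-γ * N n) ≤ q n) :
    AtLeastOneMinusSuperpoly q := by
  refine ⟨fun n => γ * ((N n : ℝ) / Real.log n) - 8,
    tendsto_atTop_add_const_right _ _ (hN.const_mul_atTop hγ), ?_⟩
  filter_upwards [h, eventually_ge_atTop 2] with n hn h2
  have h2' : (2 : ℝ) ≤ n := by exact_mod_cast h2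
  have hlog : 0 < Real.log n := Real.log_pos (by linarith)
  refine le_trans (le_of_eq ?_) hn
  have h3 : -(γ * ((N n : ℝ) / Real.log n) - 8) = 8 + -(γ * ((N n : ℝ) / Real.log n)) := by ring
  rw [h3, Real.rpow_add (by linarith)]
  congr 2
  · exact_mod_cast Real.rpow_natCast (n : ℝ) 8
  · rw [Real.rpow_def_of_pos (by linarith)]
    congr 1
    field_simp

theorem eventually_pos_of_tendsto {N : ℕ → ℕ}
    (hN : Tendsto (fun n : ℕ => (N n : ℝ) / Real.log n) atTop atTop) :
    ∀ᶠ n : ℕ in atTop, 0 < N n := by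
  filter_upwards [hN.eventually_gt_atTop 0] with n hn
  rw [Nat.pos_iff_ne_zero]
  intro h
  simp [h] at hn

theorem tendsto_log_natCast : Tendsto (fun n : ℕ => Real.log n) atTop atTop :=
  Real.tendsto_log_atTop.comp tendsto_natCast_atTop_atTop

theorem tendsto_of_eq_log_sq {N : ℕ → ℕ}
    (hN : ∀ n : ℕ, N n = ⌊Real.log n ^ 2⌋₊ ∨ N n = ⌈Real.log n ^ 2⌉₊) :
    Tendsto (fun n : ℕ => (N n : ℝ) / Real.log n) atTop atTop := by
  refine tendsto_atTop_mono' _ ?_ (tendsto_atTop_add_const_right _ (-1) tendsto_log_natCast)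
  filter_upwards [tendsto_log_natCast.eventually_ge_atTop 1] with n hn
  have h1 : Real.log n ^ 2 - 1 ≤ N n := by
    rcases hN n with h | h
    · rw [h]
      exact (Nat.sub_one_lt_floor _).le
    · rw [h]
      linarith [Nat.le_ceil (Real.log n ^ 2)]
  rw [le_div_iff₀ (by linarith)]
  nlinarith

theorem natCast_le_of_eq_log_sq {N n : ℕ} (hN : N = ⌊Real.log n ^ 2⌋₊ ∨ N = ⌈Real.log n ^ 2⌉₊)
    (hn : 1 ≤ Real.log n) : (N : ℝ) ≤ 2 * Real.log n ^ 2 := by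
  rcases hN with h | h
  · rw [h]
    have := Nat.floor_le (sq_nonneg (Real.log n))
    nlinarith
  · rw [h]
    have := Nat.ceil_lt_add_one (sq_nonneg (Real.log n))
    nlinarith

/-- The spare factor 1/4 in the iteration bound absorbs the rounding of the sample size, which is at
most 2 (ln n)^2 once ln n ≥ 1. -/
theorem atLeastOneMinusSuperpoly_probRuntime
    {gen : ∀ n, (Fin n → Fin n → ℝ) → PMF (Finset (Sym2 (Fin n)))} {γ : ℝ} (hγ : 0 < γ)
    {b : ℕ → ℝ} (hb : ∀ n, 0 ≤ b n)
    (h : ∀ᶠ n : ℕ in atTop, ∃ K : ℕ, (K : ℝ) ≤ b n / 4 ∧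
      ∀ N : ℕ, 0 < N → ∀ srt : SortRule (g1Dist n) N,
        failure (gen n) srt K (initial n, []) ≤
          ENNReal.ofReal ((n : ℝ) ^ 8 * Real.exp (-γ * N))) {N : ℕ → ℕ}
    (hN : ∀ n : ℕ, N n = ⌊Real.log n ^ 2⌋₊ ∨ N n = ⌈Real.log n ^ 2⌉₊)
    (srt : ∀ n, SortRule (g1Dist n) (N n)) :
    AtLeastOneMinusSuperpoly fun n =>
      probRuntime (gen n) (srt n) ⌊b n * Real.log n ^ 2⌋₊ := by
  have hlim := tendsto_of_eq_log_sq hN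
  refine atLeastOneMinusSuperpoly_of_le hlim hγ ?_
  filter_upwards [h, eventually_pos_of_tendsto hlim,
    tendsto_log_natCast.eventually_ge_atTop 1] with n ⟨K, hK, hfail⟩ hpos hlog
  have hNle := natCast_le_of_eq_log_sq (hN n) hlog
  have hsq : 1 ≤ Real.log n ^ 2 := one_le_pow₀ hlog
  refine one_sub_le_probRuntime (K := K) ?_ ?_ (by positivity) (hfail _ hpos _)
  · refine Nat.le_floor ?_
    have := le_mul_of_one_le_right (hb n) hsq
    have := hb n
    linarith
  · refine Nat.le_floor ?_
    push_cast
    have h1 : (K : ℝ) * N n ≤ b n / 4 * (2 * Real.log n ^ 2) := by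
      have := hb n
      gcongr
    have h2 : 0 ≤ b n * Real.log n ^ 2 := mul_nonneg (hb n) (by linarith)
    linarith

theorem atLeastOneMinusSuperpoly_probIterations
    {gen : ∀ n, (Fin n → Fin n → ℝ) → PMF (Finset (Sym2 (Fin n)))} {γ : ℝ} (hγ : 0 < γ)
    {b : ℕ → ℝ} (hb : ∀ n, 0 ≤ b n)
    (h : ∀ᶠ n : ℕ in atTop, ∃ K : ℕ, (K : ℝ) ≤ b n / 4 ∧
      ∀ N : ℕ, 0 < N → ∀ srt : SortRule (g1Dist n) N,
        failure (gen n) srt K (initial n, []) ≤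
          ENNReal.ofReal ((n : ℝ) ^ 8 * Real.exp (-γ * N))) {N : ℕ → ℕ}
    (hN : Tendsto (fun n : ℕ => (N n : ℝ) / Real.log n) atTop atTop)
    (srt : ∀ n, SortRule (g1Dist n) (N n)) :
    AtLeastOneMinusSuperpoly fun n => probIterations (gen n) (srt n) ⌊b n⌋₊ := by
  refine atLeastOneMinusSuperpoly_of_le hN hγ ?_
  filter_upwards [h, eventually_pos_of_tendsto hN] with n ⟨K, hK, hfail⟩ hpos
  refine one_sub_le_probIterations (K := K) (Nat.le_floor ?_) (by positivity) (hfail _ hpos _)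
  have := hb n
  linarith

end Asymptotics

end CrossEntropyTSP

theorem mainTheorem3 :
    -- on `G₁`, the cycle `(1, 2, …, n)` is the unique optimal solution
    (∀ n : ℕ, 3 ≤ n → ∀ s : Finset (Sym2 (Fin n)),
      CrossEntropyTSP.IsOptimal (CrossEntropyTSP.g1Dist n) s ↔
        s = CrossEntropyTSP.g1Optimum n) ∧
    -- number of iterations for a sample size in `ω(ln n)`
    (∀ (N : ℕ → ℕ), Tendsto (fun n : ℕ => (N n : ℝ) / Real.log n) atTop atTop →
      ∀ srt : ∀ n, CrossEntropyTSP.SortRule (CrossEntropyTSP.g1Dist n) (N n),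
        CrossEntropyTSP.AtLeastOneMinusSuperpoly (fun n =>
          CrossEntropyTSP.probIterations CrossEntropyTSP.vertexGen (srt n) (n ^ 6)) ∧
        CrossEntropyTSP.AtLeastOneMinusSuperpoly (fun n =>
          CrossEntropyTSP.probIterations CrossEntropyTSP.edgeGen (srt n)
            ⌊(n : ℝ) ^ 3 * Real.log n⌋₊)) ∧
    -- runtime for the sample size `(ln n)²`, rounded down or up
    (∀ (N : ℕ → ℕ),
      (∀ n : ℕ, N n = ⌊Real.log n ^ 2⌋₊ ∨ N n = ⌈Real.log n ^ 2⌉₊) →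
      ∀ srt : ∀ n, CrossEntropyTSP.SortRule (CrossEntropyTSP.g1Dist n) (N n),
        CrossEntropyTSP.AtLeastOneMinusSuperpoly (fun n =>
          CrossEntropyTSP.probRuntime CrossEntropyTSP.vertexGen (srt n)
            ⌊(n : ℝ) ^ 6 * Real.log n ^ 2⌋₊) ∧
        CrossEntropyTSP.AtLeastOneMinusSuperpoly (fun n =>
          CrossEntropyTSP.probRuntime CrossEntropyTSP.edgeGen (srt n)
            ⌊(n : ℝ) ^ 3 * Real.log n ^ 3⌋₊)) := by
  obtain ⟨γ, hγ, hv⟩ := CrossEntropyTSP.exists_failure_vertexGen_le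
  obtain ⟨γ', hγ', he⟩ := CrossEntropyTSP.exists_failure_edgeGen_le
  have hlog : ∀ n : ℕ, 0 ≤ Real.log n := fun n => Real.log_natCast_nonneg n
  have hb : ∀ n : ℕ, (0 : ℝ) ≤ (n : ℝ) ^ 3 * Real.log n := fun n =>
    mul_nonneg (by positivity) (hlog n)
  have hb' : ∀ n : ℕ, (0 : ℝ) ≤ (n : ℝ) ^ 6 := fun n => by positivity
  refine ⟨fun n hn s => CrossEntropyTSP.isOptimal_iff hn s, fun N hN srt => ⟨?_, ?_⟩,
    fun N hN srt => ⟨?_, ?_⟩⟩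
  · have h := CrossEntropyTSP.atLeastOneMinusSuperpoly_probIterations hγ hb' hv hN srt
    have hfloor : ∀ n : ℕ, ⌊(n : ℝ) ^ 6⌋₊ = n ^ 6 := fun n => by
      rw [← Nat.cast_pow, Nat.floor_natCast]
    simpa only [hfloor] using h
  · exact CrossEntropyTSP.atLeastOneMinusSuperpoly_probIterations hγ' hb he hN srt
  · exact CrossEntropyTSP.atLeastOneMinusSuperpoly_probRuntime hγ hb' hv hN srt
  · have h := CrossEntropyTSP.atLeastOneMinusSuperpoly_probRuntime hγ' hb he hN srt
    have hcube : ∀ n : ℕ, (n : ℝ) ^ 3 * Real.log n * Real.log n ^ 2 =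
        (n : ℝ) ^ 3 * Real.log n ^ 3 := fun n => by ring
    simpa only [hcube] using h
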